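/- **Notation.** Let $D=\{x\in\mathbb R^3:|x|<1\}$ and write $x=r\omega$ with $r=|x|$, $|\omega|=1$. For an integer $n\ge 1$ let $j_n$ be the spherical Bessel function $j_n(x)=\sum_{l\ge 0}\frac{(-1)^l x^{n+2l}}{2^l\,l!\,(2n+2l+1)!!}$. For an integer $m$ with $|m|\le n$ let $Y_n^m$ be the real $L^2(\mathbb S^2)$-normalized spherical harmonic, i.e. the product of $\sqrt{\tfrac{2n+1}{4\pi}\tfrac{(n-|m|)!}{(n+|m|)!}}\,(\sin\theta)^{|m|}P_n^{(|m|)}(\cos\theta)$ ($P_n$ the Legendre polynomial, $P_n^{(|m|)}$ its $|m|$-th derivative) with $\sqrt2\cos m\varphi$, $1$ or $\sqrt2\sin|m|\varphi$ according as $m>0$, $m=0$ or $m<0$. Put $U_n^m=\frac1{\sqrt{n(n+1)}}\nabla_{\mathbb S^2}Y_n^m$ and $V_n^m=\omega\times U_n^m$. For an open set $S$, $H(\mathrm{curl},S)$ is the space of fields in $L^2(S;\mathbb C^3)$ with weak curl in $L^2$; tangential traces on the boundary are defined by Green's formula, as is the flux of a divergence-free field through a part of the boundary; $H_0(\mathrm{curl},S)$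 is the subspace of fields with zero tangential trace. A bounded Lipschitz domain is a bounded connected open set that near each boundary point is, in suitable orthonormal coordinates, the region below the graph of a Lipschitz function. **Theorem.** Let $n\ge1$, $m\in\mathbb Z$ with $|m|\le n$, let $k>0$ be a zero of $j_n$, and define $$\mathbf E_+(r\omega)=\frac{\sqrt{n(n+1)}}{j_n(k)+kj_n'(k)}\,\frac{j_n(kr)}{r}\,Y_n^m(\omega)\,\omega+\frac{1}{j_n(k)+kj_n'(k)}\,\frac{j_n(kr)+kr\,j_n'(kr)}{r}\,U_n^m(\omega),$$ $$\mathbf H_+(r\omega)=ik\,\frac{j_n(kr)}{j_n(k)+kj_n'(k)}\,V_n^m(\omega).$$ (a) $\mathbf E_+,\mathbf H_+\in H(\mathrm{curl},D)$ satisfy $\nabla\times\mathbf E_+=ik\mathbf H_+$ and $\nabla\times\mathbf H_+=-ik\mathbf E_+$ weakly in $D$, and $\mathbf E_+\cdot\nu_D=0$ and $\mathbf H_+=0$ on $\partial D$. Let moreover $\Omega\subset\mathbb R^3$ be any bounded Lipschitz domain with $\overline D\subset\Omega$. Consider the problem of finding $\mathbf E_-\in H(\mathrm{curl},\Omega\setminus\overline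 D)$ with $$\nabla\times\nabla\times\mathbf E_-=0,\quad \operatorname{div}\mathbf E_-=0\ \text{ in }\Omega\setminus\overline D,\qquad \mathbf E_-\times\nu_D=\mathbf E_+\times\nu_D\ \text{ on }\partial D,\qquad \mathbf E_-\times\nu_\Omega=0\ \text{ on }\partial\Omega,\qquad \int_{\partial\Omega}\mathbf E_-\cdot\nu_\Omega\,d\mathcal H^2=0,$$ where the first equation means $\int_{\Omega\setminus\overline D}\nabla\times\mathbf E_-\cdot\overline{\nabla\times\mathbf F}\,dx=0$ for all $\mathbf F\in H_0(\mathrm{curl},\Omega\setminus\overline D)$ and the second is understood in the sense of distributions. (b) This problem has a solution of the form $\mathbf E_-=\nabla h$ with $h\in H^1(\Omega\setminus\overline D)$ (hence $h$ is harmonic in $\Omega\setminus\overline D$) and $h$ equal to a constant on $\partial\Omega$. If $\partial\Omega$ is connected, the solution $\mathbf E_-$ is unique. (c) For every solution $\mathbf E_-$, one has $\mathbf H_-:=\frac1{ik}\nabla\times\mathbf E_-=0$ in $\Omega\setminus\overline D$. The fields $\mathbf E$, equal to $\mathbf E_+$ in $D$ and to $\mathbf E_-$ in $\Omega\setminus\overline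 D$, and $\mathbf H$, equal to $\mathbf H_+$ in $D$ and to $0$ in $\Omega\setminus\overline D$, satisfy $\mathbf E\in H_0(\mathrm{curl},\Omega)$ and $\nabla\times\mathbf E=ik\mathbf H$ in $\Omega$; moreover $\mathbf E$ does not vanish almost everywhere in $D$, and it is an eigenfunction with eigenvalue $k^2$ of the limiting problem $\nabla\times\nabla\times\mathbf E=\lambda 1_D\mathbf E$ in $\Omega$, $\mathbf E\times\nu_\Omega=0$ on $\partial\Omega$, that is, $$\int_\Omega\nabla\times\mathbf E\cdot\overline{\nabla\times\mathbf F}\,dx=k^2\int_D\mathbf E\cdot\overline{\mathbf F}\,dx\qquad\text{for all }\mathbf F\in H_0(\mathrm{curl},\Omega).$$ In particular, the eigenvalue $k^2$ and the fields $\mathbf E_+,\mathbf H_+$ do not depend on $\Omega$. -/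

import Mathlib

open MeasureTheory Metric
open scoped Matrix Topology Polynomial

noncomputable section

namespace CoreShell

/-! ### Vector calculus in three dimensions -/

/-- Physical space. -/
abbrev R3 := EuclideanSpace ℝ (Fin 3)

/-- Values of complex vector fields. -/
abbrev C3 := EuclideanSpace ℂ (Fin 3)

/-- The inclusion of real vectors into complex ones. -/
def toC3 (v : R3) : C3 := WithLp.toLp 2 fun i => (v i : ℂ)

/-- The (bilinear) dot product of complex vectors. -/
def dot (a b : C3) : ℂ := ∑ i, a i * b i

/-- The cross product of real vectors. -/
def cross (a b : R3) : R3 := WithLp.toLp 2 (a.ofLp ⨯₃ b.ofLp)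

/-- The partial derivative in the `j`-th coordinate direction. -/
def pderiv {F : Type*} [NormedAddCommGroup F] [NormedSpace ℝ F]
    (j : Fin 3) (f : R3 → F) (x : R3) : F :=
  fderiv ℝ f x (EuclideanSpace.single j 1)

/-- The classical curl; the indices `i + 1`, `i + 2` are taken modulo 3. -/
def curl (φ : R3 → C3) (x : R3) : C3 :=
  WithLp.toLp 2 fun i => pderiv (i + 1) φ x (i + 2) - pderiv (i + 2) φ x (i + 1)

/-- The classical divergence. -/
def divergence (φ : R3 → C3) (x : R3) : ℂ := ∑ i, pderiv i φ x i

/-- The classical gradient of a complex-valued function. -/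
def grad (ψ : R3 → ℂ) (x : R3) : C3 := WithLp.toLp 2 fun i => pderiv i ψ x

/-! ### Weak curl, tangential traces, and the spaces `H(curl)` and `H₀(curl)` -/

/-- Smooth functions (or vector fields) on the whole space with compact support. -/
def IsTest {F : Type*} [NormedAddCommGroup F] [NormedSpace ℝ F] (φ : R3 → F) : Prop :=
  ContDiff ℝ (⊤ : ℕ∞) φ ∧ HasCompactSupport φ

/-- The Green pairing of `u`, with (weak) curl `v` on `S`, against a test field `φ`:
`∫_S (v · φ - u · curl φ)`. It equals `∫_{∂S} (ν × u) · φ`, with `ν` the outward normal of `S`,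
when everything is smooth, and it is the definition of the tangential trace of `u`
in `H(curl, S)` in general. -/
def tangentialPairing (S : Set R3) (u v : R3 → C3) (φ : R3 → C3) : ℂ :=
  ∫ x in S, (dot (v x) (φ x) - dot (u x) (curl φ x))

/-- `u ∈ H(curl, S)` and its weak curl on the open set `S` is `v`. -/
def HCurl (S : Set R3) (u v : R3 → C3) : Prop :=
  MemLp u 2 (volume.restrict S) ∧ MemLp v 2 (volume.restrict S) ∧
    ∀ φ : R3 → C3, IsTest φ → tsupport φ ⊆ S → tangentialPairing S u v φ = 0

/-- `u ∈ H₀(curl, S)` and its weak curl on `S` is `v`: as the test fields need not vanish on the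
boundary, Green's formula says both that `curl u = v` in `S` and that `u × ν = 0` on `∂S`. -/
def HCurlZero (S : Set R3) (u v : R3 → C3) : Prop :=
  MemLp u 2 (volume.restrict S) ∧ MemLp v 2 (volume.restrict S) ∧
    ∀ φ : R3 → C3, IsTest φ → tangentialPairing S u v φ = 0

/-! ### Lipschitz domains -/

/-- A bounded Lipschitz domain: a bounded connected open set which, near each of its boundary
points, is the part of space strictly below the graph of a Lipschitz function, in suitable
orthonormal coordinates (`v` is the vertical direction, and `x - ⟪v, x⟫ v` the horizontal part
of `x`). -/
def IsLipschitzDomain (Ω : Set R3) : Prop :=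
  IsOpen Ω ∧ IsConnected Ω ∧ Bornology.IsBounded Ω ∧
    ∀ p ∈ frontier Ω, ∃ v : R3, ‖v‖ = 1 ∧ ∃ (K : NNReal) (g : R3 → ℝ), LipschitzWith K g ∧
      ∃ ρ > 0, ∀ x ∈ ball p ρ, x ∈ Ω ↔ inner ℝ v x < g (x - inner ℝ v x • v)

/-! ### The core, the shell, and the boundary value problem in the shell -/

/-- The inclusion `D`: the open unit ball. -/
def core : Set R3 := ball 0 1

/-- The shell `Ω \ D̄`. -/
def shell (Ω : Set R3) : Set R3 := Ω \ closedBall 0 1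

/-- The field `E₋` is a weak solution in the shell of `curl curl E₋ = 0` and `div E₋ = 0`
with `E₋ × ν = E₊ × ν` on `∂D`, `E₋ × ν = 0` on `∂Ω`, and zero flux through `∂Ω`. -/
def IsShellField (Ω : Set R3) (Ep Em : R3 → C3) : Prop :=
  ∃ Cp Cm : R3 → C3, HCurl core Ep Cp ∧ HCurl (shell Ω) Em Cm ∧
    -- `curl curl E₋ = 0` in the shell
    (∀ F G : R3 → C3, HCurlZero (shell Ω) F G →
      ∫ x in shell Ω, inner ℂ (G x) (Cm x) = 0) ∧
    -- `div E₋ = 0` in the shell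
    (∀ ψ : R3 → ℂ, IsTest ψ → tsupport ψ ⊆ shell Ω →
      ∫ x in shell Ω, dot (Em x) (grad ψ x) = 0) ∧
    -- the tangential traces on `∂D` agree (the two outward normals there are opposite)
    (∀ φ : R3 → C3, IsTest φ → tsupport φ ⊆ Ω →
      -tangentialPairing (shell Ω) Em Cm φ = tangentialPairing core Ep Cp φ) ∧
    -- the tangential trace on `∂Ω` vanishes
    (∀ φ : R3 → C3, IsTest φ → Disjoint (tsupport φ) (closedBall 0 1) →
      tangentialPairing (shell Ω) Em Cm φ = 0) ∧
    -- the flux `∫_{∂Ω} E₋ · ν` vanishes, by the divergence theorem applied to `ψ E₋`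
    (∀ ψ : R3 → ℂ, IsTest ψ → (∀ᶠ x in 𝓝ˢ (frontier Ω), ψ x = 1) →
      Disjoint (tsupport ψ) (closedBall 0 1) →
      ∫ x in shell Ω, dot (Em x) (grad ψ x) = 0)

/-- `h ∈ H¹(Ω \ D̄)` has weak gradient `u` in the shell and equals the constant `c` on `∂Ω`:
the test fields vanish near `D̄`, but need not vanish on `∂Ω`. -/
def IsShellPotential (Ω : Set R3) (h : R3 → ℂ) (c : ℂ) (u : R3 → C3) : Prop :=
  MemLp h 2 (volume.restrict (shell Ω)) ∧ MemLp u 2 (volume.restrict (shell Ω)) ∧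
    ∀ φ : R3 → C3, IsTest φ → Disjoint (tsupport φ) (closedBall 0 1) →
      ∫ x in shell Ω, (h x - c) * divergence φ x = -∫ x in shell Ω, dot (u x) (φ x)

/-- `E` is an eigenfunction, with eigenvalue `lam`, of the limiting problem
`curl curl E = lam 1_D E` in `Ω`, `E × ν = 0` on `∂Ω`, in its weak form on `H₀(curl, Ω)`.
As every gradient of a test function supported in the shell solves this for every `lam`,
nontriviality is required in `D`. -/
def IsLimitEigenpair (Ω : Set R3) (E : R3 → C3) (lam : ℂ) : Prop :=
  ¬ (∀ᵐ x ∂(volume.restrict core), E x = 0) ∧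
    ∃ C : R3 → C3, HCurlZero Ω E C ∧ ∀ F G : R3 → C3, HCurlZero Ω F G →
      ∫ x in Ω, inner ℂ (G x) (C x) = lam * ∫ x in core, inner ℂ (F x) (E x)

/-! ### Spherical Bessel functions and spherical harmonics -/

/-- The spherical Bessel function of the first kind,
`j_n(x) = ∑_l (-1)^l x^(n+2l) / (2^l l! (2n+2l+1)!!)`. -/
def sphBessel (n : ℕ) (x : ℝ) : ℝ :=
  ∑' l : ℕ, (-1) ^ l * x ^ (n + 2 * l) / (2 ^ l * (l.factorial : ℝ) * (Nat.doubleFactorial (2 * n + 2 * l + 1) : ℝ))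

/-- The Legendre polynomial `P_n`, by Rodrigues' formula. -/
def legendreP (n : ℕ) : ℝ[X] :=
  Polynomial.C ((1 : ℝ) / (2 ^ n * (n.factorial : ℝ))) *
    Polynomial.derivative^[n] ((Polynomial.X ^ 2 - 1) ^ n)

/-- The real spherical harmonic `Y_n^m`, `|m| ≤ n`, normalized in `L²(S²)`. In spherical
coordinates it is a constant times `(sin θ)^|m| P_n^{(|m|)}(cos θ)` times `cos (m φ)` for `m ≥ 0`
or `sin (|m| φ)` for `m < 0`, where `(sin θ)^|m| e^{i |m| φ} = (ω₀ + i ω₁)^|m|`. -/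
def sphHarmonic (n : ℕ) (m : ℤ) (ω : R3) : ℝ :=
  √((2 * n + 1) / (4 * Real.pi) * (((n - m.natAbs).factorial : ℝ) / ((n + m.natAbs).factorial : ℝ))) *
    (if m = 0 then 1 else √2) *
    (Polynomial.derivative^[m.natAbs] (legendreP n)).eval (ω 2) *
    (if 0 ≤ m then (((ω 0 : ℂ) + ω 1 * Complex.I) ^ m.natAbs).re
      else (((ω 0 : ℂ) + ω 1 * Complex.I) ^ m.natAbs).im)

/-- The surface gradient on the unit sphere: the gradient of the extension of `Y` which is
constant along rays. -/
def surfaceGrad (Y : R3 → ℝ) (ω : R3) : R3 := gradient (fun x => Y (‖x‖⁻¹ • x)) ω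

/-- The tangential vector spherical harmonic `U_n^m`. -/
def vecU (n : ℕ) (m : ℤ) (ω : R3) : R3 :=
  (√((n : ℝ) * (n + 1)))⁻¹ • surfaceGrad (sphHarmonic n m) ω

/-- The tangential vector spherical harmonic `V_n^m`. -/
def vecV (n : ℕ) (m : ℤ) (ω : R3) : R3 := cross ω (vecU n m ω)

/-- The electric field in the ball; here `r = ‖x‖` and `ω = x / r`. -/
def Eplus (n : ℕ) (m : ℤ) (k : ℝ) (x : R3) : C3 :=
  let r := ‖x‖
  let ω := r⁻¹ • x
  let d := sphBessel n k + k * deriv (sphBessel n) k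
  toC3 ((√((n : ℝ) * (n + 1)) / d * (sphBessel n (k * r) / r) * sphHarmonic n m ω) • ω +
    (1 / d * ((sphBessel n (k * r) + k * r * deriv (sphBessel n) (k * r)) / r)) • vecU n m ω)

/-- The magnetic field in the ball; here `r = ‖x‖` and `ω = x / r`. -/
def Hplus (n : ℕ) (m : ℤ) (k : ℝ) (x : R3) : C3 :=
  let r := ‖x‖
  let ω := r⁻¹ • x
  let d := sphBessel n k + k * deriv (sphBessel n) k
  (Complex.I * k * ((sphBessel n (k * r) / d : ℝ) : ℂ)) • toC3 (vecV n m ω)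

/-- The field equal to `Ep` in `D` and to `Em` in the shell. -/
def glue (Ω : Set R3) (Ep Em : R3 → C3) : R3 → C3 :=
  core.indicator Ep + (shell Ω).indicator Em

end CoreShell

end

open CoreShell

/-! Let p = r^n Y_n^m be the solid harmonic and write j_n(kr) = r^n f(r²) with f smooth. Away from
the origin, H₊ is a constant multiple of M = f(r²) x × ∇p, and E₊ is a constant multiple of -curl M
(`Hplus_eq`, `Eplus_eq`). Since p is harmonic and homogeneous and 4sf'' + (6 + 4n)f' + k²f = 0,
these are smooth Maxwell fields (`curl_magField`, `curl_elecField`). The hypothesis j_n(k) = 0 says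
f(1) = 0, so H₊ and the normal component of E₊ vanish on the sphere. The zero is simple
(`deriv_radialProfile_one_ne`), so the denominators do not vanish.

The resonance rests on two facts. As M vanishes on the sphere, Green's formula in D against F ∈
H₀(curl, Ω) has no boundary term (`tangentialPairing_core_radial`), which is the eigenvalue equation
once curl E = 0 in the shell. And E₊ is a radial field plus a gradient ∇G (`elecField_eq`), so its
tangential trace is that of a gradient and the shell can be filled with a curl-free field, whatever
Ω is.

For that field, cut G off to a function g supported in Ω, and subtract from ∇g its L² projection
onto the closure of the gradients of test functions supported in Ω and constant near the closed
ball. Orthogonality to these gradients encodes both div E₋ = 0 and the zero flux, because the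
constant is free. The Poincaré inequality gives the potential (`exists_isTraceLift`,
`exists_isShellField`). Any solution differs from ∇g by a field of H₀(curl) with the same curl; this
field is admissible in the equation, so the curl is zero (`IsShellField.curl_free`).

For uniqueness, extend the difference of two solutions by zero. It is a compactly supported
curl-free field on the whole space, hence the gradient of some h in L² (`exists_isWeakGrad`). Off
the shell, h is constant near the ball and, by connectedness of ∂Ω, near ∂Ω
(`exists_const_of_isPreconnected`). Once the constants are removed with cutoffs, mollification along
outer cones of the boundary shows that the field is orthogonal to the corrected gradient
(`integral_dot_eq_zero_of_vanishing`); the jump between the constants is multiplied by the flux,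
which is zero. So the field is orthogonal to itself. All traces are pairings with test fields, and
no surface measure occurs. -/

namespace CoreShell

/-! ### Calculus of partial derivatives. -/

section Pderiv

variable {F : Type*} [NormedAddCommGroup F] [NormedSpace ℝ F]

/-- The standard basis vectors of space. -/
noncomputable abbrev basisVec (j : Fin 3) : R3 := EuclideanSpace.single j 1

lemma _root_.HasFDerivAt.pderiv_eq {f : R3 → F} {L : R3 →L[ℝ] F} {x : R3} (h : HasFDerivAt f L x)
    (j : Fin 3) : pderiv j f x = L (basisVec j) := by
  rw [pderiv, h.fderiv]

lemma contDiff_pderiv {f : R3 → F} (hf : ContDiff ℝ (⊤ : ℕ∞) f) (j : Fin 3) :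
    ContDiff ℝ (⊤ : ℕ∞) (pderiv j f) :=
  (hf.fderiv_right (m := (⊤ : ℕ∞)) le_rfl).clm_apply contDiff_const

lemma pderiv_add {f g : R3 → F} {x : R3} (hf : DifferentiableAt ℝ f x)
    (hg : DifferentiableAt ℝ g x) (j : Fin 3) :
    pderiv j (fun y => f y + g y) x = pderiv j f x + pderiv j g x := by
  simp [pderiv, fderiv_fun_add hf hg]

lemma pderiv_sub {f g : R3 → F} {x : R3} (hf : DifferentiableAt ℝ f x)
    (hg : DifferentiableAt ℝ g x) (j : Fin 3) :
    pderiv j (fun y => f y - g y) x = pderiv j f x - pderiv j g x := by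
  simp [pderiv, fderiv_fun_sub hf hg]

lemma pderiv_const (c : F) (j : Fin 3) (x : R3) : pderiv j (fun _ => c) x = 0 := by
  simp [pderiv]

lemma pderiv_sum {ι : Type*} (s : Finset ι) {f : ι → R3 → F} {x : R3}
    (hf : ∀ i ∈ s, DifferentiableAt ℝ (f i) x) (j : Fin 3) :
    pderiv j (fun y => ∑ i ∈ s, f i y) x = ∑ i ∈ s, pderiv j (f i) x := by
  simp [pderiv, fderiv_fun_sum hf]

lemma pderiv_mul {𝔸 : Type*} [NormedCommRing 𝔸] [NormedAlgebra ℝ 𝔸] {f g : R3 → 𝔸} {x : R3}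
    (hf : DifferentiableAt ℝ f x) (hg : DifferentiableAt ℝ g x) (j : Fin 3) :
    pderiv j (fun y => f y * g y) x = pderiv j f x * g x + f x * pderiv j g x := by
  simp [pderiv, fderiv_fun_mul hf hg]
  ring

lemma pderiv_const_mul {𝔸 : Type*} [NormedCommRing 𝔸] [NormedAlgebra ℝ 𝔸] {f : R3 → 𝔸} {x : R3}
    (c : 𝔸) (hf : DifferentiableAt ℝ f x) (j : Fin 3) :
    pderiv j (fun y => c * f y) x = c * pderiv j f x := by
  simp [pderiv_mul (differentiableAt_const c) hf, pderiv_const]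

lemma pderiv_clm_comp {G : Type*} [NormedAddCommGroup G] [NormedSpace ℝ G] (L : F →L[ℝ] G)
    {f : R3 → F} {x : R3} (hf : DifferentiableAt ℝ f x) (j : Fin 3) :
    pderiv j (fun y => L (f y)) x = L (pderiv j f x) :=
  (L.hasFDerivAt.comp x hf.hasFDerivAt).pderiv_eq j

lemma pderiv_ofReal {f : R3 → ℝ} {x : R3} (hf : DifferentiableAt ℝ f x) (j : Fin 3) :
    pderiv j (fun y => (f y : ℂ)) x = ((pderiv j f x : ℝ) : ℂ) :=
  pderiv_clm_comp Complex.ofRealCLM hf j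

lemma pderiv_conj {f : R3 → ℂ} {x : R3} (hf : DifferentiableAt ℝ f x) (j : Fin 3) :
    pderiv j (fun y => (starRingEnd ℂ) (f y)) x = (starRingEnd ℂ) (pderiv j f x) :=
  pderiv_clm_comp Complex.conjCLE.toContinuousLinearMap hf j

lemma pderiv_comp_deriv {f : R3 → ℝ} {g : ℝ → F} {x : R3} (hg : DifferentiableAt ℝ g (f x))
    (hf : DifferentiableAt ℝ f x) (j : Fin 3) :
    pderiv j (fun y => g (f y)) x = pderiv j f x • deriv g (f x) := by
  have := (hg.hasFDerivAt.comp x hf.hasFDerivAt).pderiv_eq j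
  simpa [pderiv, Function.comp_def] using this

lemma pderiv_apply_C3 {φ : R3 → C3} {x : R3} (h : DifferentiableAt ℝ φ x) (j i : Fin 3) :
    pderiv j φ x i = pderiv j (fun y => φ y i) x :=
  (pderiv_clm_comp ((EuclideanSpace.proj i : C3 →L[ℂ] ℂ).restrictScalars ℝ) h j).symm

lemma pderiv_coord (i j : Fin 3) (x : R3) :
    pderiv j (fun y : R3 => y i) x = if i = j then 1 else 0 := by
  have := ((EuclideanSpace.proj i : R3 →L[ℝ] ℝ).hasFDerivAt (x := x)).pderiv_eq j
  rw [show (fun y : R3 => y i) = ⇑(EuclideanSpace.proj i : R3 →L[ℝ] ℝ) from rfl, this]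
  simp [basisVec]

lemma pderiv_comm {f : R3 → F} (hf : ContDiff ℝ (⊤ : ℕ∞) f) (i j : Fin 3) (x : R3) :
    pderiv i (pderiv j f) x = pderiv j (pderiv i f) x := by
  have h2 : ContDiffAt ℝ 2 f x := (contDiff_infty.1 hf 2).contDiffAt
  have hs := h2.isSymmSndFDerivAt (by simp)
  have hd : DifferentiableAt ℝ (fderiv ℝ f) x :=
    ((hf.fderiv_right (m := (⊤ : ℕ∞)) le_rfl).differentiable (by simp)) x
  have key : ∀ a b : Fin 3, pderiv a (pderiv b f) x
      = fderiv ℝ (fderiv ℝ f) x (basisVec a) (basisVec b) := by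
    intro a b
    have := (hd.hasFDerivAt.clm_apply (hasFDerivAt_const (basisVec b) x)).pderiv_eq a
    simpa [show pderiv b f = fun y => fderiv ℝ f y (basisVec b) from rfl] using this
  rw [key, key]
  exact hs _ _

lemma pderiv_congr_of_eventuallyEq {f g : R3 → F} {x : R3} (h : f =ᶠ[𝓝 x] g) (j : Fin 3) :
    pderiv j f x = pderiv j g x := by
  rw [pderiv, pderiv, h.fderiv_eq]

lemma support_pderiv_subset (f : R3 → F) (j : Fin 3) :
    Function.support (pderiv j f) ⊆ tsupport f := by
  intro x hx
  by_contra hn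
  apply hx
  rw [pderiv_congr_of_eventuallyEq (notMem_tsupport_iff_eventuallyEq.1 hn)]
  exact pderiv_const 0 j x

lemma tsupport_pderiv_subset (f : R3 → F) (j : Fin 3) :
    tsupport (pderiv j f) ⊆ tsupport f :=
  closure_minimal (support_pderiv_subset f j) (isClosed_tsupport f)

end Pderiv

/-! ### Test functions and integration by parts. -/

section Test

variable {F : Type*} [NormedAddCommGroup F] [NormedSpace ℝ F]

lemma IsTest.differentiable {φ : R3 → F} (h : IsTest φ) : Differentiable ℝ φ :=
  h.1.differentiable (by simp)

lemma IsTest.continuous {φ : R3 → F} (h : IsTest φ) : Continuous φ := h.1.continuous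

lemma IsTest.pderiv {φ : R3 → F} (h : IsTest φ) (j : Fin 3) : IsTest (pderiv j φ) :=
  ⟨contDiff_pderiv h.1 j, h.2.of_isClosed_subset (isClosed_tsupport _) (tsupport_pderiv_subset φ j)⟩

lemma IsTest.integrable {φ : R3 → F} (h : IsTest φ) : Integrable φ :=
  h.continuous.integrable_of_hasCompactSupport h.2

lemma IsTest.memLp {φ : R3 → F} (h : IsTest φ) (p : ENNReal) : MemLp φ p :=
  h.continuous.memLp_of_hasCompactSupport h.2

lemma IsTest.of_tsupport_subset {G : Type*} [NormedAddCommGroup G] [NormedSpace ℝ G]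
    {φ : R3 → F} {ψ : R3 → G} (h : IsTest φ) (hψ : ContDiff ℝ (⊤ : ℕ∞) ψ)
    (hs : tsupport ψ ⊆ tsupport φ) : IsTest ψ :=
  ⟨hψ, h.2.of_isClosed_subset (isClosed_tsupport _) hs⟩

lemma IsTest.add {φ ψ : R3 → F} (h : IsTest φ) (h' : IsTest ψ) : IsTest (fun x => φ x + ψ x) :=
  ⟨h.1.add h'.1, h.2.add h'.2⟩

lemma IsTest.sub {φ ψ : R3 → F} (h : IsTest φ) (h' : IsTest ψ) : IsTest (fun x => φ x - ψ x) :=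
  ⟨h.1.sub h'.1, h.2.sub h'.2⟩

lemma IsTest.mul_left {φ ψ : R3 → ℂ} (h : ContDiff ℝ (⊤ : ℕ∞) φ) (h' : IsTest ψ) :
    IsTest (fun x => φ x * ψ x) :=
  ⟨h.mul h'.1, h'.2.mul_left⟩

lemma IsTest.mul_right {φ ψ : R3 → ℂ} (h : IsTest φ) (h' : ContDiff ℝ (⊤ : ℕ∞) ψ) :
    IsTest (fun x => φ x * ψ x) :=
  ⟨h.1.mul h', h.2.mul_right⟩

lemma IsTest.conj {φ : R3 → ℂ} (h : IsTest φ) : IsTest (fun x => (starRingEnd ℂ) (φ x)) :=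
  ⟨Complex.conjCLE.contDiff.comp h.1, h.2.comp_left (map_zero _)⟩

lemma IsTest.ofReal {φ : R3 → ℝ} (h : IsTest φ) : IsTest (fun x => (φ x : ℂ)) :=
  ⟨Complex.ofRealCLM.contDiff.comp h.1, h.2.comp_left (g := fun t : ℝ => (t : ℂ)) (by simp)⟩

lemma contDiff_C3_iff {n : WithTop ℕ∞} {φ : R3 → C3} :
    ContDiff ℝ n φ ↔ ∀ i, ContDiff ℝ n (fun x => φ x i) := by
  constructor
  · intro h i
    exact ((EuclideanSpace.proj i : C3 →L[ℂ] ℂ).restrictScalars ℝ).contDiff.comp h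
  · intro h
    have e := ((PiLp.continuousLinearEquiv 2 ℂ (fun _ : Fin 3 => ℂ)).symm.toContinuousLinearMap.restrictScalars ℝ).contDiff (n := n)
    exact e.comp (contDiff_pi.2 h)

lemma IsTest.apply {φ : R3 → C3} (h : IsTest φ) (i : Fin 3) : IsTest (fun x => φ x i) :=
  ⟨contDiff_C3_iff.1 h.1 i, h.2.comp_left (g := fun v : C3 => v i) (by simp)⟩

lemma IsTest.toLp {f : Fin 3 → R3 → ℂ} (h : ∀ i, IsTest (f i)) :
    IsTest (fun x => (WithLp.toLp 2 fun i => f i x : C3)) := by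
  refine ⟨contDiff_C3_iff.2 fun i => (h i).1, ?_⟩
  refine HasCompactSupport.of_support_subset_isCompact
    (((h 0).2.isCompact.union (h 1).2.isCompact).union (h 2).2.isCompact) ?_
  intro x hx
  by_contra hn
  simp only [Set.mem_union, not_or] at hn
  apply hx
  ext i
  change f i x = 0
  fin_cases i
  · exact image_eq_zero_of_notMem_tsupport (f := f 0) hn.1.1
  · exact image_eq_zero_of_notMem_tsupport (f := f 1) hn.1.2
  · exact image_eq_zero_of_notMem_tsupport (f := f 2) hn.2

/-- Integration by parts against the constant 1. All Green formulas below reduce to this. -/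
lemma integral_pderiv_eq_zero {f : R3 → ℂ} (hf : IsTest f) (j : Fin 3) : ∫ x, pderiv j f x = 0 := by
  have h := integral_smul_fderiv_eq_neg_fderiv_smul_of_integrable (𝕜 := ℝ) (μ := (volume : Measure R3))
    (f := fun _ : R3 => (1 : ℝ)) (g := f) (v := basisVec j) (by simp)
    (by simpa using! (hf.pderiv j).integrable)
    (by simpa using hf.integrable) (by fun_prop) (fun x _ => hf.differentiable x)
  simpa [pderiv] using h

lemma integral_mul_pderiv {u f : R3 → ℂ} (hu : ContDiff ℝ (⊤ : ℕ∞) u) (hf : IsTest f) (j : Fin 3) :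
    ∫ x, u x * pderiv j f x = - ∫ x, pderiv j u x * f x := by
  have h := integral_pderiv_eq_zero (hf.mul_left hu) j
  have hd := hu.differentiable (by simp)
  simp_rw [pderiv_mul (hd _) (hf.differentiable _)] at h
  rw [integral_add ((hf.mul_left (contDiff_pderiv hu j)).integrable)
    (((hf.pderiv j).mul_left hu).integrable)] at h
  linear_combination h

end Test

/-! ### Curl, gradient, dot product and Green's formula on the whole space. -/

section Fields

lemma curl_apply {φ : R3 → C3} {x : R3} (h : DifferentiableAt ℝ φ x) (i : Fin 3) :
    curl φ x i = pderiv (i + 1) (fun y => φ y (i + 2)) x - pderiv (i + 2) (fun y => φ y (i + 1)) x := by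
  simp [curl, pderiv_apply_C3 h]

lemma contDiff_curl {φ : R3 → C3} (h : ContDiff ℝ (⊤ : ℕ∞) φ) : ContDiff ℝ (⊤ : ℕ∞) (curl φ) :=
  contDiff_C3_iff.2 fun i => ((contDiff_C3_iff.1 (contDiff_pderiv h (i + 1))) (i + 2)).sub
    ((contDiff_C3_iff.1 (contDiff_pderiv h (i + 2))) (i + 1))

lemma contDiff_grad {ψ : R3 → ℂ} (h : ContDiff ℝ (⊤ : ℕ∞) ψ) : ContDiff ℝ (⊤ : ℕ∞) (grad ψ) :=
  contDiff_C3_iff.2 fun i => contDiff_pderiv h i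

lemma curl_congr_of_eventuallyEq {f g : R3 → C3} {x : R3} (h : f =ᶠ[𝓝 x] g) :
    curl f x = curl g x := by
  simp only [curl, pderiv_congr_of_eventuallyEq h]

lemma grad_congr_of_eventuallyEq {f g : R3 → ℂ} {x : R3} (h : f =ᶠ[𝓝 x] g) :
    grad f x = grad g x := by
  simp only [grad, pderiv_congr_of_eventuallyEq h]

lemma curl_zero_of_notMem {φ : R3 → C3} {x : R3} (h : x ∉ tsupport φ) : curl φ x = 0 := by
  rw [curl_congr_of_eventuallyEq (notMem_tsupport_iff_eventuallyEq.1 h)]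
  ext i
  simp [curl, pderiv]

lemma grad_zero_of_eventually_const {ψ : R3 → ℂ} {x : R3} {c : ℂ} (h : ∀ᶠ y in 𝓝 x, ψ y = c) :
    grad ψ x = 0 := by
  rw [grad_congr_of_eventuallyEq h]
  ext i
  simp [grad, pderiv]

lemma grad_zero_of_notMem {ψ : R3 → ℂ} {x : R3} (h : x ∉ tsupport ψ) : grad ψ x = 0 :=
  grad_zero_of_eventually_const (c := 0) (notMem_tsupport_iff_eventuallyEq.1 h)

lemma tsupport_curl_subset (φ : R3 → C3) : tsupport (curl φ) ⊆ tsupport φ :=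
  closure_minimal (fun x hx => by by_contra hn; exact hx (curl_zero_of_notMem hn))
    (isClosed_tsupport φ)

lemma tsupport_grad_subset (ψ : R3 → ℂ) : tsupport (grad ψ) ⊆ tsupport ψ :=
  closure_minimal (fun x hx => by by_contra hn; exact hx (grad_zero_of_notMem hn))
    (isClosed_tsupport ψ)

lemma IsTest.curl {φ : R3 → C3} (h : IsTest φ) : IsTest (curl φ) :=
  h.of_tsupport_subset (contDiff_curl h.1) (tsupport_curl_subset φ)

lemma IsTest.grad {ψ : R3 → ℂ} (h : IsTest ψ) : IsTest (grad ψ) :=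
  h.of_tsupport_subset (contDiff_grad h.1) (tsupport_grad_subset ψ)

lemma curl_grad {ψ : R3 → ℂ} (h : ContDiff ℝ (⊤ : ℕ∞) ψ) (x : R3) : curl (CoreShell.grad ψ) x = 0 := by
  ext i
  rw [curl_apply ((contDiff_grad h).differentiable (by simp) x)]
  simp only [CoreShell.grad]
  simpa using sub_eq_zero.2 (pderiv_comm h (i + 1) (i + 2) x)

lemma curl_add {A B : R3 → C3} {x : R3} (hA : DifferentiableAt ℝ A x) (hB : DifferentiableAt ℝ B x) :
    curl (fun y => A y + B y) x = curl A x + curl B x := by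
  ext i
  simp [curl, pderiv_add hA hB]
  ring

lemma curl_const_smul {A : R3 → C3} {x : R3} (c : ℂ) (hA : DifferentiableAt ℝ A x) :
    curl (fun y => c • A y) x = c • curl A x := by
  ext i
  rw [curl_apply (φ := fun y => c • A y) (hA.const_smul c)]
  simp only [PiLp.smul_apply, smul_eq_mul]
  have hc : ∀ a, DifferentiableAt ℝ (fun y => A y a) x := fun a =>
    ((EuclideanSpace.proj a : C3 →L[ℂ] ℂ).restrictScalars ℝ).differentiableAt.comp x hA
  rw [pderiv_const_mul c (hc _), pderiv_const_mul c (hc _), curl_apply hA]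
  ring

lemma grad_sub {f g : R3 → ℂ} {x : R3} (hf : DifferentiableAt ℝ f x) (hg : DifferentiableAt ℝ g x) :
    grad (fun y => f y - g y) x = grad f x - grad g x := by
  ext i
  simp [grad, pderiv_sub hf hg]

lemma grad_add {f g : R3 → ℂ} {x : R3} (hf : DifferentiableAt ℝ f x) (hg : DifferentiableAt ℝ g x) :
    grad (fun y => f y + g y) x = grad f x + grad g x := by
  ext i
  simp [grad, pderiv_add hf hg]

lemma grad_const_mul {f : R3 → ℂ} {x : R3} (c : ℂ) (hf : DifferentiableAt ℝ f x) :
    grad (fun y => c * f y) x = c • grad f x := by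
  ext i
  simp [grad, pderiv_const_mul c hf]

lemma dot_add_left (a b c : C3) : dot (a + b) c = dot a c + dot b c := by
  simp [dot, add_mul, Finset.sum_add_distrib]

lemma dot_add_right (a b c : C3) : dot a (b + c) = dot a b + dot a c := by
  simp [dot, mul_add, Finset.sum_add_distrib]

lemma dot_sub_left (a b c : C3) : dot (a - b) c = dot a c - dot b c := by
  simp [dot, sub_mul, Finset.sum_sub_distrib]

lemma dot_sub_right (a b c : C3) : dot a (b - c) = dot a b - dot a c := by
  simp [dot, mul_sub, Finset.sum_sub_distrib]

lemma dot_smul_left (t : ℂ) (a b : C3) : dot (t • a) b = t * dot a b := by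
  simp [dot, Finset.mul_sum, mul_assoc]

lemma dot_smul_right (t : ℂ) (a b : C3) : dot a (t • b) = t * dot a b := by
  simp [dot, Finset.mul_sum, mul_left_comm]

lemma dot_neg_left (a b : C3) : dot (-a) b = - dot a b := by
  simp [dot]

lemma dot_comm (a b : C3) : dot a b = dot b a := by
  simp [dot, mul_comm]

@[simp] lemma dot_zero_left (a : C3) : dot 0 a = 0 := by simp [dot]

@[simp] lemma dot_zero_right (a : C3) : dot a 0 = 0 := by simp [dot]

/-- Componentwise complex conjugation. -/
noncomputable def conjVec (a : C3) : C3 := WithLp.toLp 2 fun i => (starRingEnd ℂ) (a i)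

@[simp] lemma conjVec_apply (a : C3) (i : Fin 3) : conjVec a i = (starRingEnd ℂ) (a i) := rfl

lemma inner_eq_dot (a b : C3) : inner ℂ a b = dot (conjVec a) b := by
  simp [PiLp.inner_apply, dot, mul_comm]

@[simp] lemma conjVec_conjVec (a : C3) : conjVec (conjVec a) = a := by
  ext i; simp

lemma dot_eq_inner (a b : C3) : dot a b = inner ℂ (conjVec a) b := by
  rw [inner_eq_dot, conjVec_conjVec]

@[simp] lemma norm_conjVec (a : C3) : ‖conjVec a‖ = ‖a‖ := by
  simp [EuclideanSpace.norm_eq]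

lemma norm_dot_le (a b : C3) : ‖dot a b‖ ≤ ‖a‖ * ‖b‖ := by
  rw [dot_eq_inner]
  simpa using norm_inner_le_norm (𝕜 := ℂ) (conjVec a) b

lemma continuous_conjVec : Continuous conjVec := by
  refine (PiLp.continuous_toLp 2 _).comp (continuous_pi fun i => ?_)
  exact Complex.continuous_conj.comp (EuclideanSpace.proj i : C3 →L[ℂ] ℂ).continuous

lemma memLp_conjVec {μ : Measure R3} {p : ENNReal} {u : R3 → C3} (hu : MemLp u p μ) :
    MemLp (fun x => conjVec (u x)) p μ :=
  hu.of_le (continuous_conjVec.comp_aestronglyMeasurable hu.1) (by simp)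

lemma integrable_dot {μ : Measure R3} {u v : R3 → C3} (hu : MemLp u 2 μ) (hv : MemLp v 2 μ) :
    Integrable (fun x => dot (u x) (v x)) μ := by
  simp_rw [dot_eq_inner]
  refine (hu.norm.integrable_mul hv.norm).mono
    ((memLp_conjVec hu).1.inner hv.1) (Filter.Eventually.of_forall fun x => ?_)
  rw [← dot_eq_inner]
  simpa using norm_dot_le (u x) (v x)

/-- The integrand is div(A × φ), and A × φ has compact support. -/
lemma integral_green {A φ : R3 → C3} (hA : ContDiff ℝ (⊤ : ℕ∞) A) (hφ : IsTest φ) :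
    ∫ x, (dot (curl A x) (φ x) - dot (A x) (curl φ x)) = 0 := by
  have hAi := contDiff_C3_iff.1 hA
  have key : ∀ x, dot (curl A x) (φ x) - dot (A x) (curl φ x) =
      ∑ i : Fin 3, (pderiv (i + 1) (fun y => A y (i + 2) * φ y i) x
        - pderiv (i + 2) (fun y => A y (i + 1) * φ y i) x) := by
    intro x
    have h1 := fun a => (hAi a).differentiable (by simp) x
    have h2 := fun a => (hφ.apply a).differentiable x
    simp_rw [pderiv_mul (h1 _) (h2 _)]
    simp only [dot, curl_apply (hA.differentiable (by simp) x), curl_apply (hφ.differentiable x),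
      Fin.sum_univ_three]
    norm_num [Fin.isValue, show (1 + 1 : Fin 3) = 2 from rfl, show (1 + 2 : Fin 3) = 0 from rfl,
      show (2 + 1 : Fin 3) = 0 from rfl, show (2 + 2 : Fin 3) = 1 from rfl]
    ring
  simp_rw [key]
  have ht : ∀ a b, IsTest (fun y => A y a * φ y b) := fun a b => (hφ.apply b).mul_left (hAi a)
  have hi : ∀ i ∈ Finset.univ, Integrable fun x => (pderiv (i + 1) (fun y => A y (i + 2) * φ y i) x
        - pderiv (i + 2) (fun y => A y (i + 1) * φ y i) x) :=
    fun i _ => ((ht _ _).pderiv _).integrable.sub ((ht _ _).pderiv _).integrable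
  rw [integral_finsetSum _ hi]
  refine Finset.sum_eq_zero fun i _ => ?_
  rw [integral_sub ((ht _ _).pderiv _).integrable ((ht _ _).pderiv _).integrable,
    integral_pderiv_eq_zero (ht _ _), integral_pderiv_eq_zero (ht _ _), sub_zero]

lemma integral_dot_grad_curl {g : R3 → ℂ} {φ : R3 → C3} (hg : ContDiff ℝ (⊤ : ℕ∞) g)
    (hφ : IsTest φ) : ∫ x, dot (grad g x) (curl φ x) = 0 := by
  have h := integral_green (contDiff_grad hg) hφ
  simp only [curl_grad hg, dot_zero_left, zero_sub, integral_neg] at h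
  simpa using h

lemma integral_mul_divergence {g : R3 → ℂ} {φ : R3 → C3} (hg : ContDiff ℝ (⊤ : ℕ∞) g)
    (hφ : IsTest φ) : ∫ x, g x * divergence φ x = - ∫ x, dot (grad g x) (φ x) := by
  simp only [divergence, dot, Finset.mul_sum, pderiv_apply_C3 (hφ.differentiable _)]
  rw [integral_finsetSum _ fun i _ => (((hφ.apply i).pderiv i).mul_left hg).integrable,
    integral_finsetSum _ fun i _ => by
      simpa only [grad] using ((hφ.apply i).mul_left (contDiff_pderiv hg i)).integrable,
    ← Finset.sum_neg_distrib]
  exact Finset.sum_congr rfl fun i _ => integral_mul_pderiv hg (hφ.apply i) i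

end Fields


/-! ### The tangential pairing and the weak curl. -/

section Pairing

lemma memLp_restrict_of_continuous {F : Type*} [NormedAddCommGroup F] {u : R3 → F}
    (hu : Continuous u) {S : Set R3} (hS : Bornology.IsBounded S) (p : ENNReal) :
    MemLp u p (volume.restrict S) := by
  have hc : IsCompact (closure S) := hS.isCompact_closure
  obtain ⟨C, hC⟩ := hc.exists_bound_of_continuousOn hu.continuousOn
  have hfin : IsFiniteMeasure (volume.restrict (closure S) : Measure R3) :=
    ⟨by simpa using hc.measure_lt_top⟩
  have : MemLp u p (volume.restrict (closure S)) :=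
    MemLp.of_bound hu.aestronglyMeasurable C
      ((ae_restrict_iff' isClosed_closure.measurableSet).2 (Filter.Eventually.of_forall hC))
  exact this.mono_measure (Measure.restrict_mono subset_closure le_rfl)

lemma measurableSet_core : MeasurableSet core := isOpen_ball.measurableSet

lemma isOpen_shell {Ω : Set R3} (h : IsOpen Ω) : IsOpen (shell Ω) := h.sdiff isClosed_closedBall

lemma isBounded_core : Bornology.IsBounded core := isBounded_ball

lemma shell_subset (Ω : Set R3) : shell Ω ⊆ Ω := Set.sdiff_subset

variable {S : Set R3} {u v u' v' φ φ' : R3 → C3}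

lemma integrable_pairing (hu : MemLp u 2 (volume.restrict S)) (hv : MemLp v 2 (volume.restrict S))
    (hφ : IsTest φ) :
    Integrable (fun x => dot (v x) (φ x) - dot (u x) (curl φ x)) (volume.restrict S) :=
  (integrable_dot hv ((hφ.memLp 2).restrict S)).sub (integrable_dot hu ((hφ.curl.memLp 2).restrict S))

lemma tangentialPairing_add_test (hu : MemLp u 2 (volume.restrict S))
    (hv : MemLp v 2 (volume.restrict S)) (hφ : IsTest φ) (hφ' : IsTest φ') :
    tangentialPairing S u v (fun x => φ x + φ' x)
      = tangentialPairing S u v φ + tangentialPairing S u v φ' := by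
  unfold tangentialPairing
  rw [← integral_add (integrable_pairing hu hv hφ) (integrable_pairing hu hv hφ')]
  congr 1 with x
  rw [curl_add (hφ.differentiable x) (hφ'.differentiable x), dot_add_right, dot_add_right]
  ring

lemma tangentialPairing_sub (hu : MemLp u 2 (volume.restrict S))
    (hv : MemLp v 2 (volume.restrict S)) (hu' : MemLp u' 2 (volume.restrict S))
    (hv' : MemLp v' 2 (volume.restrict S)) (hφ : IsTest φ) :
    tangentialPairing S (fun x => u x - u' x) (fun x => v x - v' x) φ
      = tangentialPairing S u v φ - tangentialPairing S u' v' φ := by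
  unfold tangentialPairing
  rw [← integral_sub (integrable_pairing hu hv hφ) (integrable_pairing hu' hv' hφ)]
  congr 1 with x
  rw [dot_sub_left, dot_sub_left]
  ring

lemma tangentialPairing_congr_ae (hu : ∀ᵐ x ∂volume.restrict S, u x = u' x)
    (hv : ∀ᵐ x ∂volume.restrict S, v x = v' x) (φ : R3 → C3) :
    tangentialPairing S u v φ = tangentialPairing S u' v' φ := by
  refine integral_congr_ae ?_
  filter_upwards [hu, hv] with x h1 h2
  rw [h1, h2]

lemma tangentialPairing_eq_zero_of_disjoint (h : Disjoint (tsupport φ) S) :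
    tangentialPairing S u v φ = 0 := by
  refine setIntegral_eq_zero_of_forall_eq_zero fun x hx => ?_
  have hn : x ∉ tsupport φ := fun h' => h.le_bot ⟨h', hx⟩
  rw [curl_zero_of_notMem hn, image_eq_zero_of_notMem_tsupport hn]
  simp

lemma HCurl.congr_ae (h : HCurl S u v) (hu : ∀ᵐ x ∂volume.restrict S, u x = u' x)
    (hv : ∀ᵐ x ∂volume.restrict S, v x = v' x) : HCurl S u' v' :=
  ⟨h.1.ae_eq hu, h.2.1.ae_eq hv, fun φ hφ hs =>
    (tangentialPairing_congr_ae hu hv φ).symm.trans (h.2.2 φ hφ hs)⟩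

/-- The weak curl is unique. -/
lemma HCurl.ae_eq (hS : IsOpen S) (h : HCurl S u v) (h' : HCurl S u v') :
    ∀ᵐ x ∂volume.restrict S, v x = v' x := by
  have hcomp : ∀ i : Fin 3, ∀ᵐ x ∂(volume : Measure R3), x ∈ S → v x i - v' x i = 0 := by
    intro i
    have hm : MemLp (fun x => v x i - v' x i) 2 (volume.restrict S) :=
      ((EuclideanSpace.proj i : C3 →L[ℂ] ℂ).comp_memLp' h.2.1).sub
        ((EuclideanSpace.proj i : C3 →L[ℂ] ℂ).comp_memLp' h'.2.1)
    refine hS.ae_eq_zero_of_integral_contDiff_smul_eq_zero (f := fun x => v x i - v' x i) ?_ ?_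
    · exact locallyIntegrableOn_of_locallyIntegrable_restrict (hm.locallyIntegrable (by norm_num))
    · intro g hg hgc hgs
      have hgt : IsTest (fun x => (g x : ℂ)) := IsTest.ofReal ⟨hg, hgc⟩
      have hts : tsupport (fun x => (g x : ℂ)) ⊆ tsupport g :=
        closure_mono fun x hx => by
          simpa using hx
      -- A test field with a single nonzero component isolates the `i`-th component of `v - v'`; the
      -- terms with curl φ cancel in the difference of the two pairings.
      set φ : R3 → C3 := fun x => WithLp.toLp 2 (fun a => if a = i then (g x : ℂ) else 0) with hφd
      have hφ : IsTest φ := IsTest.toLp fun a => by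
        by_cases ha : a = i
        · simpa [ha] using hgt
        · simp only [ha, if_false]
          exact ⟨contDiff_const, HasCompactSupport.zero⟩
      have hφs : tsupport φ ⊆ S := by
        refine (closure_mono fun x hx => ?_).trans hgs
        intro h0
        apply hx
        ext a
        simp [hφd, h0]
      have e1 := h.2.2 φ hφ hφs
      have e2 := h'.2.2 φ hφ hφs
      have e3 := tangentialPairing_sub h.1 h.2.1 h'.1 h'.2.1 hφ
      rw [e1, e2, sub_zero] at e3
      rw [← setIntegral_eq_integral_of_forall_compl_eq_zero (s := S) (fun x hx => by
        rw [image_eq_zero_of_notMem_tsupport (fun h0 => hx (hgs h0)), zero_smul]), ← e3]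
      unfold tangentialPairing
      congr 1 with x
      simp [dot, hφd, Complex.real_smul]
      ring
  rw [ae_restrict_iff' hS.measurableSet]
  filter_upwards [hcomp 0, hcomp 1, hcomp 2] with x h0 h1 h2 hx
  ext i
  fin_cases i
  · exact sub_eq_zero.1 (h0 hx)
  · exact sub_eq_zero.1 (h1 hx)
  · exact sub_eq_zero.1 (h2 hx)

end Pairing

/-! ### Green's formula in the ball for fields with a radial factor vanishing on the sphere. -/

section Cutoff

/-- The (bilinear) cross product of complex vectors. -/
noncomputable def crossC (a b : C3) : C3 :=
  WithLp.toLp 2 fun i => a (i + 1) * b (i + 2) - a (i + 2) * b (i + 1)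

lemma contDiff_toC3 : ContDiff ℝ (⊤ : ℕ∞) toC3 :=
  contDiff_C3_iff.2 fun i => Complex.ofRealCLM.contDiff.comp
    (EuclideanSpace.proj i : R3 →L[ℝ] ℝ).contDiff

lemma contDiff_crossC {A B : R3 → C3} (hA : ContDiff ℝ (⊤ : ℕ∞) A) (hB : ContDiff ℝ (⊤ : ℕ∞) B) :
    ContDiff ℝ (⊤ : ℕ∞) (fun x => crossC (A x) (B x)) := by
  rw [contDiff_C3_iff] at *
  exact fun i => ((hA _).mul (hB _)).sub ((hA _).mul (hB _))

lemma curl_smul {g : R3 → ℂ} {Z : R3 → C3} {x : R3} (hg : DifferentiableAt ℝ g x)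
    (hZ : DifferentiableAt ℝ Z x) :
    curl (fun y => g y • Z y) x = crossC (grad g x) (Z x) + g x • curl Z x := by
  have hc : ∀ a, DifferentiableAt ℝ (fun y => Z y a) x := fun a =>
    ((EuclideanSpace.proj a : C3 →L[ℂ] ℂ).restrictScalars ℝ).differentiableAt.comp x hZ
  ext i
  rw [curl_apply (φ := fun y => g y • Z y) (hg.smul hZ)]
  simp only [PiLp.smul_apply, smul_eq_mul, PiLp.add_apply, curl_apply hZ, crossC, grad]
  rw [pderiv_mul hg (hc _), pderiv_mul hg (hc _)]
  ring

lemma pderiv_normSq (j : Fin 3) (x : R3) : pderiv j (fun y : R3 => ‖y‖ ^ 2) x = 2 * x j := by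
  have := ((hasStrictFDerivAt_norm_sq x).hasFDerivAt).pderiv_eq j
  rw [this]
  simp [basisVec, EuclideanSpace.inner_single_right]

lemma contDiff_normSq : ContDiff ℝ (⊤ : ℕ∞) (fun y : R3 => ‖y‖ ^ 2) := contDiff_norm_sq ℝ

lemma pderiv_radial {f : ℝ → ℝ} (hf : Differentiable ℝ f) (j : Fin 3) (x : R3) :
    pderiv j (fun y => f (‖y‖ ^ 2)) x = 2 * x j * deriv f (‖x‖ ^ 2) := by
  rw [pderiv_comp_deriv (hf _) (contDiff_normSq.differentiable (by simp) x), pderiv_normSq, smul_eq_mul]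

lemma grad_radial {f : ℝ → ℝ} (hf : Differentiable ℝ f) (x : R3) :
    grad (fun y => (f (‖y‖ ^ 2) : ℂ)) x = ((2 * deriv f (‖x‖ ^ 2) : ℝ) : ℂ) • toC3 x := by
  ext i
  have hd : DifferentiableAt ℝ (fun y : R3 => f (‖y‖ ^ 2)) x :=
    (hf _).comp x (contDiff_normSq.differentiable (by simp) x)
  simp only [grad, toC3, PiLp.smul_apply, smul_eq_mul]
  rw [pderiv_ofReal hd, pderiv_radial hf]
  push_cast
  ring

lemma curl_radial_smul {f : ℝ → ℝ} (hf : Differentiable ℝ f) {Z : R3 → C3}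
    (hZ : Differentiable ℝ Z) (x : R3) :
    curl (fun y => (f (‖y‖ ^ 2) : ℂ) • Z y) x =
      ((2 * deriv f (‖x‖ ^ 2) : ℝ) : ℂ) • crossC (toC3 x) (Z x) + (f (‖x‖ ^ 2) : ℂ) • curl Z x := by
  have hd : DifferentiableAt ℝ (fun y : R3 => (f (‖y‖ ^ 2) : ℂ)) x :=
    Complex.ofRealCLM.differentiableAt.comp x
      ((hf _).comp x (contDiff_normSq.differentiable (by simp) x))
  rw [curl_smul hd (hZ x), grad_radial hf]
  congr 1
  ext i
  simp [crossC]
  ring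

/-- The function `f`, cut off smoothly near `[1, ∞)`. -/
noncomputable def cutRadial (f : ℝ → ℝ) (j : ℕ) (s : ℝ) : ℝ :=
  Real.smoothTransition (j * (1 - s)) * f s

lemma contDiff_cutRadial {f : ℝ → ℝ} (hf : ContDiff ℝ (⊤ : ℕ∞) f) (j : ℕ) :
    ContDiff ℝ (⊤ : ℕ∞) (cutRadial f j) :=
  (Real.smoothTransition.contDiff.comp (by fun_prop)).mul hf

lemma cutRadial_eq_zero {f : ℝ → ℝ} {j : ℕ} {s : ℝ} (hs : 1 ≤ s) : cutRadial f j s = 0 := by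
  rw [cutRadial, Real.smoothTransition.zero_of_nonpos, zero_mul]
  exact mul_nonpos_of_nonneg_of_nonpos (Nat.cast_nonneg j) (by linarith)

lemma cutRadial_eventually_eq (f : ℝ → ℝ) {s : ℝ} (hs : s < 1) :
    ∀ᶠ j in Filter.atTop, cutRadial f j =ᶠ[𝓝 s] f := by
  -- For t below the midpoint (s + 1)/2 and j ≥ N one has j(1 - t) ≥ 1, where the transition
  -- function equals 1.
  obtain ⟨N, hN⟩ := exists_nat_gt ((1 - (s + 1) / 2)⁻¹)
  have hpos : 0 < 1 - (s + 1) / 2 := by linarith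
  filter_upwards [Filter.eventually_ge_atTop N] with j hj
  filter_upwards [Iio_mem_nhds (show s < (s + 1) / 2 by linarith)] with t ht
  rw [cutRadial, Real.smoothTransition.one_of_one_le, one_mul]
  have h1 : (1 - (s + 1) / 2)⁻¹ ≤ j := hN.le.trans (by exact_mod_cast hj)
  have h2 : 1 - (s + 1) / 2 ≤ 1 - t := by have := Set.mem_Iio.1 ht; linarith
  calc (1 : ℝ) = (1 - (s + 1) / 2)⁻¹ * (1 - (s + 1) / 2) :=
        (inv_mul_cancel₀ hpos.ne').symm
    _ ≤ j * (1 - t) := by gcongr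

/-- The derivative vanishes beyond 1, so only the compact interval [0, 1] matters. This controls the
factor that blows up when the cutoff is sharpened. -/
lemma deriv_smoothTransition_mul_bound :
    ∃ M : ℝ, ∀ t : ℝ, 0 ≤ t → |deriv Real.smoothTransition t * t| ≤ M := by
  have hc : Continuous (fun t => deriv Real.smoothTransition t * t) :=
    ((Real.smoothTransition.contDiff (n := 1)).continuous_deriv le_rfl).mul continuous_id
  obtain ⟨M, hM⟩ := (isCompact_Icc (a := (0 : ℝ)) (b := 1)).exists_bound_of_continuousOn hc.continuousOn
  refine ⟨M, fun t ht => ?_⟩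
  rcases le_or_gt t 1 with h | h
  · exact hM t ⟨ht, h⟩
  · have : Real.smoothTransition =ᶠ[𝓝 t] fun _ => 1 := by
      filter_upwards [Ioi_mem_nhds h] with y hy
      exact Real.smoothTransition.one_of_one_le (le_of_lt hy)
    rw [this.deriv_eq]
    simpa using (norm_nonneg _).trans (hM 0 ⟨le_rfl, zero_le_one⟩)

/-- Differentiating the cutoff costs a factor j, but f(1) = 0 gives |f(s)| ≤ B(1 - s), and j(1 - s)
is absorbed by the derivative of the transition function. The bound is therefore uniform in j, which
is what dominated convergence needs. -/
lemma cutRadial_bound {f : ℝ → ℝ} (hf : ContDiff ℝ (⊤ : ℕ∞) f) (h1 : f 1 = 0) :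
    ∃ C : ℝ, ∀ (j : ℕ), ∀ s ∈ Set.Icc (0 : ℝ) 1,
      |cutRadial f j s| ≤ C ∧ |deriv (cutRadial f j) s| ≤ C := by
  obtain ⟨M, hM⟩ := deriv_smoothTransition_mul_bound
  have hM0 : 0 ≤ M := (abs_nonneg _).trans (hM 0 le_rfl)
  have hd := hf.differentiable (by simp)
  obtain ⟨A, hA⟩ := (isCompact_Icc (a := (0 : ℝ)) (b := 1)).exists_bound_of_continuousOn
    hf.continuous.continuousOn
  obtain ⟨B, hB⟩ := (isCompact_Icc (a := (0 : ℝ)) (b := 1)).exists_bound_of_continuousOn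
    (hf.continuous_deriv (by simp)).continuousOn
  have hA0 : 0 ≤ A := (norm_nonneg _).trans (hA 0 ⟨le_rfl, zero_le_one⟩)
  have hB0 : 0 ≤ B := (norm_nonneg _).trans (hB 0 ⟨le_rfl, zero_le_one⟩)
  refine ⟨A + (M * B + B), fun j s hs => ⟨?_, ?_⟩⟩
  · rw [cutRadial, abs_mul, abs_of_nonneg (Real.smoothTransition.nonneg _)]
    have := mul_le_mul (Real.smoothTransition.le_one (j * (1 - s))) (hA s hs) (norm_nonneg _) zero_le_one
    rw [Real.norm_eq_abs] at this
    have := mul_nonneg hM0 hB0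
    linarith
  · have hT : HasDerivAt (fun t : ℝ => (j : ℝ) * (1 - t)) (-(j : ℝ)) s := by
      simpa using ((hasDerivAt_id s).const_sub 1).const_mul (j : ℝ)
    have hS : HasDerivAt (fun t : ℝ => Real.smoothTransition ((j : ℝ) * (1 - t)))
        (deriv Real.smoothTransition ((j : ℝ) * (1 - s)) * (-(j : ℝ))) s :=
      ((Real.smoothTransition.contDiff (n := 1)).differentiable one_ne_zero _).hasDerivAt.comp s hT
    have hder : deriv (cutRadial f j) s = deriv Real.smoothTransition ((j : ℝ) * (1 - s)) * (-(j : ℝ)) * f s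
        + Real.smoothTransition ((j : ℝ) * (1 - s)) * deriv f s := (hS.mul (hd s).hasDerivAt).deriv
    have hfs : |f s| ≤ B * (1 - s) := by
      have := (convex_Icc (0 : ℝ) 1).norm_image_sub_le_of_norm_deriv_le (f := f) (fun x _ => hd x) hB hs
        (Set.right_mem_Icc.2 zero_le_one)
      rw [h1, zero_sub, norm_neg, Real.norm_eq_abs, Real.norm_eq_abs,
        abs_of_nonneg (show (0 : ℝ) ≤ 1 - s by linarith [hs.2])] at this
      exact this
    have hj : (0 : ℝ) ≤ j := Nat.cast_nonneg j
    have e1 : |deriv Real.smoothTransition ((j : ℝ) * (1 - s)) * (-(j : ℝ)) * f s| ≤ M * B := by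
      rw [abs_mul, abs_mul, abs_neg, abs_of_nonneg hj]
      calc |deriv Real.smoothTransition ((j : ℝ) * (1 - s))| * j * |f s|
          ≤ |deriv Real.smoothTransition ((j : ℝ) * (1 - s))| * j * (B * (1 - s)) := by gcongr
        _ = |deriv Real.smoothTransition ((j : ℝ) * (1 - s)) * ((j : ℝ) * (1 - s))| * B := by
            rw [abs_mul, abs_of_nonneg (mul_nonneg hj (show (0 : ℝ) ≤ 1 - s by linarith [hs.2]))]
            ring
        _ ≤ M * B := by
            gcongr
            exact hM _ (mul_nonneg hj (by linarith [hs.2]))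
    have e2 : |Real.smoothTransition ((j : ℝ) * (1 - s)) * deriv f s| ≤ B := by
      rw [abs_mul, abs_of_nonneg (Real.smoothTransition.nonneg _)]
      have := mul_le_mul (Real.smoothTransition.le_one (j * (1 - s))) (hB s hs) (norm_nonneg _) zero_le_one
      rw [Real.norm_eq_abs] at this
      linarith
    rw [hder]
    linarith [abs_add_le (deriv Real.smoothTransition ((j : ℝ) * (1 - s)) * (-(j : ℝ)) * f s)
      (Real.smoothTransition ((j : ℝ) * (1 - s)) * deriv f s)]

lemma isTest_radial_smul {f : ℝ → ℝ} (hf : ContDiff ℝ (⊤ : ℕ∞) f) (h1 : ∀ s, 1 ≤ s → f s = 0)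
    {Z : R3 → C3} (hZ : ContDiff ℝ (⊤ : ℕ∞) Z) :
    IsTest (fun x => (f (‖x‖ ^ 2) : ℂ) • Z x) ∧
      tsupport (fun x => (f (‖x‖ ^ 2) : ℂ) • Z x) ⊆ closedBall 0 1 := by
  have hs : tsupport (fun x => (f (‖x‖ ^ 2) : ℂ) • Z x) ⊆ closedBall 0 1 := by
    refine closure_minimal (fun x hx => ?_) isClosed_closedBall
    by_contra hn
    apply hx
    have : 1 ≤ ‖x‖ ^ 2 := one_le_pow₀ (by simpa using (not_le.1 (by simpa using hn)).le)
    simp [h1 _ this]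
  refine ⟨⟨?_, (isCompact_closedBall 0 1).of_isClosed_subset (isClosed_tsupport _) hs⟩, hs⟩
  exact (Complex.ofRealCLM.contDiff.comp (hf.comp contDiff_normSq)).smul hZ

/-- A pairing that vanishes on all test fields supported in the closed unit ball vanishes on
smooth fields with a radial factor that is zero on the unit sphere. -/
lemma tangentialPairing_core_radial {S : Set R3} (hS : MeasurableSet S) (hcS : core ⊆ S)
    {F G : R3 → C3}
    (hF : MemLp F 2 (volume.restrict S)) (hG : MemLp G 2 (volume.restrict S))
    (h0 : ∀ φ, IsTest φ → tsupport φ ⊆ closedBall 0 1 → tangentialPairing S F G φ = 0)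
    {f : ℝ → ℝ} (hf : ContDiff ℝ (⊤ : ℕ∞) f) (h1 : f 1 = 0)
    {Z : R3 → C3} (hZ : ContDiff ℝ (⊤ : ℕ∞) Z) :
    tangentialPairing core F G (fun x => (f (‖x‖ ^ 2) : ℂ) • Z x) = 0 := by
  obtain ⟨C, hC⟩ := cutRadial_bound hf h1
  have hC0 : 0 ≤ C := (abs_nonneg _).trans (hC 0 0 ⟨le_rfl, zero_le_one⟩).1
  have hfd := hf.differentiable (by simp)
  have hZd := hZ.differentiable (by simp)
  set X : ℕ → R3 → C3 := fun j x => (cutRadial f j (‖x‖ ^ 2) : ℂ) • Z x with hX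
  have hXt : ∀ j, IsTest (X j) ∧ tsupport (X j) ⊆ closedBall 0 1 := fun j =>
    isTest_radial_smul (contDiff_cutRadial hf j) (fun s hs => cutRadial_eq_zero hs) hZ
  have hcurl : ∀ j x, curl (X j) x = ((2 * deriv (cutRadial f j) (‖x‖ ^ 2) : ℝ) : ℂ) •
      crossC (toC3 x) (Z x) + (cutRadial f j (‖x‖ ^ 2) : ℂ) • curl Z x := fun j x =>
    curl_radial_smul ((contDiff_cutRadial hf j).differentiable (by simp)) hZd x
  have hFc := hF.mono_measure (Measure.restrict_mono hcS le_rfl)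
  have hGc := hG.mono_measure (Measure.restrict_mono hcS le_rfl)
  -- The cut-off fields are admissible test fields supported in the closed ball, and the sphere is a
  -- null set, so integrating over `S` or over the open ball is the same.
  have hz : ∀ j, tangentialPairing core F G (X j) = 0 := by
    intro j
    rw [← h0 (X j) (hXt j).1 (hXt j).2]
    refine (setIntegral_eq_of_subset_of_ae_sdiff_eq_zero hS.nullMeasurableSet hcS ?_).symm
    have hsph : ∀ᵐ x ∂(volume : Measure R3), x ∉ sphere (0 : R3) 1 :=
      measure_eq_zero_iff_ae_notMem.1 (Measure.addHaar_sphere _ _ _)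
    filter_upwards [hsph] with x hx hxS
    have hn : x ∉ tsupport (X j) := by
      intro hx'
      have h2 := (hXt j).2 hx'
      rw [← ball_union_sphere] at h2
      exact h2.elim hxS.2 hx
    rw [curl_zero_of_notMem hn, image_eq_zero_of_notMem_tsupport hn]
    simp
  have hfin : IsFiniteMeasure (volume.restrict core : Measure R3) :=
    ⟨by simpa using isBounded_core.measure_lt_top⟩
  have hcZ : Continuous fun x => crossC (toC3 x) (Z x) := (contDiff_crossC contDiff_toC3 hZ).continuous
  have hkc := isCompact_closedBall (0 : R3) 1
  obtain ⟨K1, hK1⟩ := hkc.exists_bound_of_continuousOn hZ.continuous.continuousOn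
  obtain ⟨K2, hK2⟩ := hkc.exists_bound_of_continuousOn hcZ.continuousOn
  obtain ⟨K3, hK3⟩ := hkc.exists_bound_of_continuousOn (contDiff_curl hZ).continuous.continuousOn
  have hlim : Filter.Tendsto (fun j => tangentialPairing core F G (X j)) Filter.atTop
      (𝓝 (tangentialPairing core F G (fun x => (f (‖x‖ ^ 2) : ℂ) • Z x))) := by
    refine tendsto_integral_of_dominated_convergence
      (fun x => ‖G x‖ * (C * K1) + ‖F x‖ * (2 * C * K2 + C * K3)) ?_ ?_ ?_ ?_
    · exact fun j => (integrable_pairing hFc hGc (hXt j).1).1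
    · exact ((hGc.norm.integrable one_le_two).mul_const _).add
        ((hFc.norm.integrable one_le_two).mul_const _)
    · intro j
      rw [ae_restrict_iff' measurableSet_core]
      refine Filter.Eventually.of_forall fun x hx => ?_
      have hx' : x ∈ closedBall (0 : R3) 1 := ball_subset_closedBall hx
      have hs : ‖x‖ ^ 2 ∈ Set.Icc (0 : ℝ) 1 :=
        ⟨by positivity, pow_le_one₀ (norm_nonneg _) (by simpa using hx')⟩
      have hb := hC j _ hs
      have b1 : ‖X j x‖ ≤ C * K1 := by
        rw [hX, norm_smul, Complex.norm_real]
        exact mul_le_mul hb.1 (hK1 x hx') (norm_nonneg _) hC0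
      have b2 : ‖curl (X j) x‖ ≤ 2 * C * K2 + C * K3 := by
        rw [hcurl]
        refine (norm_add_le _ _).trans (add_le_add ?_ ?_)
        · rw [norm_smul, Complex.norm_real, norm_mul, Real.norm_ofNat]
          exact mul_le_mul (mul_le_mul_of_nonneg_left hb.2 (by norm_num)) (hK2 x hx') (norm_nonneg _)
            (by positivity)
        · rw [norm_smul, Complex.norm_real]
          exact mul_le_mul hb.1 (hK3 x hx') (norm_nonneg _) hC0
      refine (norm_sub_le _ _).trans (add_le_add ?_ ?_)
      · exact (norm_dot_le _ _).trans (mul_le_mul_of_nonneg_left b1 (norm_nonneg _))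
      · exact (norm_dot_le _ _).trans (mul_le_mul_of_nonneg_left b2 (norm_nonneg _))
    · rw [ae_restrict_iff' measurableSet_core]
      refine Filter.Eventually.of_forall fun x hx => ?_
      have hs : ‖x‖ ^ 2 < 1 := pow_lt_one₀ (norm_nonneg _) (by simpa [core] using hx) two_ne_zero
      refine tendsto_const_nhds.congr' ?_
      filter_upwards [cutRadial_eventually_eq f hs] with j hj
      have e := hcurl j x
      rw [hj.deriv_eq, hj.eq_of_nhds] at e
      have e' : X j x = (f (‖x‖ ^ 2) : ℂ) • Z x := by simp [hX, hj.eq_of_nhds]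
      rw [e, e', curl_radial_smul hfd hZd]
  exact tendsto_nhds_unique hlim (by simp [hz])

end Cutoff


/-! ### Everywhere convergent power series. -/

section PowerSeries

/-- The sum of the power series with coefficients `a`. -/
noncomputable def powSum (a : ℕ → ℝ) (s : ℝ) : ℝ := ∑' l, a l * s ^ l

/-- The power series with coefficients `a` has infinite radius of convergence. -/
def IsEntire (a : ℕ → ℝ) : Prop := ∀ R : ℝ, Summable fun l => |a l| * R ^ l

/-- The coefficients of the derivative of a power series. -/
def derivCoeff (a : ℕ → ℝ) (l : ℕ) : ℝ := (l + 1) * a (l + 1)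

lemma IsEntire.summable {a : ℕ → ℝ} (h : IsEntire a) (s : ℝ) : Summable fun l => a l * s ^ l := by
  refine Summable.of_norm ?_
  simpa [abs_mul, abs_pow] using h |s|

lemma IsEntire.derivCoeff {a : ℕ → ℝ} (h : IsEntire a) : IsEntire (derivCoeff a) := by
  intro R
  -- Doubling the radius absorbs the factor l + 1 ≤ 2^(l+1) produced by differentiation.
  have h1 : Summable fun l => |a (l + 1)| * (2 * (|R| + 1)) ^ (l + 1) :=
    (summable_nat_add_iff 1).2 (h (2 * (|R| + 1)))
  refine Summable.of_norm_bounded h1 fun l => ?_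
  rw [CoreShell.derivCoeff, abs_mul, norm_mul, norm_mul, norm_pow, norm_abs_eq_norm, norm_abs_eq_norm, Real.norm_eq_abs,
    Real.norm_eq_abs, Real.norm_eq_abs]
  have e1 : |(l : ℝ) + 1| ≤ 2 ^ (l + 1) := by
    rw [abs_of_nonneg (by positivity)]
    exact_mod_cast (Nat.lt_two_pow_self (n := l + 1)).le
  have e2 : |R| ^ l ≤ (|R| + 1) ^ (l + 1) := by
    calc |R| ^ l ≤ (|R| + 1) ^ l := by gcongr; linarith
      _ ≤ (|R| + 1) ^ (l + 1) := pow_le_pow_right₀ (by linarith [abs_nonneg R]) (Nat.le_succ l)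
  calc |(l : ℝ) + 1| * |a (l + 1)| * |R| ^ l
      ≤ 2 ^ (l + 1) * |a (l + 1)| * (|R| + 1) ^ (l + 1) := by gcongr
    _ = |a (l + 1)| * (2 * (|R| + 1)) ^ (l + 1) := by rw [mul_pow]; ring

lemma IsEntire.hasDerivAt {a : ℕ → ℝ} (h : IsEntire a) (s : ℝ) :
    HasDerivAt (powSum a) (powSum (CoreShell.derivCoeff a) s) s := by
  set R := |s| + 1
  have hu : Summable fun l : ℕ => ‖(l : ℝ) * a l‖ * R ^ (l - 1) := by
    rw [← summable_nat_add_iff 1]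
    simpa [CoreShell.derivCoeff, abs_mul] using h.derivCoeff R
  have hs : s ∈ Metric.ball (0 : ℝ) R := by simp [R]
  have key := hasDerivAt_tsum_of_isPreconnected (g := fun l s => a l * s ^ l)
    (g' := fun l s => a l * (l * s ^ (l - 1))) hu Metric.isOpen_ball
    (convex_ball (0 : ℝ) R).isPreconnected
    (fun l y _ => (hasDerivAt_pow l y).const_mul (a l))
    (fun l y hy => by
      rw [norm_mul, norm_mul, norm_mul, norm_pow, mul_comm ‖(l : ℝ)‖ ‖a l‖, mul_assoc]
      have : ‖y‖ ≤ R := by simpa using (Metric.mem_ball.1 hy).le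
      gcongr) (y₀ := 0) (by simp [R]; positivity) (h.summable 0) hs
  have e : powSum (CoreShell.derivCoeff a) s = ∑' l : ℕ, a l * (l * s ^ (l - 1)) := by
    have hsm : Summable fun l : ℕ => a l * (l * s ^ (l - 1)) := by
      rw [← summable_nat_add_iff 1]
      refine (h.derivCoeff.summable s).congr fun l => ?_
      simp [CoreShell.derivCoeff]; ring
    rw [hsm.tsum_eq_zero_add]
    simp only [powSum, CoreShell.derivCoeff]
    simp only [CharP.cast_eq_zero, zero_mul, mul_zero, zero_add, Nat.cast_add, Nat.cast_one,
      Nat.add_sub_cancel]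
    exact tsum_congr fun l => by ring
  rw [e]
  exact key

lemma IsEntire.deriv {a : ℕ → ℝ} (h : IsEntire a) :
    deriv (powSum a) = powSum (CoreShell.derivCoeff a) :=
  funext fun s => (h.hasDerivAt s).deriv

lemma IsEntire.contDiff {a : ℕ → ℝ} (h : IsEntire a) : ContDiff ℝ (⊤ : ℕ∞) (powSum a) := by
  refine contDiff_infty.2 fun m => ?_
  induction m generalizing a with
  | zero =>
    exact contDiff_zero.2 (Differentiable.continuous fun s => (h.hasDerivAt s).differentiableAt)
  | succ m ih =>
    have := contDiff_succ_iff_deriv (n := (m : WithTop ℕ∞)) (𝕜 := ℝ) (f := powSum a)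
    push_cast
    refine this.2 ⟨fun s => (h.hasDerivAt s).differentiableAt, by simp, ?_⟩
    rw [h.deriv]
    exact ih h.derivCoeff

end PowerSeries

/-! ### The spherical Bessel function as r^n times a smooth function of r², and simplicity of its
zeros. -/

section Bessel

/-- The Taylor coefficients of `y ↦ j_n(√y) / √y ^ n`. -/
noncomputable def besselCoeff (n l : ℕ) : ℝ :=
  (-1) ^ l / (2 ^ l * (l.factorial : ℝ) * (Nat.doubleFactorial (2 * n + 2 * l + 1) : ℝ))

lemma isEntire_besselCoeff (n : ℕ) : IsEntire (besselCoeff n) := by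
  intro R
  refine Summable.of_norm_bounded (Real.summable_pow_div_factorial |R|) fun l => ?_
  rw [norm_mul, norm_pow, norm_abs_eq_norm, Real.norm_eq_abs, Real.norm_eq_abs, besselCoeff, abs_div, abs_pow, abs_neg, abs_one,
    one_pow, div_mul_eq_mul_div, one_mul]
  have h1 : (1 : ℝ) ≤ 2 ^ l := one_le_pow₀ (by norm_num)
  have h2 : (1 : ℝ) ≤ (Nat.doubleFactorial (2 * n + 2 * l + 1) : ℝ) := by
    exact_mod_cast Nat.succ_le_of_lt (Nat.doubleFactorial_pos _)
  have h3 : (0 : ℝ) < l.factorial := by exact_mod_cast l.factorial_pos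
  rw [abs_of_pos (a := 2 ^ l * (l.factorial : ℝ) * _) (by positivity)]
  gcongr
  calc (l.factorial : ℝ) = 1 * l.factorial * 1 := by ring
    _ ≤ _ := by gcongr

/-- This two-term recursion is the differential equation at the level of coefficients. -/
lemma besselCoeff_succ (n l : ℕ) :
    2 * ((l : ℝ) + 1) * (2 * n + 2 * l + 3) * besselCoeff n (l + 1) = - besselCoeff n l := by
  have h3 : (0 : ℝ) < l.factorial := by exact_mod_cast l.factorial_pos
  have h2 : (0 : ℝ) < (Nat.doubleFactorial (2 * n + 2 * l + 1) : ℝ) := by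
    exact_mod_cast Nat.doubleFactorial_pos _
  have e : (Nat.doubleFactorial (2 * n + 2 * (l + 1) + 1) : ℝ)
      = (2 * n + 2 * l + 3) * (Nat.doubleFactorial (2 * n + 2 * l + 1) : ℝ) := by
    rw [show 2 * n + 2 * (l + 1) + 1 = (2 * n + 2 * l + 1) + 2 by ring, Nat.doubleFactorial_add_two]
    push_cast; ring
  rw [besselCoeff, besselCoeff, e, Nat.factorial_succ]
  push_cast
  field_simp
  ring

/-- The profile `f` with `j_n(k r) = r ^ n f(r ^ 2)`. -/
noncomputable def radialProfile (n : ℕ) (k s : ℝ) : ℝ := k ^ n * powSum (besselCoeff n) (k ^ 2 * s)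

lemma sphBessel_eq (n : ℕ) (y : ℝ) : sphBessel n y = y ^ n * powSum (besselCoeff n) (y ^ 2) := by
  rw [sphBessel, powSum, ← tsum_mul_left]
  refine tsum_congr fun l => ?_
  rw [besselCoeff, pow_add, pow_mul]
  ring

lemma contDiff_radialProfile (n : ℕ) (k : ℝ) : ContDiff ℝ (⊤ : ℕ∞) (radialProfile n k) :=
  contDiff_const.mul ((isEntire_besselCoeff n).contDiff.comp (contDiff_const.mul contDiff_id))

lemma deriv_radialProfile (n : ℕ) (k s : ℝ) : deriv (radialProfile n k) s
    = k ^ (n + 2) * powSum (derivCoeff (besselCoeff n)) (k ^ 2 * s) := by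
  have h1 : HasDerivAt (fun s : ℝ => k ^ 2 * s) (k ^ 2) s := by
    simpa using (hasDerivAt_id s).const_mul (k ^ 2)
  have h2 := (((isEntire_besselCoeff n).hasDerivAt (k ^ 2 * s)).comp s h1).const_mul (k ^ n)
  have h3 : deriv (radialProfile n k) s = _ := h2.deriv
  rw [h3]; ring

lemma deriv_deriv_radialProfile (n : ℕ) (k s : ℝ) : deriv (deriv (radialProfile n k)) s
    = k ^ (n + 4) * powSum (derivCoeff (derivCoeff (besselCoeff n))) (k ^ 2 * s) := by
  have h1 : HasDerivAt (fun s : ℝ => k ^ 2 * s) (k ^ 2) s := by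
    simpa using (hasDerivAt_id s).const_mul (k ^ 2)
  have h2 := (((isEntire_besselCoeff n).derivCoeff.hasDerivAt (k ^ 2 * s)).comp s h1).const_mul (k ^ (n + 2))
  rw [show deriv (radialProfile n k) = _ from funext (deriv_radialProfile n k)]
  refine h2.deriv.trans ?_
  ring

lemma powSum_besselCoeff_ode (n : ℕ) (t : ℝ) :
    4 * t * powSum (derivCoeff (derivCoeff (besselCoeff n))) t
      + (6 + 4 * n) * powSum (derivCoeff (besselCoeff n)) t + powSum (besselCoeff n) t = 0 := by
  have h0 := isEntire_besselCoeff n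
  have s0 := h0.summable t
  have s1 := h0.derivCoeff.summable t
  have s2 := h0.derivCoeff.derivCoeff.summable t
  have e2 : t * powSum (derivCoeff (derivCoeff (besselCoeff n))) t
      = ∑' l : ℕ, (l * derivCoeff (besselCoeff n) l) * t ^ l := by
    have hs : Summable fun l : ℕ => (l * derivCoeff (besselCoeff n) l) * t ^ l := by
      rw [← summable_nat_add_iff 1]
      refine (s2.mul_left t).congr fun l => ?_
      rw [derivCoeff]; push_cast; ring
    rw [hs.tsum_eq_zero_add, powSum, ← tsum_mul_left]
    simp only [CharP.cast_eq_zero, zero_mul, zero_add]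
    refine tsum_congr fun l => ?_
    rw [derivCoeff]; push_cast; ring
  have hs : Summable fun l : ℕ => (l * derivCoeff (besselCoeff n) l) * t ^ l := by
    rw [← summable_nat_add_iff 1]
    refine (s2.mul_left t).congr fun l => ?_
    rw [derivCoeff]; push_cast; ring
  rw [mul_assoc, e2, powSum, powSum, ← tsum_mul_left, ← tsum_mul_left,
    ← (hs.mul_left 4).tsum_add (s1.mul_left _), ← ((hs.mul_left 4).add (s1.mul_left _)).tsum_add s0]
  convert tsum_zero with l
  have := besselCoeff_succ n l
  rw [derivCoeff]
  linear_combination t ^ l * this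

/-- For p harmonic and homogeneous of degree n, this is the Helmholtz equation (Δ + k²)(f(r²) p) = 0
written in the variable s = r². -/
lemma radialProfile_ode (n : ℕ) (k s : ℝ) :
    4 * s * deriv (deriv (radialProfile n k)) s + (6 + 4 * n) * deriv (radialProfile n k) s
      + k ^ 2 * radialProfile n k s = 0 := by
  rw [deriv_deriv_radialProfile, deriv_radialProfile, radialProfile]
  linear_combination k ^ (n + 2) * powSum_besselCoeff_ode n (k ^ 2 * s)

lemma sphBessel_mul (n : ℕ) (k r : ℝ) : sphBessel n (k * r) = r ^ n * radialProfile n k (r ^ 2) := by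
  rw [sphBessel_eq, radialProfile, mul_pow, mul_pow]; ring

/-- The left side is the r-derivative of r j_n(kr) = r^(n+1) f(r²). -/
lemma sphBessel_add_deriv (n : ℕ) (k r : ℝ) :
    sphBessel n (k * r) + k * r * deriv (sphBessel n) (k * r)
      = r ^ n * ((n + 1) * radialProfile n k (r ^ 2) + 2 * r ^ 2 * deriv (radialProfile n k) (r ^ 2)) := by
  have hd : ∀ y : ℝ, deriv (sphBessel n) y = n * y ^ (n - 1) * powSum (besselCoeff n) (y ^ 2)
      + y ^ n * (powSum (derivCoeff (besselCoeff n)) (y ^ 2) * (2 * y)) := by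
    intro y
    have h1 : HasDerivAt (fun s : ℝ => s ^ 2) (2 * y) y := by simpa using hasDerivAt_pow 2 y
    have h2 := (hasDerivAt_pow n y).mul (((isEntire_besselCoeff n).hasDerivAt (y ^ 2)).comp y h1)
    rw [show sphBessel n = _ from funext (sphBessel_eq n)]
    exact h2.deriv
  have hn : ∀ y : ℝ, (n : ℝ) * (y * y ^ (n - 1)) = n * y ^ n := by
    intro y
    rcases n with _ | n
    · simp
    · rw [Nat.add_sub_cancel, pow_succ]; ring
  rw [hd, sphBessel_eq, deriv_radialProfile, radialProfile]
  have := hn (k * r)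
  rw [show k ^ 2 * r ^ 2 = (k * r) ^ 2 by ring]
  have e : (k * r) ^ n = k ^ n * r ^ n := mul_pow _ _ _
  linear_combination powSum (besselCoeff n) ((k * r) ^ 2) * this
    + ((n + 1) * powSum (besselCoeff n) ((k * r) ^ 2)
      + 2 * (k * r) ^ 2 * powSum (derivCoeff (besselCoeff n)) ((k * r) ^ 2)) * e

lemma radialProfile_zero_ne {n : ℕ} {k : ℝ} (hk : k ≠ 0) : radialProfile n k 0 ≠ 0 := by
  have h : powSum (besselCoeff n) 0 = besselCoeff n 0 := by
    rw [powSum, tsum_eq_single 0 (fun l hl => by simp [hl])]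
    simp
  rw [radialProfile, mul_zero, h, besselCoeff]
  have : (Nat.doubleFactorial (2 * n + 2 * 0 + 1) : ℝ) ≠ 0 := by
    exact_mod_cast (Nat.doubleFactorial_pos _).ne'
  positivity

/-- Positive zeros of spherical Bessel functions are simple. -/
lemma deriv_radialProfile_one_ne {n : ℕ} {k : ℝ} (hk : k ≠ 0) (h1 : radialProfile n k 1 = 0) :
    deriv (radialProfile n k) 1 ≠ 0 := by
  intro h2
  set f := radialProfile n k with hf
  have hfc : ContDiff ℝ (⊤ : ℕ∞) f := contDiff_radialProfile n k
  have hfd : Differentiable ℝ f := hfc.differentiable (by simp)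
  have hfd' : Differentiable ℝ (deriv f) :=
    (hfc.iterate_deriv 1).differentiable (by simp)
  -- An energy for the equation. The weight s^(2n+2) makes the f'² terms cancel, so that Φ' is a
  -- nonnegative multiple of f². If f(1) = f'(1) = 0, then Φ(1) = 0 and monotonicity forces f = 0 on
  -- (0, 1], against f(0) ≠ 0.
  set Φ : ℝ → ℝ := fun s => s ^ (2 * n + 2) * (4 * s * (deriv f s) ^ 2 + k ^ 2 * (f s) ^ 2) with hΦ
  have hder : ∀ s, HasDerivAt Φ ((2 * n + 2) * s ^ (2 * n + 1) * (k ^ 2 * (f s) ^ 2)) s := by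
    intro s
    have a1 := hasDerivAt_pow (2 * n + 2) s
    have a2 := (((hasDerivAt_id s).const_mul 4).mul ((hfd' s).hasDerivAt.pow 2)).add
      (((hfd s).hasDerivAt.pow 2).const_mul (k ^ 2))
    refine (a1.mul a2).congr_deriv ?_
    have ode := radialProfile_ode n k s
    rw [← hf] at ode
    simp only [Pi.pow_apply, id, Pi.add_apply, Pi.mul_apply, Nat.cast_add, Nat.cast_mul,
      Nat.cast_ofNat, show 2 * n + 2 - 1 = 2 * n + 1 by omega, Nat.add_one_sub_one, pow_one]
    linear_combination 2 * s ^ (2 * n + 2) * deriv f s * ode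
  have hmono : MonotoneOn Φ (Set.Icc 0 1) := by
    refine monotoneOn_of_deriv_nonneg (convex_Icc 0 1)
      (Differentiable.continuous fun s => (hder s).differentiableAt).continuousOn
      (fun s _ => (hder s).differentiableAt.differentiableWithinAt) fun s hs => ?_
    rw [interior_Icc] at hs
    rw [(hder s).deriv]
    have := hs.1
    positivity
  have hzero : ∀ s ∈ Set.Ioc (0 : ℝ) 1, f s = 0 := by
    intro s hs
    have hle := hmono ⟨hs.1.le, hs.2⟩ ⟨zero_le_one, le_rfl⟩ hs.2
    have hs0 := hs.1
    simp only [hΦ, h1, h2] at hle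
    have hp : 0 < s ^ (2 * n + 2) := by positivity
    have h3 : 4 * s * (deriv f s) ^ 2 + k ^ 2 * (f s) ^ 2 ≤ 0 := by
      by_contra hcon
      have := mul_pos hp (not_le.1 hcon)
      norm_num at hle
      linarith
    have h4 : k ^ 2 * (f s) ^ 2 ≤ 0 := by
      have : 0 ≤ 4 * s * (deriv f s) ^ 2 := by positivity
      linarith
    have h5 : 0 < k ^ 2 := by positivity
    have h6 : (f s) ^ 2 ≤ 0 := by
      by_contra hcon
      have := mul_pos h5 (not_le.1 hcon)
      linarith
    exact pow_eq_zero_iff two_ne_zero |>.1 (le_antisymm h6 (sq_nonneg _))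
  have hlim : Filter.Tendsto f (𝓝[>] 0) (𝓝 (f 0)) := hfd.continuous.continuousAt.continuousWithinAt
  have hlim0 : Filter.Tendsto f (𝓝[>] 0) (𝓝 0) := by
    refine tendsto_const_nhds.congr' ?_
    filter_upwards [Ioc_mem_nhdsGT (zero_lt_one (α := ℝ))] with s hs
    exact (hzero s hs).symm
  exact radialProfile_zero_ne hk (tendsto_nhds_unique hlim hlim0)

end Bessel


/-! ### The Laplacian of the monomials z^a r^(2b) (x + iy)^M. -/

section Laplacian

/-- The Laplacian of a scalar function. -/
noncomputable def laplacian {F : Type*} [NormedAddCommGroup F] [NormedSpace ℝ F]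
    (f : R3 → F) (x : R3) : F := ∑ i, pderiv i (pderiv i f) x

lemma pderiv_pow {f : R3 → ℂ} {x : R3} (hf : DifferentiableAt ℝ f x) (a : ℕ) (j : Fin 3) :
    pderiv j (fun y => f y ^ a) x = a * f x ^ (a - 1) * pderiv j f x := by
  have := ((hf.hasFDerivAt).pow a).pderiv_eq j
  rw [this]
  simp [pderiv, mul_assoc]

lemma laplacian_mul {f g : R3 → ℂ} (hf : ContDiff ℝ (⊤ : ℕ∞) f) (hg : ContDiff ℝ (⊤ : ℕ∞) g)
    (x : R3) : laplacian (fun y => f y * g y) x = laplacian f x * g x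
      + 2 * ∑ i, pderiv i f x * pderiv i g x + f x * laplacian g x := by
  have df := hf.differentiable (by simp)
  have dg := hg.differentiable (by simp)
  have df' := fun i => (contDiff_pderiv hf i).differentiable (by simp)
  have dg' := fun i => (contDiff_pderiv hg i).differentiable (by simp)
  have h : ∀ i, pderiv i (pderiv i fun y => f y * g y) x = pderiv i (pderiv i f) x * g x
      + 2 * (pderiv i f x * pderiv i g x) + f x * pderiv i (pderiv i g) x := by
    intro i
    rw [show pderiv i (fun y => f y * g y) = fun y => pderiv i f y * g y + f y * pderiv i g y from
      funext fun y => pderiv_mul (df y) (dg y) i,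
      pderiv_add ((df' i x).fun_mul (dg x)) ((df x).fun_mul (dg' i x)), pderiv_mul (df' i x) (dg x),
      pderiv_mul (df x) (dg' i x)]
    ring
  simp only [laplacian, h, Finset.sum_add_distrib, Finset.sum_mul, Finset.mul_sum]

lemma laplacian_sum {ι : Type*} (s : Finset ι) {f : ι → R3 → ℂ}
    (hf : ∀ i, ContDiff ℝ (⊤ : ℕ∞) (f i)) (x : R3) :
    laplacian (fun y => ∑ i ∈ s, f i y) x = ∑ i ∈ s, laplacian (f i) x := by
  have h : ∀ j, pderiv j (pderiv j fun y => ∑ i ∈ s, f i y) x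
      = ∑ i ∈ s, pderiv j (pderiv j (f i)) x := by
    intro j
    rw [show pderiv j (fun y => ∑ i ∈ s, f i y) = fun y => ∑ i ∈ s, pderiv j (f i) y from
      funext fun y => pderiv_sum s (fun i _ => (hf i).differentiable (by simp) y) j,
      pderiv_sum s fun i _ => (contDiff_pderiv (hf i) j).differentiable (by simp) x]
  simp only [laplacian, h]
  exact Finset.sum_comm

lemma laplacian_const_mul {f : R3 → ℂ} (hf : ContDiff ℝ (⊤ : ℕ∞) f) (c : ℂ) (x : R3) :
    laplacian (fun y => c * f y) x = c * laplacian f x := by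
  rw [laplacian_mul contDiff_const hf]
  simp [laplacian, pderiv_const, show ∀ i, pderiv i (fun _ : R3 => c) = fun _ => 0 from
    fun i => funext fun y => pderiv_const c i y]

lemma laplacian_clm_comp (L : ℂ →L[ℝ] ℝ) {f : R3 → ℂ} (hf : ContDiff ℝ (⊤ : ℕ∞) f) (x : R3) :
    laplacian (fun y => L (f y)) x = L (laplacian f x) := by
  simp only [laplacian, map_sum]
  refine Finset.sum_congr rfl fun i _ => ?_
  rw [show pderiv i (fun y => L (f y)) = fun y => L (pderiv i f y) from
    funext fun y => pderiv_clm_comp L (hf.differentiable (by simp) y) i,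
    pderiv_clm_comp L ((contDiff_pderiv hf i).differentiable (by simp) x)]

/-- The complexified coordinates. -/
noncomputable def coordC (i : Fin 3) (x : R3) : ℂ := (x i : ℂ)

/-- The squared norm, as a complex number. -/
noncomputable def normSqC (x : R3) : ℂ := ((‖x‖ ^ 2 : ℝ) : ℂ)

/-- The complex coordinate of the horizontal plane. -/
noncomputable def planeC (x : R3) : ℂ := (x 0 : ℂ) + x 1 * Complex.I

lemma contDiff_coordC (i : Fin 3) : ContDiff ℝ (⊤ : ℕ∞) (coordC i) :=
  Complex.ofRealCLM.contDiff.comp (EuclideanSpace.proj i : R3 →L[ℝ] ℝ).contDiff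

lemma contDiff_normSqC : ContDiff ℝ (⊤ : ℕ∞) normSqC :=
  Complex.ofRealCLM.contDiff.comp contDiff_normSq

lemma contDiff_planeC : ContDiff ℝ (⊤ : ℕ∞) planeC :=
  (contDiff_coordC 0).add ((contDiff_coordC 1).mul contDiff_const)

lemma pderiv_coordC (i j : Fin 3) (x : R3) : pderiv j (coordC i) x = if i = j then 1 else 0 := by
  have : pderiv j (coordC i) x = _ := pderiv_ofReal
    ((EuclideanSpace.proj i : R3 →L[ℝ] ℝ).differentiableAt (x := x)) j
  rw [this]
  have e := pderiv_coord i j x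
  rw [show (⇑(EuclideanSpace.proj i : R3 →L[ℝ] ℝ)) = fun y : R3 => y i from rfl, e]
  split_ifs <;> simp

lemma pderiv_normSqC (j : Fin 3) (x : R3) : pderiv j normSqC x = 2 * coordC j x := by
  have : pderiv j normSqC x = _ := pderiv_ofReal (contDiff_normSq.differentiable (by simp) x) j
  rw [this, pderiv_normSq, coordC]
  push_cast; ring

lemma pderiv_planeC (j : Fin 3) (x : R3) :
    pderiv j planeC x = (if 0 = j then 1 else 0) + (if 1 = j then Complex.I else 0) := by
  have d := fun i => (contDiff_coordC i).differentiable (by simp) x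
  have : pderiv j planeC x = _ := pderiv_add (d 0) ((d 1).fun_mul (differentiableAt_const Complex.I)) j
  rw [this, pderiv_mul (d 1) (differentiableAt_const _), pderiv_coordC, pderiv_coordC, pderiv_const]
  split_ifs <;> simp

lemma normSqC_eq (x : R3) : normSqC x = coordC 0 x ^ 2 + coordC 1 x ^ 2 + coordC 2 x ^ 2 := by
  simp only [normSqC, coordC, EuclideanSpace.norm_sq_eq, Fin.sum_univ_three, Real.norm_eq_abs, sq_abs]
  push_cast; ring

lemma planeC_eq (x : R3) : planeC x = coordC 0 x + coordC 1 x * Complex.I := rfl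

/-- For b = 0 the exponent b - 1 is truncated to 0, but the factor b vanishes; so the identity needs
no case distinction when it is used. -/
lemma cast_mul_pow_pred {b : ℕ} {s : ℂ} : (b : ℂ) * s ^ (b - 1) * s = b * s ^ b := by
  rcases b with _ | b
  · simp
  · rw [Nat.add_sub_cancel, pow_succ]; ring

lemma cast_sub_one_mul_pow_pred {b : ℕ} {s : ℂ} :
    (b : ℂ) * ((b - 1 : ℕ) * s ^ (b - 1 - 1) * s) = b * (b - 1) * s ^ (b - 1) := by
  rcases b with _ | b
  · simp
  · rw [cast_mul_pow_pred]; simp; ring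

lemma cast_mul_cast_pred (b : ℕ) : (b : ℂ) * (b - 1 : ℕ) = b * (b - 1) := by
  rcases b with _ | b <;> simp

lemma laplacian_coordC_pow (a : ℕ) (x : R3) :
    laplacian (fun y => coordC 2 y ^ a) x = a * (a - 1) * coordC 2 x ^ (a - 2) := by
  have d := (contDiff_coordC 2).differentiable (by simp)
  have h : ∀ i, pderiv i (fun y => coordC 2 y ^ a)
      = fun y => ((a : ℂ) * if 2 = i then 1 else 0) * coordC 2 y ^ (a - 1) := by
    intro i; ext y
    rw [pderiv_pow (d y), pderiv_coordC]; ring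
  have h2 : ∀ i, pderiv i (pderiv i (fun y => coordC 2 y ^ a)) x
      = if 2 = i then (a : ℂ) * (a - 1) * coordC 2 x ^ (a - 2) else 0 := by
    intro i
    rw [h, pderiv_const_mul _ ((d x).fun_pow _), pderiv_pow (d x), pderiv_coordC, Nat.sub_sub]
    split_ifs
    · rw [← cast_mul_cast_pred]; ring
    · ring
  simp [laplacian, h2]

lemma laplacian_normSqC_pow (b : ℕ) (x : R3) :
    laplacian (fun y => normSqC y ^ b) x = 2 * b * (2 * b + 1) * normSqC x ^ (b - 1) := by
  have d := contDiff_normSqC.differentiable (by simp)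
  have dc := fun i => (contDiff_coordC i).differentiable (by simp)
  have h : ∀ i, pderiv i (fun y => normSqC y ^ b)
      = fun y => (2 * b : ℂ) * (normSqC y ^ (b - 1) * coordC i y) := by
    intro i; ext y
    rw [pderiv_pow (d y), pderiv_normSqC]; ring
  have h2 : ∀ i, pderiv i (pderiv i (fun y => normSqC y ^ b)) x
      = (2 * b : ℂ) * ((b - 1 : ℕ) * normSqC x ^ (b - 1 - 1) * (2 * coordC i x ^ 2)
        + normSqC x ^ (b - 1)) := by
    intro i
    rw [h, pderiv_const_mul _ (((d x).fun_pow _).fun_mul (dc i x)), pderiv_mul ((d x).fun_pow _) (dc i x),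
      pderiv_pow (d x), pderiv_normSqC, pderiv_coordC]
    simp only [if_true]; ring
  simp only [laplacian, h2, Fin.sum_univ_three]
  have e := cast_sub_one_mul_pow_pred (b := b) (s := normSqC x)
  have e2 := normSqC_eq x
  linear_combination 4 * e - 4 * (b : ℂ) * ((b - 1 : ℕ) * normSqC x ^ (b - 1 - 1)) * e2

/-- A holomorphic function of x + iy: the second derivatives in x and y carry the factors 1 and I² =
-1. -/
lemma laplacian_planeC_pow (M : ℕ) (x : R3) : laplacian (fun y => planeC y ^ M) x = 0 := by
  have d := contDiff_planeC.differentiable (by simp)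
  have h : ∀ i, pderiv i (fun y => planeC y ^ M)
      = fun y => ((M : ℂ) * ((if 0 = i then 1 else 0) + (if 1 = i then Complex.I else 0))) *
        planeC y ^ (M - 1) := by
    intro i; ext y
    rw [pderiv_pow (d y), pderiv_planeC]; ring
  have h2 : ∀ i, pderiv i (pderiv i (fun y => planeC y ^ M)) x
      = (M : ℂ) * (M - 1 : ℕ) * planeC x ^ (M - 1 - 1) *
        ((if 0 = i then 1 else 0) + (if 1 = i then Complex.I else 0)) ^ 2 := by
    intro i
    rw [h, pderiv_const_mul _ ((d x).fun_pow _), pderiv_pow (d x), pderiv_planeC]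
    ring
  simp only [laplacian, h2, Fin.sum_univ_three]
  norm_num [Fin.ext_iff]

/-- The cross terms come from ∇r² = 2x, which by Euler's identity produces the degrees a and M of
the other two factors; the gradients of z and x + iy are orthogonal. -/
lemma laplacian_monomial (a b M : ℕ) (x : R3) :
    laplacian (fun y => coordC 2 y ^ a * (normSqC y ^ b * planeC y ^ M)) x =
      (a * (a - 1) * coordC 2 x ^ (a - 2) * normSqC x ^ b
        + 2 * b * (2 * b + 1 + 2 * a + 2 * M) * coordC 2 x ^ a * normSqC x ^ (b - 1)) *
        planeC x ^ M := by
  have c1 := (contDiff_coordC 2).pow a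
  have c2 := contDiff_normSqC.pow b
  have c3 := contDiff_planeC.pow M
  have d1 := (contDiff_coordC 2).differentiable (by simp) x
  have d2 := contDiff_normSqC.differentiable (by simp) x
  have d3 := contDiff_planeC.differentiable (by simp) x
  rw [laplacian_mul c1 (c2.mul c3), laplacian_mul c2 c3, laplacian_coordC_pow, laplacian_normSqC_pow,
    laplacian_planeC_pow]
  simp only [pderiv_mul (d2.fun_pow b) (d3.fun_pow M), pderiv_pow d1, pderiv_pow d2, pderiv_pow d3,
    pderiv_coordC, pderiv_normSqC, pderiv_planeC, Fin.sum_univ_three]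
  norm_num [Fin.ext_iff]
  have e1 := cast_mul_pow_pred (b := a) (s := coordC 2 x)
  have e3 := cast_mul_pow_pred (b := M) (s := planeC x)
  have e4 := planeC_eq x
  linear_combination (4 * (b : ℂ) * normSqC x ^ (b - 1) * planeC x ^ M) * e1
    + coordC 2 x ^ a * 4 * (b : ℂ) * normSqC x ^ (b - 1) * e3
    - coordC 2 x ^ a * 4 * (b : ℂ) * normSqC x ^ (b - 1) * (M : ℂ) * planeC x ^ (M - 1) * e4

end Laplacian

/-! ### Solid harmonics: harmonicity, homogeneity, relation to `sphHarmonic`, nontriviality. -/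

section SolidHarmonic

/-- The coefficients of the Legendre functions, up to normalization. -/
def legendreCoeff (n M j : ℕ) : ℤ :=
  (-1) ^ j * (n.choose j : ℤ) * ((2 * (n - j)).descFactorial (n + M) : ℤ)

/-- The complex solid harmonic `r ^ n P_n^(M)(cos θ) (sin θ)^M e^(i M φ)`, up to normalization. -/
noncomputable def solidC (n M : ℕ) (x : R3) : ℂ :=
  ∑ j ∈ Finset.range (n + 1), (legendreCoeff n M j : ℂ) *
    (coordC 2 x ^ (2 * (n - j) - (n + M)) * (normSqC x ^ j * planeC x ^ M))

lemma contDiff_solidC (n M : ℕ) : ContDiff ℝ (⊤ : ℕ∞) (solidC n M) :=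
  ContDiff.sum fun _ _ => contDiff_const.mul (((contDiff_coordC 2).pow _).mul
    ((contDiff_normSqC.pow _).mul (contDiff_planeC.pow _)))

/-- Both sides equal the descending factorial of N + 2 with P + 2 factors, split off at one end or
at the other. -/
lemma descFactorial_identity (N P : ℕ) :
    ((N + 2).descFactorial P : ℤ) * ((N + 2 - P : ℕ) * ((N + 2 - P : ℕ) - 1))
      = (N + 2) * (N + 1) * (N.descFactorial P : ℤ) := by
  have h1 : (N + 2).descFactorial (P + 2) = (N + 2) * ((N + 1) * N.descFactorial P) := by
    rw [Nat.succ_descFactorial_succ, Nat.succ_descFactorial_succ]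
  have h2 : (N + 2).descFactorial (P + 2)
      = (N + 2 - (P + 1)) * ((N + 2 - P) * (N + 2).descFactorial P) := by
    rw [Nat.descFactorial_succ, Nat.descFactorial_succ]
  have h3 : ((N + 2 - P : ℕ) : ℤ) * ((N + 2 - P : ℕ) - 1)
      = ((N + 2 - P : ℕ) : ℤ) * (N + 2 - (P + 1) : ℕ) := by
    rcases Nat.lt_or_ge P (N + 2) with h | h
    · rw [Nat.cast_sub (by omega), Nat.cast_sub (by omega)]; push_cast; ring
    · rw [Nat.sub_eq_zero_of_le h]; simp
  rw [h3]
  have h4 := congrArg (fun t : ℕ => (t : ℤ)) (h2.symm.trans h1)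
  push_cast at h4 ⊢
  linear_combination h4

/-- Lowering z^a r^(2j) in z gives the same monomial as lowering the (j+1)-st term in r². The
recursion says that the two contributions cancel. -/
lemma legendreCoeff_recursion {n M j : ℕ} (hj : j < n) :
    legendreCoeff n M j * ((2 * (n - j) - (n + M) : ℕ) * ((2 * (n - j) - (n + M) : ℕ) - 1))
      + legendreCoeff n M (j + 1) * (2 * ((j + 1 : ℕ) : ℤ) *
        (2 * ((j + 1 : ℕ) : ℤ) + 1 + 2 * (2 * (n - (j + 1)) - (n + M) : ℕ) + 2 * M)) = 0 := by
  obtain ⟨q, rfl⟩ : ∃ q, n = j + 1 + q := ⟨n - (j + 1), by omega⟩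
  have e1 : j + 1 + q - j = q + 1 := by omega
  have e2 : j + 1 + q - (j + 1) = q := by omega
  rw [legendreCoeff, legendreCoeff, e1, e2]
  have h1 := descFactorial_identity (2 * q) (j + 1 + q + M)
  have h2 : (((j + 1 + q).choose (j + 1) : ℕ) : ℤ) * (j + 1) = ((j + 1 + q).choose j : ℕ) * (q + 1) := by
    have := Nat.choose_succ_right_eq (j + 1 + q) j
    rw [e1] at this
    exact_mod_cast this
  have h3 : ((2 * q).descFactorial (j + 1 + q + M) : ℤ) *
      (2 * ((j + 1 : ℕ) : ℤ) + 1 + 2 * (2 * q - (j + 1 + q + M) : ℕ) + 2 * M)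
      = ((2 * q).descFactorial (j + 1 + q + M) : ℤ) * (2 * q + 1) := by
    rcases Nat.lt_or_ge (2 * q) (j + 1 + q + M) with h | h
    · rw [Nat.descFactorial_eq_zero_iff_lt.2 h]; simp
    · rw [Nat.cast_sub h]; push_cast; ring
  rw [show 2 * (q + 1) = 2 * q + 2 by ring]
  push_cast at h1 h2 h3 ⊢
  rw [pow_succ]
  linear_combination (-1) ^ j * ((j + 1 + q).choose j : ℤ) * h1
    - (-1) ^ j * ((j + 1 + q).choose (j + 1) : ℤ) * 2 * (j + 1) * h3
    - (-1) ^ j * ((2 * q).descFactorial (j + 1 + q + M) : ℤ) * 2 * (2 * q + 1) * h2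

lemma laplacian_solidC (n M : ℕ) (x : R3) : laplacian (solidC n M) x = 0 := by
  have hc : ∀ j, ContDiff ℝ (⊤ : ℕ∞) fun y => coordC 2 y ^ (2 * (n - j) - (n + M)) *
      (normSqC y ^ j * planeC y ^ M) := fun j => ((contDiff_coordC 2).pow _).mul
    ((contDiff_normSqC.pow _).mul (contDiff_planeC.pow _))
  have h : laplacian (solidC n M) x = _ := laplacian_sum (Finset.range (n + 1))
    (f := fun j y => (legendreCoeff n M j : ℂ) *
      (coordC 2 y ^ (2 * (n - j) - (n + M)) * (normSqC y ^ j * planeC y ^ M)))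
    (fun j => contDiff_const.mul (hc j)) x
  rw [h]
  simp only [laplacian_const_mul (hc _), laplacian_monomial]
  set z := coordC 2 x
  set s := normSqC x
  set A : ℕ → ℂ := fun j => (legendreCoeff n M j : ℂ) * (((2 * (n - j) - (n + M) : ℕ) : ℂ) *
    ((2 * (n - j) - (n + M) : ℕ) - 1) * z ^ (2 * (n - j) - (n + M) - 2) * s ^ j * planeC x ^ M) with hA
  set B : ℕ → ℂ := fun j => (legendreCoeff n M j : ℂ) * (2 * (j : ℂ) *
    (2 * j + 1 + 2 * (2 * (n - j) - (n + M) : ℕ) + 2 * M) * z ^ (2 * (n - j) - (n + M)) * s ^ (j - 1)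
      * planeC x ^ M) with hB
  have e : ∀ j ∈ Finset.range (n + 1), (legendreCoeff n M j : ℂ) *
      ((((2 * (n - j) - (n + M) : ℕ) : ℂ) * ((2 * (n - j) - (n + M) : ℕ) - 1) *
        z ^ (2 * (n - j) - (n + M) - 2) * s ^ j + 2 * (j : ℂ) *
        (2 * j + 1 + 2 * (2 * (n - j) - (n + M) : ℕ) + 2 * M) * z ^ (2 * (n - j) - (n + M)) *
        s ^ (j - 1)) * planeC x ^ M) = A j + B j := fun j _ => by simp only [hA, hB]; ring
  -- The sum telescopes: the last `A` vanishes (its exponent of z is 0), the first `B` has the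
  -- factor 0, and `A j` cancels `B (j + 1)`.
  rw [Finset.sum_congr rfl e, Finset.sum_add_distrib, Finset.sum_range_succ, Finset.sum_range_succ' B]
  have hAn : A n = 0 := by simp [hA]
  have hB0 : B 0 = 0 := by simp [hB]
  rw [hAn, hB0, add_zero, add_zero, ← Finset.sum_add_distrib]
  refine Finset.sum_eq_zero fun j hj => ?_
  have hj' := Finset.mem_range.1 hj
  have hrec := congrArg (fun t : ℤ => (t : ℂ)) (legendreCoeff_recursion (M := M) hj')
  simp only [hA, hB, Nat.add_sub_cancel]
  have hexp : 2 * (n - (j + 1)) - (n + M) = 2 * (n - j) - (n + M) - 2 := by omega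
  rw [hexp] at hrec ⊢
  push_cast at hrec ⊢
  linear_combination z ^ (2 * (n - j) - (n + M) - 2) * s ^ j * planeC x ^ M * hrec

lemma solidC_smul (n M : ℕ) (t : ℝ) (x : R3) : solidC n M (t • x) = (t : ℂ) ^ n * solidC n M x := by
  rw [solidC, solidC, Finset.mul_sum]
  refine Finset.sum_congr rfl fun j hj => ?_
  have h1 : coordC 2 (t • x) = t * coordC 2 x := by simp [coordC]
  have h2 : normSqC (t • x) = t ^ 2 * normSqC x := by simp [normSqC, norm_smul, mul_pow]
  have h3 : planeC (t • x) = t * planeC x := by simp [planeC]; ring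
  rw [h1, h2, h3]
  -- Where the exponent of z is truncated by natural subtraction, the descending factorial in the
  -- coefficient is 0. Otherwise the degrees add up to n.
  rcases Nat.lt_or_ge (2 * (n - j)) (n + M) with h | h
  · rw [legendreCoeff, Nat.descFactorial_eq_zero_iff_lt.2 h]; simp
  · have hjn : j ≤ n := Nat.lt_succ_iff.1 (Finset.mem_range.1 hj)
    have e : (t : ℂ) ^ n = t ^ (2 * (n - j) - (n + M)) * (t ^ (2 * j) * t ^ M) := by
      rw [← pow_add, ← pow_add]; congr 1; omega
    rw [e, pow_mul, mul_pow, mul_pow, mul_pow]; ring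

lemma eval_iterate_derivative_legendreP (n M : ℕ) (t : ℝ) :
    (Polynomial.derivative^[M] (legendreP n)).eval t = (1 / (2 ^ n * (n.factorial : ℝ))) *
      ∑ j ∈ Finset.range (n + 1), (legendreCoeff n M j : ℝ) * t ^ (2 * (n - j) - (n + M)) := by
  rw [legendreP, Polynomial.iterate_derivative_C_mul, ← Function.iterate_add_apply,
    Polynomial.eval_C_mul]
  congr 1
  rw [show (Polynomial.X ^ 2 - 1 : ℝ[X]) = -1 + Polynomial.X ^ 2 by ring, add_pow,
    Polynomial.iterate_derivative_sum, Polynomial.eval_finsetSum]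
  refine Finset.sum_congr rfl fun j _ => ?_
  rw [show ((-1) ^ j * (Polynomial.X ^ 2) ^ (n - j) * ((n.choose j : ℕ) : ℝ[X]))
    = Polynomial.C ((-1) ^ j * (n.choose j : ℝ)) * Polynomial.X ^ (2 * (n - j)) by
      rw [← pow_mul]; simp; ring, Polynomial.iterate_derivative_C_mul,
    Polynomial.iterate_derivative_X_pow_eq_natCast_mul, legendreCoeff, Nat.add_comm M n]
  simp
  ring

/-- In total n + M ≤ 2n derivatives are applied to the monic polynomial (X² - 1)^n of degree 2n, so
its leading term survives. -/
lemma iterate_derivative_legendreP_ne_zero {n M : ℕ} (hM : M ≤ n) :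
    Polynomial.derivative^[M] (legendreP n) ≠ 0 := by
  intro h
  rw [legendreP, Polynomial.iterate_derivative_C_mul, ← Function.iterate_add_apply] at h
  have hC : Polynomial.C ((1 : ℝ) / (2 ^ n * (n.factorial : ℝ))) ≠ 0 := by
    rw [Ne, Polynomial.C_eq_zero]
    have : (n.factorial : ℝ) ≠ 0 := by exact_mod_cast n.factorial_ne_zero
    positivity
  have h' := (mul_eq_zero.1 h).resolve_left hC
  have hc := congrArg (fun p => Polynomial.coeff p (n - M)) h'
  simp only [Polynomial.coeff_iterate_derivative, Polynomial.coeff_zero] at hc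
  have hm : (Polynomial.X ^ 2 - 1 : ℝ[X]).Monic := by
    simpa using Polynomial.monic_X_pow_sub_C (1 : ℝ) two_ne_zero
  have hd : ((Polynomial.X ^ 2 - 1 : ℝ[X]) ^ n).natDegree = n - M + (M + n) := by
    rw [hm.natDegree_pow, show (Polynomial.X ^ 2 - 1 : ℝ[X]) = Polynomial.X ^ 2 - Polynomial.C 1 by simp,
      Polynomial.natDegree_X_pow_sub_C]
    omega
  rw [← hd, (hm.pow n).coeff_natDegree] at hc
  rw [nsmul_eq_mul, mul_one] at hc
  have hc' : ((Polynomial.X ^ 2 - 1 : ℝ[X]) ^ n).natDegree.descFactorial (M + n) = 0 := by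
    exact_mod_cast hc
  rw [Nat.descFactorial_eq_zero_iff_lt, hd] at hc'
  omega

/-- The real or imaginary part, according to the sign of `m`. -/
noncomputable def partCLM (m : ℤ) : ℂ →L[ℝ] ℝ := if 0 ≤ m then Complex.reCLM else Complex.imCLM

lemma partCLM_real_mul (m : ℤ) (a : ℝ) (z : ℂ) : partCLM m (a * z) = a * partCLM m z := by
  unfold partCLM
  split_ifs <;> simp

/-- The normalization constant of the spherical harmonics. -/
noncomputable def harmonicNorm (n : ℕ) (m : ℤ) : ℝ :=
  √((2 * n + 1) / (4 * Real.pi) * (((n - m.natAbs).factorial : ℝ) / ((n + m.natAbs).factorial : ℝ))) *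
    (if m = 0 then 1 else √2)

lemma harmonicNorm_ne_zero (n : ℕ) (m : ℤ) : harmonicNorm n m ≠ 0 := by
  have h1 : (0 : ℝ) < (n - m.natAbs).factorial := by exact_mod_cast Nat.factorial_pos _
  have h2 : (0 : ℝ) < (n + m.natAbs).factorial := by exact_mod_cast Nat.factorial_pos _
  have h3 := Real.pi_pos
  refine mul_ne_zero (Real.sqrt_ne_zero'.2 (by positivity)) ?_
  split_ifs <;> positivity

lemma sphHarmonic_eq (n : ℕ) (m : ℤ) (ω : R3) : sphHarmonic n m ω = harmonicNorm n m *
    (Polynomial.derivative^[m.natAbs] (legendreP n)).eval (ω 2) * partCLM m (planeC ω ^ m.natAbs) := by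
  rw [sphHarmonic, harmonicNorm, partCLM, planeC]
  split_ifs <;> simp

/-- The solid harmonic `r ^ n Y_n^m`, a homogeneous harmonic polynomial. -/
noncomputable def solidHarmonic (n : ℕ) (m : ℤ) (x : R3) : ℝ :=
  harmonicNorm n m * (1 / (2 ^ n * (n.factorial : ℝ))) * partCLM m (solidC n m.natAbs x)

lemma contDiff_solidHarmonic (n : ℕ) (m : ℤ) : ContDiff ℝ (⊤ : ℕ∞) (solidHarmonic n m) :=
  contDiff_const.mul ((partCLM m).contDiff.comp (contDiff_solidC _ _))

lemma solidHarmonic_smul (n : ℕ) (m : ℤ) (t : ℝ) (x : R3) :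
    solidHarmonic n m (t • x) = t ^ n * solidHarmonic n m x := by
  rw [solidHarmonic, solidC_smul, show (t : ℂ) ^ n = ((t ^ n : ℝ) : ℂ) by push_cast; rfl,
    partCLM_real_mul, solidHarmonic]
  ring

lemma laplacian_solidHarmonic (n : ℕ) (m : ℤ) (x : R3) : laplacian (solidHarmonic n m) x = 0 := by
  have h := laplacian_clm_comp ((harmonicNorm n m * (1 / (2 ^ n * (n.factorial : ℝ)))) • partCLM m)
    (contDiff_solidC n m.natAbs) x
  rw [laplacian_solidC, map_zero] at h
  exact h

lemma sphHarmonic_eq_solidHarmonic (n : ℕ) (m : ℤ) {ω : R3} (hω : ‖ω‖ = 1) :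
    sphHarmonic n m ω = solidHarmonic n m ω := by
  have h : solidC n m.natAbs ω = ((∑ j ∈ Finset.range (n + 1), (legendreCoeff n m.natAbs j : ℝ) *
      (ω 2) ^ (2 * (n - j) - (n + m.natAbs)) : ℝ) : ℂ) * planeC ω ^ m.natAbs := by
    rw [solidC]
    push_cast
    rw [Finset.sum_mul]
    refine Finset.sum_congr rfl fun j _ => ?_
    simp [normSqC, hω, coordC]
    ring
  rw [sphHarmonic_eq, eval_iterate_derivative_legendreP, solidHarmonic, h, partCLM_real_mul]
  ring

lemma exists_sphHarmonic_ne_zero {n : ℕ} {m : ℤ} (hm : |m| ≤ (n : ℤ)) :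
    ∃ ω : R3, ‖ω‖ = 1 ∧ sphHarmonic n m ω ≠ 0 := by
  have hM : m.natAbs ≤ n := by rw [Int.abs_eq_natAbs] at hm; omega
  obtain ⟨t, ht, htr⟩ : ∃ t ∈ Set.Ioo (-1 : ℝ) 1,
      (Polynomial.derivative^[m.natAbs] (legendreP n)).eval t ≠ 0 := by
    by_contra hcon
    push Not at hcon
    exact iterate_derivative_legendreP_ne_zero hM
      (Polynomial.eq_zero_of_infinite_isRoot _ ((Set.Ioo_infinite (by norm_num)).mono hcon))
  -- This angle makes the azimuthal factor, cos(|m|φ) or sin(|m|φ), equal to 1.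
  set φ : ℝ := if 0 ≤ m then 0 else Real.pi / (2 * m.natAbs) with hφ
  have hpos : 0 < 1 - t ^ 2 := by nlinarith [ht.1, ht.2]
  set ρ := √(1 - t ^ 2) with hρ
  have hρ0 : 0 < ρ := Real.sqrt_pos.2 hpos
  have hρ2 : ρ ^ 2 = 1 - t ^ 2 := Real.sq_sqrt hpos.le
  refine ⟨!₂[ρ * Real.cos φ, ρ * Real.sin φ, t], ?_, ?_⟩
  · rw [EuclideanSpace.norm_eq, Real.sqrt_eq_one, Fin.sum_univ_three]
    simp only [Real.norm_eq_abs, sq_abs]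
    simp
    linear_combination ρ ^ 2 * Real.sin_sq_add_cos_sq φ + hρ2
  · have hw : planeC !₂[ρ * Real.cos φ, ρ * Real.sin φ, t] ^ m.natAbs
        = ((ρ ^ m.natAbs : ℝ) : ℂ) * Complex.exp ((m.natAbs * φ : ℝ) * Complex.I) := by
      have : planeC !₂[ρ * Real.cos φ, ρ * Real.sin φ, t] = ρ * Complex.exp (φ * Complex.I) := by
        rw [Complex.exp_mul_I]
        simp [planeC]; ring
      rw [this, mul_pow, ← Complex.exp_nat_mul]
      push_cast
      ring_nf
    rw [sphHarmonic_eq, hw, partCLM_real_mul]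
    refine mul_ne_zero (mul_ne_zero (harmonicNorm_ne_zero n m) (by simpa using htr))
      (mul_ne_zero (pow_pos hρ0 _).ne' ?_)
    rw [partCLM]
    split_ifs with h0
    · simp [hφ, h0]
    · have hne : (m.natAbs : ℝ) ≠ 0 := by
        have : m.natAbs ≠ 0 := by omega
        exact_mod_cast this
      have : (m.natAbs : ℝ) * φ = Real.pi / 2 := by
        rw [hφ, if_neg h0]; field_simp
      rw [this]
      simp [Complex.exp_mul_I]

end SolidHarmonic

/-! ### Euler's identity for homogeneous functions. -/

section Homogeneous

variable {p : R3 → ℝ} {n : ℕ}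

lemma fderiv_apply_eq_sum {F : Type*} [NormedAddCommGroup F] [NormedSpace ℝ F] (f : R3 → F) (x y : R3) :
    fderiv ℝ f x y = ∑ i, y i • pderiv i f x := by
  have h : y = ∑ i, y i • basisVec i := by
    ext a
    simp [basisVec, Finset.sum_apply, Pi.single_apply]
  conv_lhs => rw [h]
  simp [pderiv]

lemma euler_identity (hp : ContDiff ℝ (⊤ : ℕ∞) p) (hh : ∀ (t : ℝ) x, p (t • x) = t ^ n * p x) (x : R3) :
    ∑ i, x i * pderiv i p x = n * p x := by
  have h1 : HasDerivAt (fun t : ℝ => t • x) x 1 := by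
    simpa using (hasDerivAt_id (1 : ℝ)).smul_const x
  have hd : HasFDerivAt p (fderiv ℝ p x) ((1 : ℝ) • x) := by
    rw [one_smul]; exact (hp.differentiable (by simp) x).hasFDerivAt
  have h2 := hd.comp_hasDerivAt (1 : ℝ) h1
  have h3 : HasDerivAt (fun t : ℝ => t ^ n * p x) (n * p x) 1 := by
    simpa using (hasDerivAt_pow n (1 : ℝ)).mul_const (p x)
  have e : (p ∘ fun t : ℝ => t • x) = fun t => t ^ n * p x := funext fun t => hh t x
  rw [e] at h2
  rw [← h2.unique h3, fderiv_apply_eq_sum]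
  simp

/-- Euler's identity differentiated once: first derivatives are homogeneous of degree n - 1. -/
lemma euler_identity_pderiv (hp : ContDiff ℝ (⊤ : ℕ∞) p) (hh : ∀ (t : ℝ) x, p (t • x) = t ^ n * p x)
    (j : Fin 3) (x : R3) :
    ∑ i, x i * pderiv i (pderiv j p) x = (n - 1) * pderiv j p x := by
  have h := congrArg (fun f => pderiv j f x) (funext fun y => euler_identity hp hh y)
  have dp := fun i => (contDiff_pderiv hp i).differentiable (by simp) x
  have dc : ∀ i, DifferentiableAt ℝ (fun y : R3 => y i) x := fun i =>
    (EuclideanSpace.proj i : R3 →L[ℝ] ℝ).differentiableAt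
  simp only at h
  rw [pderiv_const_mul _ (hp.differentiable (by simp) x),
    pderiv_sum _ (fun i _ => (dc i).fun_mul (dp i))] at h
  simp only [pderiv_mul (dc _) (dp _), pderiv_coord, Finset.sum_add_distrib, ite_mul, one_mul, zero_mul,
    Finset.sum_ite_eq', Finset.mem_univ, if_true] at h
  simp only [pderiv_comm hp _ j]
  linear_combination h

end Homogeneous


/-! ### Electric and magnetic multipole fields. -/

section Mie

lemma fin_three_cases (i : Fin 3) : i = 0 ∨ i = 1 ∨ i = 2 := by
  fin_cases i <;> simp

/-- The magnetic multipole field `f(r²) x × ∇p`. -/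
noncomputable def magField (f : ℝ → ℝ) (p : R3 → ℝ) (x : R3) : C3 :=
  (f (‖x‖ ^ 2) : ℂ) • crossC (toC3 x) (grad (fun y => (p y : ℂ)) x)

/-- The radial factor `((n + 1) f + 2 s f')(s)`. -/
noncomputable def elecFactor (n : ℕ) (f : ℝ → ℝ) (s : ℝ) : ℝ := (n + 1) * f s + 2 * s * deriv f s

/-- The electric multipole field, which is minus the curl of `magField`. -/
noncomputable def elecField (n : ℕ) (f : ℝ → ℝ) (p : R3 → ℝ) (x : R3) : C3 :=
  ((-2 * n * deriv f (‖x‖ ^ 2) * p x : ℝ) : ℂ) • toC3 x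
    + (elecFactor n f (‖x‖ ^ 2) : ℂ) • grad (fun y => (p y : ℂ)) x

variable {f : ℝ → ℝ} {p : R3 → ℝ} {n : ℕ} {κ : ℝ}

lemma contDiff_deriv (hf : ContDiff ℝ (⊤ : ℕ∞) f) : ContDiff ℝ (⊤ : ℕ∞) (deriv f) :=
  hf.iterate_deriv 1

lemma contDiff_elecFactor (hf : ContDiff ℝ (⊤ : ℕ∞) f) : ContDiff ℝ (⊤ : ℕ∞) (elecFactor n f) :=
  (contDiff_const.mul hf).add ((contDiff_const.mul contDiff_id).mul (contDiff_deriv hf))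

lemma deriv_elecFactor (hf : ContDiff ℝ (⊤ : ℕ∞) f) (s : ℝ) :
    deriv (elecFactor n f) s = (n + 3) * deriv f s + 2 * s * deriv (deriv f) s := by
  have h1 := (hf.differentiable (by simp) s).hasDerivAt
  have h2 := ((contDiff_deriv hf).differentiable (by simp) s).hasDerivAt
  have h3 := (h1.const_mul ((n : ℝ) + 1)).add (((hasDerivAt_id s).const_mul 2).mul h2)
  refine HasDerivAt.deriv (h3.congr_deriv ?_)
  simp; ring

lemma contDiff_ofReal {g : R3 → ℝ} (hg : ContDiff ℝ (⊤ : ℕ∞) g) :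
    ContDiff ℝ (⊤ : ℕ∞) (fun x => (g x : ℂ)) := Complex.ofRealCLM.contDiff.comp hg

lemma contDiff_radial {g : ℝ → ℝ} (hg : ContDiff ℝ (⊤ : ℕ∞) g) :
    ContDiff ℝ (⊤ : ℕ∞) (fun x : R3 => g (‖x‖ ^ 2)) := hg.comp contDiff_normSq

lemma contDiff_magField (hf : ContDiff ℝ (⊤ : ℕ∞) f) (hp : ContDiff ℝ (⊤ : ℕ∞) p) :
    ContDiff ℝ (⊤ : ℕ∞) (magField f p) :=
  (contDiff_ofReal (contDiff_radial hf)).smul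
    (contDiff_crossC contDiff_toC3 (contDiff_grad (contDiff_ofReal hp)))

lemma contDiff_elecField (hf : ContDiff ℝ (⊤ : ℕ∞) f) (hp : ContDiff ℝ (⊤ : ℕ∞) p) :
    ContDiff ℝ (⊤ : ℕ∞) (elecField n f p) :=
  ((contDiff_ofReal ((contDiff_const.mul (contDiff_radial (contDiff_deriv hf))).mul hp)).smul
    contDiff_toC3).add ((contDiff_ofReal (contDiff_radial (contDiff_elecFactor hf))).smul
      (contDiff_grad (contDiff_ofReal hp)))

lemma grad_ofReal (hp : ContDiff ℝ (⊤ : ℕ∞) p) (x : R3) (i : Fin 3) :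
    grad (fun y => (p y : ℂ)) x i = ((pderiv i p x : ℝ) : ℂ) :=
  pderiv_ofReal (hp.differentiable (by simp) x) i

lemma curl_toC3 (x : R3) : curl toC3 x = 0 := by
  have e : ∀ a, (fun y => toC3 y a) = coordC a := fun a => rfl
  ext i
  rw [curl_apply (contDiff_toC3.differentiable (by simp) x), e, e, pderiv_coordC, pderiv_coordC]
  fin_cases i <;> simp

/-- From curl(a × b) = a div b - b div a + (b·∇)a - (a·∇)b with a = x and b = ∇p: the terms are xΔp
= 0, -3∇p, ∇p and, by Euler, -(n - 1)∇p. -/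
lemma curl_cross_grad (hp : ContDiff ℝ (⊤ : ℕ∞) p) (hh : ∀ (t : ℝ) x, p (t • x) = t ^ n * p x)
    (hl : ∀ x, laplacian p x = 0) (x : R3) :
    curl (fun y => crossC (toC3 y) (grad (fun z => (p z : ℂ)) y)) x
      = (-(n + 1) : ℂ) • grad (fun y => (p y : ℂ)) x := by
  have hZ : ContDiff ℝ (⊤ : ℕ∞) (fun y => crossC (toC3 y) (grad (fun z => (p z : ℂ)) y)) :=
    contDiff_crossC contDiff_toC3 (contDiff_grad (contDiff_ofReal hp))
  have dc : ∀ i, DifferentiableAt ℝ (fun y : R3 => y i) x := fun i =>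
    (EuclideanSpace.proj i : R3 →L[ℝ] ℝ).differentiableAt
  have dp := fun i => (contDiff_pderiv hp i).differentiable (by simp) x
  have hcomp : ∀ a j, pderiv j (fun y => crossC (toC3 y) (grad (fun z => (p z : ℂ)) y) a) x
      = ((((if a + 1 = j then 1 else 0) * pderiv (a + 2) p x + x (a + 1) * pderiv j (pderiv (a + 2) p) x)
        - ((if a + 2 = j then 1 else 0) * pderiv (a + 1) p x
          + x (a + 2) * pderiv j (pderiv (a + 1) p) x) : ℝ) : ℂ) := by
    intro a j
    rw [show (fun y => crossC (toC3 y) (grad (fun z => (p z : ℂ)) y) a)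
      = fun y => ((y (a + 1) * pderiv (a + 2) p y - y (a + 2) * pderiv (a + 1) p y : ℝ) : ℂ) by
        ext y; simp [crossC, toC3, grad_ofReal hp],
      pderiv_ofReal (((dc _).fun_mul (dp _)).fun_sub ((dc _).fun_mul (dp _))),
      pderiv_sub ((dc _).fun_mul (dp _)) ((dc _).fun_mul (dp _)), pderiv_mul (dc _) (dp _),
      pderiv_mul (dc _) (dp _), pderiv_coord, pderiv_coord]
  have hL := hl x
  have hE := fun j => euler_identity_pderiv hp hh j x
  simp only [laplacian, Fin.sum_univ_three] at hL hE
  have c01 := pderiv_comm hp 0 1 x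
  have c02 := pderiv_comm hp 0 2 x
  have c12 := pderiv_comm hp 1 2 x
  ext i
  rw [curl_apply (hZ.differentiable (by simp) x), hcomp, hcomp, PiLp.smul_apply, grad_ofReal hp,
    smul_eq_mul, show (-(n + 1) : ℂ) = ((-(n + 1) : ℝ) : ℂ) by push_cast; ring,
    ← Complex.ofReal_sub, ← Complex.ofReal_mul]
  congr 1
  obtain ⟨c, hc⟩ : ∃ c : Fin 3 → ℝ, ∀ a, x a = c a := ⟨fun a => x a, fun _ => rfl⟩
  simp only [hc] at hE ⊢
  obtain rfl | rfl | rfl := fin_three_cases i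
  · norm_num [Fin.ext_iff, show (2 + 2 : Fin 3) = 1 from rfl, show (1 + 2 : Fin 3) = 0 from rfl,
      show (2 + 1 : Fin 3) = 0 from rfl, show (1 + 1 : Fin 3) = 2 from rfl]
    linear_combination c 0 * hL - hE 0
  · norm_num [Fin.ext_iff, show (2 + 2 : Fin 3) = 1 from rfl, show (1 + 2 : Fin 3) = 0 from rfl,
      show (2 + 1 : Fin 3) = 0 from rfl, show (1 + 1 : Fin 3) = 2 from rfl]
    linear_combination c 1 * hL - hE 1
  · norm_num [Fin.ext_iff, show (2 + 2 : Fin 3) = 1 from rfl, show (1 + 2 : Fin 3) = 0 from rfl,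
      show (2 + 1 : Fin 3) = 0 from rfl, show (1 + 1 : Fin 3) = 2 from rfl]
    linear_combination c 2 * hL - hE 2

lemma dot_toC3_toC3 (x : R3) : dot (toC3 x) (toC3 x) = ((‖x‖ ^ 2 : ℝ) : ℂ) := by
  rw [EuclideanSpace.norm_sq_eq]
  simp [dot, toC3, Fin.sum_univ_three, pow_two]

lemma dot_toC3_grad (hp : ContDiff ℝ (⊤ : ℕ∞) p) (hh : ∀ (t : ℝ) x, p (t • x) = t ^ n * p x) (x : R3) :
    dot (toC3 x) (grad (fun y => (p y : ℂ)) x) = n * p x := by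
  have h := congrArg (fun t : ℝ => (t : ℂ)) (euler_identity hp hh x)
  simp only [dot, grad_ofReal hp, toC3]
  push_cast at h
  exact h

lemma crossC_crossC (a b : C3) : crossC a (crossC a b) = dot a b • a - dot a a • b := by
  ext i
  simp only [crossC, dot, Fin.sum_univ_three, PiLp.sub_apply, PiLp.smul_apply, smul_eq_mul]
  obtain rfl | rfl | rfl := fin_three_cases i <;> norm_num [show (2 + 2 : Fin 3) = 1 from rfl, show (1 + 2 : Fin 3) = 0 from rfl,
      show (2 + 1 : Fin 3) = 0 from rfl, show (1 + 1 : Fin 3) = 2 from rfl] <;> ring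

/-- The derivative of the radial factor contributes 2f' x × (x × ∇p) = 2f'(n p x - r²∇p), and the
rest is `curl_cross_grad`. -/
lemma curl_magField (hf : ContDiff ℝ (⊤ : ℕ∞) f) (hp : ContDiff ℝ (⊤ : ℕ∞) p)
    (hh : ∀ (t : ℝ) x, p (t • x) = t ^ n * p x) (hl : ∀ x, laplacian p x = 0) (x : R3) :
    curl (magField f p) x = - elecField n f p x := by
  have hZ : ContDiff ℝ (⊤ : ℕ∞) (fun y => crossC (toC3 y) (grad (fun z => (p z : ℂ)) y)) :=
    contDiff_crossC contDiff_toC3 (contDiff_grad (contDiff_ofReal hp))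
  have h : curl (magField f p) x = _ :=
    curl_radial_smul (hf.differentiable (by simp)) (hZ.differentiable (by simp)) x
  rw [h, curl_cross_grad hp hh hl, crossC_crossC, dot_toC3_grad hp hh, dot_toC3_toC3, elecField, elecFactor]
  ext i
  simp only [PiLp.add_apply, PiLp.sub_apply, PiLp.smul_apply, PiLp.neg_apply, smul_eq_mul]
  push_cast
  ring

lemma crossC_add_left (a b c : C3) : crossC (a + b) c = crossC a c + crossC b c := by
  ext i; simp [crossC]; ring

lemma crossC_smul_left (t : ℂ) (a b : C3) : crossC (t • a) b = t • crossC a b := by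
  ext i; simp [crossC]; ring

lemma crossC_self (a : C3) : crossC a a = 0 := by
  ext i; simp [crossC]; ring

lemma crossC_swap (a b : C3) : crossC a b = - crossC b a := by
  ext i; simp [crossC]; ring

lemma grad_mul_ofReal {g : R3 → ℝ} (hg : ContDiff ℝ (⊤ : ℕ∞) g) (hp : ContDiff ℝ (⊤ : ℕ∞) p) (x : R3) :
    grad (fun y => ((g y * p y : ℝ) : ℂ)) x = (p x : ℂ) • grad (fun y => (g y : ℂ)) x
      + (g x : ℂ) • grad (fun y => (p y : ℂ)) x := by
  ext i
  rw [grad_ofReal (hg.mul hp), PiLp.add_apply, PiLp.smul_apply, PiLp.smul_apply, grad_ofReal hg,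
    grad_ofReal hp, pderiv_mul (hg.differentiable (by simp) x) (hp.differentiable (by simp) x)]
  simp only [smul_eq_mul]
  push_cast
  ring

/-- The electric field is a radial field vanishing with `f`, up to a gradient. -/
lemma elecField_eq (hf : ContDiff ℝ (⊤ : ℕ∞) f) (hp : ContDiff ℝ (⊤ : ℕ∞) p)
    (hode : ∀ s, 4 * s * deriv (deriv f) s + (6 + 4 * n) * deriv f s + κ * f s = 0) (x : R3) :
    elecField n f p x = (f (‖x‖ ^ 2) : ℂ) • ((κ * p x : ℝ) : ℂ) • toC3 x
      + grad (fun y => ((elecFactor n f (‖y‖ ^ 2) * p y : ℝ) : ℂ)) x := by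
  rw [grad_mul_ofReal (contDiff_radial (contDiff_elecFactor hf)) hp,
    grad_radial ((contDiff_elecFactor hf).differentiable (by simp)), deriv_elecFactor hf, elecField]
  have h := congrArg (fun t : ℝ => (t : ℂ)) (hode (‖x‖ ^ 2))
  ext i
  simp only [PiLp.add_apply, PiLp.smul_apply, smul_eq_mul]
  push_cast at h ⊢
  linear_combination - (p x : ℂ) * toC3 x i * h

/-- In the decomposition `elecField_eq` the gradient drops out, and the curl of the radial part κ f
p x is ∇(κ f p) × x, where only f κ ∇p × x remains because ∇f(r²) is parallel to x. -/
lemma curl_elecField (hf : ContDiff ℝ (⊤ : ℕ∞) f) (hp : ContDiff ℝ (⊤ : ℕ∞) p)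
    (hode : ∀ s, 4 * s * deriv (deriv f) s + (6 + 4 * n) * deriv f s + κ * f s = 0) (x : R3) :
    curl (elecField n f p) x = (-κ : ℂ) • magField f p x := by
  have hg := contDiff_radial (contDiff_elecFactor (n := n) hf)
  have hA : ContDiff ℝ (⊤ : ℕ∞) fun y : R3 => f (‖y‖ ^ 2) * (κ * p y) :=
    (contDiff_radial hf).mul (contDiff_const.mul hp)
  rw [show elecField n f p = fun y => (((f (‖y‖ ^ 2) * (κ * p y) : ℝ) : ℂ) • toC3 y)
      + grad (fun y => ((elecFactor n f (‖y‖ ^ 2) * p y : ℝ) : ℂ)) y from funext fun y => by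
    rw [elecField_eq hf hp hode, smul_smul, ← Complex.ofReal_mul]]
  have hdA := (contDiff_ofReal hA).differentiable (by simp) x
  have hd := contDiff_toC3.differentiable (by simp) x
  rw [curl_add (hdA.fun_smul hd) ((contDiff_grad (contDiff_ofReal (hg.mul hp))).differentiable (by simp) x),
    curl_grad (contDiff_ofReal (hg.mul hp)), curl_smul hdA hd, curl_toC3,
    grad_mul_ofReal (contDiff_radial hf) (contDiff_const.mul hp), grad_radial (hf.differentiable (by simp)),
    crossC_add_left, crossC_smul_left, crossC_smul_left, crossC_smul_left, crossC_self, magField,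
    show grad (fun y => ((κ * p y : ℝ) : ℂ)) x = (κ : ℂ) • grad (fun y => (p y : ℂ)) x by
      rw [← grad_const_mul _ ((contDiff_ofReal hp).differentiable (by simp) x)]; push_cast; rfl,
    crossC_smul_left, crossC_swap]
  simp only [smul_zero, zero_add, add_zero, smul_neg, neg_smul]
  rw [smul_comm]

/-- The f' terms cancel in the radial component. Hence the normal component vanishes on the sphere
together with f(1), and this component will also show that the field is nontrivial. -/
lemma dot_elecField (hp : ContDiff ℝ (⊤ : ℕ∞) p) (hh : ∀ (t : ℝ) x, p (t • x) = t ^ n * p x) (x : R3) :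
    dot (elecField n f p x) (toC3 x) = ((n * (n + 1) * f (‖x‖ ^ 2) * p x : ℝ) : ℂ) := by
  rw [elecField, dot_add_left, dot_smul_left, dot_smul_left, dot_toC3_toC3, dot_comm _ (toC3 x),
    dot_toC3_grad hp hh, elecFactor]
  push_cast
  ring

end Mie

/-! ### Surface gradients of spherical harmonics in terms of solid harmonics. -/

section SurfaceGradient

variable {n : ℕ} {m : ℤ}

lemma gradient_apply (h : R3 → ℝ) (x : R3) (j : Fin 3) : gradient h x j = pderiv j h x := by
  have := InnerProductSpace.toDual_symm_apply (𝕜 := ℝ) (x := basisVec j) (y := fderiv ℝ h x)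
  rw [pderiv, ← this, EuclideanSpace.inner_single_right]
  simp [gradient]

lemma pderiv_smul_arg {p : R3 → ℝ} (hp : ContDiff ℝ (⊤ : ℕ∞) p)
    (hh : ∀ (t : ℝ) x, p (t • x) = t ^ n * p x) (t : ℝ) (x : R3) (j : Fin 3) :
    t * pderiv j p (t • x) = t ^ n * pderiv j p x := by
  have h1 : HasFDerivAt (fun y : R3 => t • y) (t • ContinuousLinearMap.id ℝ R3) x :=
    (hasFDerivAt_id x).const_smul t
  have h2 := ((hp.differentiable (by simp) (t • x)).hasFDerivAt.comp x h1).pderiv_eq j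
  rw [show (p ∘ fun y : R3 => t • y) = fun y => t ^ n * p y from funext fun y => hh t y,
    pderiv_const_mul _ (hp.differentiable (by simp) x)] at h2
  rw [h2]
  simp [pderiv]

lemma surfaceGrad_sphHarmonic {ω : R3} (hω : ‖ω‖ = 1) (j : Fin 3) :
    surfaceGrad (sphHarmonic n m) ω j
      = pderiv j (solidHarmonic n m) ω - n * solidHarmonic n m ω * ω j := by
  have hp := contDiff_solidHarmonic n m
  have hd := hp.differentiable (by simp) ω
  -- The extension of Y that is constant along rays is r^(-n) p. Writing r^(-n) as a power of r²
  -- allows the chain rule through the smooth function ‖x‖².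
  have hev : (fun x : R3 => sphHarmonic n m (‖x‖⁻¹ • x)) =ᶠ[𝓝 ω]
      fun x => (‖x‖ ^ 2) ^ (-(n : ℝ) / 2) * solidHarmonic n m x := by
    have hne : ω ≠ 0 := by intro h; simp [h] at hω
    filter_upwards [isOpen_ne.mem_nhds hne] with x hx
    have hx' : ‖x‖ ≠ 0 := norm_ne_zero_iff.2 hx
    rw [sphHarmonic_eq_solidHarmonic n m (by rw [norm_smul]; simp [hx']), solidHarmonic_smul]
    congr 1
    rw [← Real.rpow_natCast ‖x‖ 2, ← Real.rpow_mul (norm_nonneg x), inv_pow, ← Real.rpow_natCast ‖x‖ n,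
      ← Real.rpow_neg (norm_nonneg x)]
    congr 1
    push_cast; ring
  rw [surfaceGrad, gradient_apply, pderiv_congr_of_eventuallyEq hev]
  have h1 : HasDerivAt (fun s : ℝ => s ^ (-(n : ℝ) / 2)) (-(n : ℝ) / 2) (‖ω‖ ^ 2) := by
    rw [hω]
    refine (Real.hasDerivAt_rpow_const (x := (1 : ℝ) ^ 2) (p := -(n : ℝ) / 2) (by norm_num)).congr_deriv ?_
    simp
  have hns := contDiff_normSq.differentiable (by simp) ω
  have hcd : DifferentiableAt ℝ (fun x : R3 => (‖x‖ ^ 2) ^ (-(n : ℝ) / 2)) ω :=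
    DifferentiableAt.comp (g := fun s : ℝ => s ^ (-(n : ℝ) / 2)) ω h1.differentiableAt hns
  rw [pderiv_mul hcd hd, pderiv_comp_deriv h1.differentiableAt hns, h1.deriv,
    pderiv_normSq, hω]
  simp
  ring

end SurfaceGradient

/-! ### The fields in the ball: Maxwell's equations, boundary values, nontriviality. -/

section Incident

variable {n : ℕ} {m : ℤ} {k : ℝ}

/-- The denominator `j_n(k) + k j_n'(k)` in the fields. -/
noncomputable def fieldDenom (n : ℕ) (k : ℝ) : ℝ := sphBessel n k + k * deriv (sphBessel n) k

/-- The normalizing constant of the fields. -/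
noncomputable def fieldConst (n : ℕ) (k : ℝ) : ℝ := (fieldDenom n k)⁻¹ * (√((n : ℝ) * (n + 1)))⁻¹

/-- The origin is excluded because the defining formula divides by r = 0 there; the right side is
smooth across it. The proof rescales p and its derivatives from ω to x = rω. -/
lemma Eplus_eq (hn : 1 ≤ n) {x : R3} (hx : x ≠ 0) : Eplus n m k x
    = (fieldConst n k : ℂ) • elecField n (radialProfile n k) (solidHarmonic n m) x := by
  have hr : ‖x‖ ≠ 0 := norm_ne_zero_iff.2 hx
  have hp := contDiff_solidHarmonic n m
  set r := ‖x‖ with hrd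
  set ω : R3 := r⁻¹ • x with hω
  have hω1 : ‖ω‖ = 1 := by rw [hω, norm_smul, norm_inv, Real.norm_eq_abs, hrd, abs_norm, inv_mul_cancel₀ hr]
  have hxω : x = r • ω := by rw [hω, smul_smul, mul_inv_cancel₀ hr, one_smul]
  have hNpos : (0 : ℝ) < (n : ℝ) * (n + 1) := by
    have : (1 : ℝ) ≤ n := by exact_mod_cast hn
    positivity
  have hN : √((n : ℝ) * (n + 1)) ^ 2 = n * (n + 1) := Real.sq_sqrt hNpos.le
  have hN0 : √((n : ℝ) * (n + 1)) ≠ 0 := (Real.sqrt_pos.2 hNpos).ne'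
  set N := √((n : ℝ) * (n + 1)) with hNd
  ext i
  have e1 : solidHarmonic n m x = r ^ n * solidHarmonic n m ω := by
    rw [hxω, solidHarmonic_smul]
  have e2 : r * pderiv i (solidHarmonic n m) x = r ^ n * pderiv i (solidHarmonic n m) ω := by
    have := pderiv_smul_arg hp (solidHarmonic_smul n m) r ω i
    rwa [← hxω] at this
  have e3 : x i = r * ω i := by
    have := congrArg (fun y : R3 => y i) hxω
    simpa using this
  simp only [Eplus, elecField, PiLp.add_apply, PiLp.smul_apply, smul_eq_mul, toC3, ← hrd, ← hω,
    grad_ofReal hp, vecU, ← hNd, surfaceGrad_sphHarmonic hω1, sphHarmonic_eq_solidHarmonic n m hω1,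
    elecFactor, fieldConst]
  rw [show sphBessel n k + k * deriv (sphBessel n) k = fieldDenom n k from rfl]
  norm_cast
  rw [sphBessel_add_deriv, sphBessel_mul, e1, e3]
  set P := pderiv i (solidHarmonic n m) x
  set Q := pderiv i (solidHarmonic n m) ω
  set f0 := radialProfile n k (r ^ 2)
  set f1 := deriv (radialProfile n k) (r ^ 2)
  set Y := solidHarmonic n m ω
  rw [one_div, div_eq_mul_inv N]
  generalize (fieldDenom n k)⁻¹ = d
  push_cast
  field_simp
  linear_combination d * r ^ n * f0 * Y * ω i * hN - d * ((n + 1) * f0 + 2 * r ^ 2 * f1) * e2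

lemma Hplus_eq {x : R3} (hx : x ≠ 0) : Hplus n m k x
    = (Complex.I * k * fieldConst n k) • magField (radialProfile n k) (solidHarmonic n m) x := by
  have hr : ‖x‖ ≠ 0 := norm_ne_zero_iff.2 hx
  have hp := contDiff_solidHarmonic n m
  set r := ‖x‖ with hrd
  set ω : R3 := r⁻¹ • x with hω
  have hω1 : ‖ω‖ = 1 := by rw [hω, norm_smul, norm_inv, Real.norm_eq_abs, hrd, abs_norm, inv_mul_cancel₀ hr]
  have hxω : x = r • ω := by rw [hω, smul_smul, mul_inv_cancel₀ hr, one_smul]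
  set N := √((n : ℝ) * (n + 1)) with hNd
  have e2 : ∀ i, r * pderiv i (solidHarmonic n m) x = r ^ n * pderiv i (solidHarmonic n m) ω := by
    intro i
    have := pderiv_smul_arg hp (solidHarmonic_smul n m) r ω i
    rwa [← hxω] at this
  have e3 : ∀ i, x i = r * ω i := by
    intro i
    have := congrArg (fun y : R3 => y i) hxω
    simpa using this
  have hV : ∀ i, vecV n m ω i = N⁻¹ * (ω (i + 1) * pderiv (i + 2) (solidHarmonic n m) ω
      - ω (i + 2) * pderiv (i + 1) (solidHarmonic n m) ω) := by
    intro i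
    have hU : ∀ j, vecU n m ω j = N⁻¹ * (pderiv j (solidHarmonic n m) ω - n * solidHarmonic n m ω * ω j) := by
      intro j
      simp [vecU, surfaceGrad_sphHarmonic hω1, hNd]
    obtain ⟨c, hc⟩ : ∃ c : Fin 3 → ℝ, ∀ a, ω a = c a := ⟨fun a => ω a, fun _ => rfl⟩
    simp only [vecV, cross, cross_apply, hU, hc]
    obtain rfl | rfl | rfl := fin_three_cases i <;> norm_num [show (2 + 2 : Fin 3) = 1 from rfl, show (1 + 2 : Fin 3) = 0 from rfl,
      show (2 + 1 : Fin 3) = 0 from rfl, show (1 + 1 : Fin 3) = 2 from rfl, Matrix.cons_val_two, Matrix.vecHead, Matrix.vecTail] <;> ring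
  ext i
  simp only [Hplus, magField, PiLp.smul_apply, smul_eq_mul, toC3, ← hrd, ← hω, hV, crossC, fieldConst,
    grad_ofReal hp, e3]
  rw [show sphBessel n k + k * deriv (sphBessel n) k = fieldDenom n k from rfl, sphBessel_mul, ← hNd]
  have h1 := congrArg (fun t : ℝ => (t : ℂ)) (e2 (i + 1))
  have h2 := congrArg (fun t : ℝ => (t : ℂ)) (e2 (i + 2))
  push_cast at h1 h2 ⊢
  rw [div_eq_mul_inv]
  linear_combination Complex.I * k * radialProfile n k (r ^ 2) * (fieldDenom n k : ℂ)⁻¹ * (N : ℂ)⁻¹ *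
    (ω (i + 2) * h1 - ω (i + 1) * h2)

lemma ae_ne_zero : ∀ᵐ x ∂(volume : Measure R3), x ≠ 0 := by
  simp [ae_iff]

/-- At r = 1 with f(1) = 0 the denominator is 2f'(1), and the zero of f is simple. -/
lemma fieldDenom_ne_zero (hk : 0 < k) (hkn : sphBessel n k = 0) : fieldDenom n k ≠ 0 := by
  have h0 := sphBessel_mul n k 1
  have h1 := sphBessel_add_deriv n k 1
  simp only [mul_one, one_pow, one_mul] at h0 h1
  rw [hkn] at h0
  rw [fieldDenom, h1, ← h0]
  have := deriv_radialProfile_one_ne hk.ne' h0.symm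
  simpa using this

lemma radialProfile_one (hkn : sphBessel n k = 0) : radialProfile n k 1 = 0 := by
  have h0 := sphBessel_mul n k 1
  simp only [mul_one, one_pow, one_mul] at h0
  rw [← h0, hkn]

lemma fieldConst_ne_zero (hn : 1 ≤ n) (hk : 0 < k) (hkn : sphBessel n k = 0) : fieldConst n k ≠ 0 := by
  have hNpos : (0 : ℝ) < (n : ℝ) * (n + 1) := by
    have : (1 : ℝ) ≤ n := by exact_mod_cast hn
    positivity
  exact mul_ne_zero (inv_ne_zero (fieldDenom_ne_zero hk hkn)) (inv_ne_zero (Real.sqrt_pos.2 hNpos).ne')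

/-- The support of the test field lies in `S`, so Green's formula on the whole space applies
although `A` has no compact support. -/
lemma hCurl_of_contDiff {A : R3 → C3} (hA : ContDiff ℝ (⊤ : ℕ∞) A) {S : Set R3}
    (hS : Bornology.IsBounded S) : HCurl S A (curl A) := by
  refine ⟨memLp_restrict_of_continuous hA.continuous hS 2,
    memLp_restrict_of_continuous (contDiff_curl hA).continuous hS 2, fun φ hφ hs => ?_⟩
  rw [tangentialPairing, setIntegral_eq_integral_of_forall_compl_eq_zero, integral_green hA hφ]
  intro x hx
  have hn : x ∉ tsupport φ := fun h => hx (hs h)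
  rw [curl_zero_of_notMem hn, image_eq_zero_of_notMem_tsupport hn]
  simp

/-- The smooth representative of the electric field in the ball. -/
noncomputable def smoothE (n : ℕ) (m : ℤ) (k : ℝ) (x : R3) : C3 :=
  (fieldConst n k : ℂ) • elecField n (radialProfile n k) (solidHarmonic n m) x

/-- The smooth representative of the magnetic field in the ball. -/
noncomputable def smoothH (n : ℕ) (m : ℤ) (k : ℝ) (x : R3) : C3 :=
  (Complex.I * k * fieldConst n k) • magField (radialProfile n k) (solidHarmonic n m) x

lemma contDiff_smoothE : ContDiff ℝ (⊤ : ℕ∞) (smoothE n m k) :=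
  ContDiff.smul (f := fun _ => (fieldConst n k : ℂ)) contDiff_const (contDiff_elecField (contDiff_radialProfile n k) (contDiff_solidHarmonic n m))

lemma contDiff_smoothH : ContDiff ℝ (⊤ : ℕ∞) (smoothH n m k) :=
  ContDiff.smul (f := fun _ => Complex.I * k * fieldConst n k) contDiff_const (contDiff_magField (contDiff_radialProfile n k) (contDiff_solidHarmonic n m))

lemma curl_smoothE (x : R3) : curl (smoothE n m k) x = (Complex.I * k) • smoothH n m k x := by
  have h1 := (contDiff_elecField (n := n) (contDiff_radialProfile n k)
    (contDiff_solidHarmonic n m)).differentiable (by simp) x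
  have h : curl (smoothE n m k) x = _ := curl_const_smul _ h1
  have hode : ∀ s, 4 * s * deriv (deriv (radialProfile n k)) s + (6 + 4 * n) * deriv (radialProfile n k) s
      + k ^ 2 * radialProfile n k s = 0 := fun s => radialProfile_ode n k s
  rw [h, curl_elecField (contDiff_radialProfile n k) (contDiff_solidHarmonic n m) hode, smoothH, smul_smul,
    smul_smul]
  congr 1
  push_cast
  linear_combination (-(k : ℂ) ^ 2 * fieldConst n k) * Complex.I_sq

lemma curl_smoothH (x : R3) : curl (smoothH n m k) x = (-(Complex.I * k)) • smoothE n m k x := by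
  have h1 := (contDiff_magField (contDiff_radialProfile n k)
    (contDiff_solidHarmonic n m)).differentiable (by simp) x
  have h : curl (smoothH n m k) x = _ := curl_const_smul _ h1
  rw [h, curl_magField (contDiff_radialProfile n k) (contDiff_solidHarmonic n m) (solidHarmonic_smul n m)
    (laplacian_solidHarmonic n m), smoothE, smul_smul, smul_neg, ← neg_smul]
  congr 1
  ring

lemma ae_Eplus (hn : 1 ≤ n) : ∀ᵐ x ∂(volume : Measure R3), Eplus n m k x = smoothE n m k x := by
  filter_upwards [ae_ne_zero] with x hx using Eplus_eq hn hx

lemma ae_Hplus : ∀ᵐ x ∂(volume : Measure R3), Hplus n m k x = smoothH n m k x := by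
  filter_upwards [ae_ne_zero] with x hx using Hplus_eq hx

lemma hCurl_Eplus (hn : 1 ≤ n) :
    HCurl core (Eplus n m k) (fun x => (Complex.I * k) • Hplus n m k x) := by
  refine (hCurl_of_contDiff (contDiff_smoothE (n := n) (m := m) (k := k)) isBounded_core).congr_ae ?_ ?_
  · filter_upwards [ae_restrict_of_ae (ae_Eplus hn)] with x hx using hx.symm
  · filter_upwards [ae_restrict_of_ae ae_Hplus] with x hx
    rw [curl_smoothE, hx]

lemma hCurl_Hplus (hn : 1 ≤ n) :
    HCurl core (Hplus n m k) (fun x => (-(Complex.I * k)) • Eplus n m k x) := by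
  refine (hCurl_of_contDiff (contDiff_smoothH (n := n) (m := m) (k := k)) isBounded_core).congr_ae ?_ ?_
  · filter_upwards [ae_restrict_of_ae ae_Hplus] with x hx using hx.symm
  · filter_upwards [ae_restrict_of_ae (ae_Eplus hn)] with x hx
    rw [curl_smoothH, hx]

lemma Eplus_Hplus_on_sphere (hn : 1 ≤ n) (hkn : sphBessel n k = 0) {ω : R3} (hω : ‖ω‖ = 1) :
    dot (Eplus n m k ω) (toC3 ω) = 0 ∧ Hplus n m k ω = 0 := by
  have hne : ω ≠ 0 := by intro h; simp [h] at hω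
  rw [Eplus_eq hn hne, Hplus_eq hne, dot_smul_left,
    dot_elecField (contDiff_solidHarmonic n m) (solidHarmonic_smul n m), magField, hω, one_pow,
    radialProfile_one hkn]
  simp

/-- If the field vanished, its radial component n(n + 1) f(t²) t^n Y(ω) would vanish along a ray
with Y(ω) ≠ 0, so f(t²) = 0 for 0 < t < 1, and f(0) = 0 by continuity, which is false. -/
lemma not_ae_Eplus_eq_zero (hn : 1 ≤ n) (hm : |m| ≤ (n : ℤ)) (hk : 0 < k) (hkn : sphBessel n k = 0) :
    ¬ ∀ᵐ x ∂(volume.restrict core), Eplus n m k x = 0 := by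
  intro h
  have h1 : ∀ᵐ x ∂(volume.restrict core), smoothE n m k x = 0 := by
    filter_upwards [h, ae_restrict_of_ae (ae_Eplus (m := m) (k := k) hn)] with x h1 h2
    rw [← h2, h1]
  have h2 : Set.EqOn (smoothE n m k) (fun _ => 0) core :=
    Measure.eqOn_open_of_ae_eq h1 isOpen_ball contDiff_smoothE.continuous.continuousOn continuousOn_const
  obtain ⟨ω, hω, hY⟩ := exists_sphHarmonic_ne_zero hm
  rw [sphHarmonic_eq_solidHarmonic n m hω] at hY
  have h3 : ∀ t ∈ Set.Ioo (0 : ℝ) 1, radialProfile n k (t ^ 2) = 0 := by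
    intro t ht
    have hx : t • ω ∈ core := by
      simp only [core, mem_ball_zero_iff, norm_smul, hω, mul_one, Real.norm_eq_abs, abs_of_pos ht.1]
      exact ht.2
    have e := h2 hx
    have e2 := dot_elecField (f := radialProfile n k) (contDiff_solidHarmonic n m)
      (solidHarmonic_smul n m) (t • ω)
    have e3 : elecField n (radialProfile n k) (solidHarmonic n m) (t • ω) = 0 :=
      (smul_eq_zero.1 e).resolve_left (by exact_mod_cast fieldConst_ne_zero hn hk hkn)
    rw [e3, dot_zero_left, norm_smul, hω, mul_one, Real.norm_eq_abs, sq_abs, solidHarmonic_smul] at e2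
    have e4 := (Complex.ofReal_eq_zero.1 e2.symm)
    have hn0 : (n : ℝ) * (n + 1) ≠ 0 := by
      have : (1 : ℝ) ≤ n := by exact_mod_cast hn
      positivity
    have ht0 : t ^ n * solidHarmonic n m ω ≠ 0 := mul_ne_zero (pow_ne_zero _ ht.1.ne') hY
    exact (mul_eq_zero.1 ((mul_eq_zero.1 e4).resolve_right ht0)).resolve_left hn0
  have hc : Continuous fun t : ℝ => radialProfile n k (t ^ 2) :=
    (contDiff_radialProfile n k).continuous.comp (continuous_pow 2)
  have hlim : Filter.Tendsto (fun t : ℝ => radialProfile n k (t ^ 2)) (𝓝[>] 0)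
      (𝓝 (radialProfile n k (0 ^ 2))) := hc.continuousAt.continuousWithinAt
  have hlim0 : Filter.Tendsto (fun t : ℝ => radialProfile n k (t ^ 2)) (𝓝[>] 0) (𝓝 0) := by
    refine tendsto_const_nhds.congr' ?_
    filter_upwards [Ioo_mem_nhdsGT (zero_lt_one (α := ℝ))] with t ht
    exact (h3 t ht).symm
  have := tendsto_nhds_unique hlim hlim0
  rw [zero_pow two_ne_zero] at this
  exact radialProfile_zero_ne hk.ne' this

end Incident


/-! ### Cutoffs, and splitting Ω into the ball, the shell and a null set. -/

section Localization

variable {Ω : Set R3}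

lemma exists_cutoff (hΩ : IsOpen Ω) (hK : closedBall (0 : R3) 1 ⊆ Ω) :
    ∃ ζ : R3 → ℂ, IsTest ζ ∧ tsupport ζ ⊆ Ω ∧ ∀ x ∈ closedBall (0 : R3) 1, ∀ᶠ y in 𝓝 x, ζ y = 1 := by
  obtain ⟨δ, hδ, hδΩ⟩ := (isCompact_closedBall (0 : R3) 1).exists_cthickening_subset_open hΩ hK
  rw [cthickening_closedBall hδ.le zero_le_one] at hδΩ
  let b : ContDiffBump (0 : R3) := ⟨1 + δ / 2, δ + 1, by linarith, by linarith⟩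
  have hb : IsTest (fun x => (b x : ℂ)) := IsTest.ofReal ⟨b.contDiff, b.hasCompactSupport⟩
  refine ⟨fun x => (b x : ℂ), hb, ?_, fun x hx => ?_⟩
  · refine (closure_mono fun x hx => ?_).trans (b.tsupport_eq.subset.trans hδΩ)
    simpa using hx
  · have hx' : x ∈ ball (0 : R3) b.rIn := by
      rw [mem_ball_zero_iff]
      have : ‖x‖ ≤ 1 := by simpa using hx
      change ‖x‖ < 1 + δ / 2
      linarith
    filter_upwards [isOpen_ball.mem_nhds hx'] with y hy
    rw [b.one_of_mem_closedBall (ball_subset_closedBall hy)]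
    simp

lemma IsTest.smul_field {ζ : R3 → ℂ} {φ : R3 → C3} (hζ : ContDiff ℝ (⊤ : ℕ∞) ζ) (hφ : IsTest φ) :
    IsTest (fun x => ζ x • φ x) :=
  ⟨ContDiff.smul (f := ζ) (g := φ) hζ hφ.1, HasCompactSupport.smul_left (f := ζ) (f' := φ) hφ.2⟩

lemma disjoint_tsupport_of_eventually {F : Type*} [NormedAddCommGroup F] {f : R3 → F} {K : Set R3}
    (h : ∀ x ∈ K, ∀ᶠ y in 𝓝 x, f y = 0) : Disjoint (tsupport f) K :=
  Set.disjoint_right.2 fun x hx => notMem_tsupport_iff_eventuallyEq.2 (h x hx)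

lemma eventually_eq_zero_of_disjoint {F : Type*} [NormedAddCommGroup F] {f : R3 → F} {K : Set R3}
    (h : Disjoint (tsupport f) K) : ∀ x ∈ K, ∀ᶠ y in 𝓝 x, f y = 0 := fun _ hx =>
  notMem_tsupport_iff_eventuallyEq.1 (Set.disjoint_right.1 h hx)

/-- Vanishing of the tangential traces on the two parts of the boundary of the shell can be checked
separately. -/
lemma tangentialPairing_eq_zero_of_localized (hΩ : IsOpen Ω) (hK : closedBall (0 : R3) 1 ⊆ Ω)
    {S : Set R3} {u v : R3 → C3} (hu : MemLp u 2 (volume.restrict S))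
    (hv : MemLp v 2 (volume.restrict S))
    (h1 : ∀ φ : R3 → C3, IsTest φ → tsupport φ ⊆ Ω → tangentialPairing S u v φ = 0)
    (h2 : ∀ φ : R3 → C3, IsTest φ → Disjoint (tsupport φ) (closedBall 0 1) →
      tangentialPairing S u v φ = 0) {φ : R3 → C3} (hφ : IsTest φ) :
    tangentialPairing S u v φ = 0 := by
  obtain ⟨ζ, hζ, hζΩ, hζ1⟩ := exists_cutoff hΩ hK
  have hζ' : ContDiff ℝ (⊤ : ℕ∞) (fun x => 1 - ζ x) := contDiff_const.sub hζ.1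
  have t1 := IsTest.smul_field hζ.1 hφ
  have t2 := IsTest.smul_field hζ' hφ
  have e : φ = fun x => ζ x • φ x + (1 - ζ x) • φ x := by
    ext x; simp [sub_smul]
  rw [e, tangentialPairing_add_test hu hv t1 t2, h1 _ t1, h2 _ t2, add_zero]
  · refine disjoint_tsupport_of_eventually fun x hx => ?_
    filter_upwards [hζ1 x hx] with y hy
    rw [hy, sub_self, zero_smul]
  · exact (tsupport_smul_subset_left ζ φ).trans hζΩ

lemma ae_eq_core_union_shell (hK : closedBall (0 : R3) 1 ⊆ Ω) :
    Ω =ᵐ[volume] (core ∪ shell Ω : Set R3) := by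
  have hsph : ∀ᵐ x ∂(volume : Measure R3), x ∉ sphere (0 : R3) 1 :=
    measure_eq_zero_iff_ae_notMem.1 (Measure.addHaar_sphere _ _ _)
  filter_upwards [hsph] with x hx
  refine propext ⟨fun h => ?_, fun h => ?_⟩
  · by_cases hb : x ∈ closedBall (0 : R3) 1
    · rw [← ball_union_sphere] at hb
      exact Or.inl (hb.resolve_right hx)
    · exact Or.inr ⟨h, hb⟩
  · exact h.elim (fun h => hK (ball_subset_closedBall h)) fun h => h.1

lemma disjoint_core_shell (Ω : Set R3) : Disjoint core (shell Ω) :=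
  Set.disjoint_left.2 fun _ hx hx' => hx'.2 (ball_subset_closedBall hx)

lemma core_subset (hK : closedBall (0 : R3) 1 ⊆ Ω) : core ⊆ Ω := ball_subset_closedBall.trans hK

lemma setIntegral_eq_core_add_shell (hΩ : IsOpen Ω) (hK : closedBall (0 : R3) 1 ⊆ Ω) {F : R3 → ℂ}
    (hc : IntegrableOn F core) (hs : IntegrableOn F (shell Ω)) :
    ∫ x in Ω, F x = (∫ x in core, F x) + ∫ x in shell Ω, F x := by
  rw [setIntegral_congr_set (ae_eq_core_union_shell hK),
    setIntegral_union (disjoint_core_shell Ω) (isOpen_shell hΩ).measurableSet hc hs]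

lemma memLp_of_core_shell (hK : closedBall (0 : R3) 1 ⊆ Ω) {F : R3 → C3}
    (hc : MemLp F 2 (volume.restrict core)) (hs : MemLp F 2 (volume.restrict (shell Ω))) :
    MemLp F 2 (volume.restrict Ω) := by
  rw [Measure.restrict_congr_set (ae_eq_core_union_shell hK)]
  have hm := (aestronglyMeasurable_union_iff (f := F)).2 ⟨hc.1, hs.1⟩
  rw [memLp_two_iff_integrable_sq_norm hm]
  exact IntegrableOn.union (s := core) (t := shell Ω) ((memLp_two_iff_integrable_sq_norm hc.1).1 hc)
    ((memLp_two_iff_integrable_sq_norm hs.1).1 hs)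

end Localization

/-! ### A potential in the shell carrying the tangential trace of E₊. -/

section Trace

variable {Ω : Set R3} {n : ℕ} {m : ℤ} {k : ℝ}

/-- Minus the gradient of this function has the tangential trace of the electric field on the unit
sphere. -/
noncomputable def tracePotential (n : ℕ) (m : ℤ) (k : ℝ) (x : R3) : ℂ :=
  (fieldConst n k : ℂ) * ((elecFactor n (radialProfile n k) (‖x‖ ^ 2) * solidHarmonic n m x : ℝ) : ℂ)

lemma contDiff_tracePotential : ContDiff ℝ (⊤ : ℕ∞) (tracePotential n m k) :=
  contDiff_const.mul (contDiff_ofReal ((contDiff_radial (contDiff_elecFactor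
    (contDiff_radialProfile n k))).mul (contDiff_solidHarmonic n m)))

/-- By `elecField_eq` the field is A + ∇G, where A has the radial factor f with f(1) = 0. The
pairing of A is zero, and the gradient has no curl, so only the term with ∇G · curl φ is left. -/
lemma tangentialPairing_core_smoothE (hkn : sphBessel n k = 0) {φ : R3 → C3} (hφ : IsTest φ) :
    tangentialPairing core (smoothE n m k) (curl (smoothE n m k)) φ
      = - ∫ x in core, dot (grad (tracePotential n m k) x) (curl φ x) := by
  have hp := contDiff_solidHarmonic n m
  have hf := contDiff_radialProfile n k
  have hode : ∀ s, 4 * s * deriv (deriv (radialProfile n k)) s + (6 + 4 * n) * deriv (radialProfile n k) s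
      + k ^ 2 * radialProfile n k s = 0 := fun s => radialProfile_ode n k s
  set Z : R3 → C3 := fun x => (fieldConst n k : ℂ) • ((k ^ 2 * solidHarmonic n m x : ℝ) : ℂ) • toC3 x with hZd
  have hZ : ContDiff ℝ (⊤ : ℕ∞) Z :=
    ContDiff.smul (f := fun _ => (fieldConst n k : ℂ)) contDiff_const
      ((contDiff_ofReal (contDiff_const.mul hp)).smul contDiff_toC3)
  set A : R3 → C3 := fun x => (radialProfile n k (‖x‖ ^ 2) : ℂ) • Z x with hAd
  have hA : ContDiff ℝ (⊤ : ℕ∞) A := (contDiff_ofReal (contDiff_radial hf)).smul hZ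
  have hG := contDiff_tracePotential (n := n) (m := m) (k := k)
  have hE : smoothE n m k = fun x => A x + grad (tracePotential n m k) x := by
    ext1 x
    have hd := (contDiff_ofReal ((contDiff_radial (contDiff_elecFactor (n := n) hf)).mul hp)).differentiable
      (by simp) x
    have e : grad (tracePotential n m k) x = _ := grad_const_mul (fieldConst n k : ℂ) hd
    rw [smoothE, elecField_eq hf hp hode, e, smul_add, hAd, hZd]
    congr 1
    rw [smul_comm]
  have hcurl : ∀ x, curl (smoothE n m k) x = curl A x := by
    intro x
    rw [hE, curl_add (hA.differentiable (by simp) x) ((contDiff_grad hG).differentiable (by simp) x),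
      curl_grad hG, add_zero]
  have hbd := isBounded_core
  -- The roles are exchanged: φ, with its curl, is the given field, and A is the limit of test
  -- fields. On the whole space such pairings vanish by `integral_green`.
  have h0 : tangentialPairing core φ (curl φ) A = 0 := by
    refine tangentialPairing_core_radial MeasurableSet.univ (Set.subset_univ _)
      (by simpa using hφ.memLp 2) (by simpa using hφ.curl.memLp 2) (fun ψ hψ _ => ?_) hf
      (radialProfile_one hkn) hZ
    rw [tangentialPairing, setIntegral_univ]
    exact integral_green hφ.1 hψ
  have m1 := memLp_restrict_of_continuous hA.continuous hbd 2
  have m2 := memLp_restrict_of_continuous (contDiff_curl hA).continuous hbd 2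
  have m3 := memLp_restrict_of_continuous (contDiff_grad hG).continuous hbd 2
  have h1 : tangentialPairing core (smoothE n m k) (curl (smoothE n m k)) φ
      = - tangentialPairing core φ (curl φ) A
        - ∫ x in core, dot (grad (tracePotential n m k) x) (curl φ x) := by
    have i1 : Integrable (fun x => dot (curl φ x) (A x) - dot (φ x) (curl A x)) (volume.restrict core) :=
      (integrable_dot ((hφ.curl.memLp 2).restrict core) m1).sub
        (integrable_dot ((hφ.memLp 2).restrict core) m2)
    have i2 : Integrable (fun x => -(dot (curl φ x) (A x) - dot (φ x) (curl A x)))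
      (volume.restrict core) := i1.neg
    rw [tangentialPairing, tangentialPairing, ← integral_neg,
      ← integral_sub i2 (integrable_dot m3 ((hφ.curl.memLp 2).restrict core))]
    congr 1 with x
    rw [hcurl, hE, dot_add_left, dot_comm (curl φ x), dot_comm (φ x)]
    ring
  rw [h1, h0]
  ring

/-- A potential, supported in `Ω`, whose gradient has the tangential trace of the electric field on
the unit sphere. -/
def IsTraceLift (Ω : Set R3) (n : ℕ) (m : ℤ) (k : ℝ) (g : R3 → ℂ) : Prop :=
  IsTest g ∧ tsupport g ⊆ Ω ∧ ∀ φ : R3 → C3, IsTest φ →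
    tangentialPairing core (smoothE n m k) (curl (smoothE n m k)) φ
      = - tangentialPairing (shell Ω) (grad g) 0 φ

/-- The integral of ∇g · curl φ over the whole space is 0, so its parts over the ball and over the
shell are opposite; in the ball ∇g = ∇G. This transfers the trace across the sphere without a
surface integral. -/
lemma exists_isTraceLift (hΩ : IsOpen Ω) (hK : closedBall (0 : R3) 1 ⊆ Ω) (hkn : sphBessel n k = 0) :
    ∃ g, IsTraceLift Ω n m k g := by
  obtain ⟨ζ, hζ, hζΩ, hζ1⟩ := exists_cutoff hΩ hK
  have hG := contDiff_tracePotential (n := n) (m := m) (k := k)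
  have hg : IsTest (fun x => ζ x * tracePotential n m k x) := hζ.mul_right hG
  have hgΩ : tsupport (fun x => ζ x * tracePotential n m k x) ⊆ Ω :=
    (tsupport_mul_subset_left (f := ζ)).trans hζΩ
  refine ⟨_, hg, hgΩ, fun φ hφ => ?_⟩
  rw [tangentialPairing_core_smoothE hkn hφ]
  have hi : Integrable fun x => dot (grad (fun x => ζ x * tracePotential n m k x) x) (curl φ x) :=
    integrable_dot (hg.grad.memLp 2) (hφ.curl.memLp 2)
  have h1 := integral_dot_grad_curl hg.1 hφ
  rw [← setIntegral_eq_integral_of_forall_compl_eq_zero (s := Ω) (fun x hx => by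
      rw [grad_zero_of_notMem fun h => hx (hgΩ h), dot_zero_left]),
    setIntegral_eq_core_add_shell hΩ hK hi.integrableOn hi.integrableOn] at h1
  have h2 : ∫ x in core, dot (grad (fun x => ζ x * tracePotential n m k x) x) (curl φ x)
      = ∫ x in core, dot (grad (tracePotential n m k) x) (curl φ x) := by
    refine setIntegral_congr_fun measurableSet_core fun x hx => ?_
    have : (fun x => ζ x * tracePotential n m k x) =ᶠ[𝓝 x] tracePotential n m k := by
      filter_upwards [hζ1 x (ball_subset_closedBall hx)] with y hy
      rw [hy, one_mul]
    simp only [grad_congr_of_eventuallyEq this]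
  rw [h2] at h1
  simp only [tangentialPairing, Pi.zero_apply, dot_zero_left, zero_sub, integral_neg]
  linear_combination -h1

end Trace

/-! ### Solutions in the shell are curl-free; gluing; the eigenvalue equation. -/

section ShellField

variable {Ω : Set R3} {n : ℕ} {m : ℤ} {k : ℝ}

/-- `IsShellField` allows any weak curl of E₊; by uniqueness of the weak curl it may be replaced
with the smooth one. -/
lemma tangentialPairing_Eplus (hn : 1 ≤ n) {Cp : R3 → C3} (h : HCurl core (Eplus n m k) Cp)
    (φ : R3 → C3) : tangentialPairing core (Eplus n m k) Cp φ
      = tangentialPairing core (smoothE n m k) (curl (smoothE n m k)) φ := by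
  have h' : HCurl core (Eplus n m k) (curl (smoothE n m k)) := (hCurl_Eplus hn).congr_ae
    (Filter.Eventually.of_forall fun _ => rfl) (by
      filter_upwards [ae_restrict_of_ae (ae_Hplus (n := n) (m := m) (k := k))] with x hx
      rw [curl_smoothE, hx])
  exact tangentialPairing_congr_ae (ae_restrict_of_ae (ae_Eplus hn)) (h.ae_eq isOpen_ball h') φ

/-- A field in the shell with the right tangential traces differs from the gradient of a trace
lift by a field in `H₀(curl)`. -/
lemma hCurlZero_sub_grad (hΩ : IsOpen Ω) (hK : closedBall (0 : R3) 1 ⊆ Ω) (hn : 1 ≤ n) {g : R3 → ℂ}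
    (hg : IsTraceLift Ω n m k g) {Em Cm Cp : R3 → C3} (hp : HCurl core (Eplus n m k) Cp)
    (hm : HCurl (shell Ω) Em Cm)
    (h1 : ∀ φ : R3 → C3, IsTest φ → tsupport φ ⊆ Ω →
      -tangentialPairing (shell Ω) Em Cm φ = tangentialPairing core (Eplus n m k) Cp φ)
    (h2 : ∀ φ : R3 → C3, IsTest φ → Disjoint (tsupport φ) (closedBall 0 1) →
      tangentialPairing (shell Ω) Em Cm φ = 0) :
    HCurlZero (shell Ω) (fun x => Em x - grad g x) Cm := by
  have mg := (hg.1.grad.memLp 2).restrict (shell Ω)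
  have m0 : MemLp (0 : R3 → C3) 2 (volume.restrict (shell Ω)) := MemLp.zero
  have hu := hm.1.sub mg
  refine ⟨hu, hm.2.1, fun φ hφ => ?_⟩
  refine tangentialPairing_eq_zero_of_localized hΩ hK hu hm.2.1 ?_ ?_ hφ
  · intro φ hφ hs
    have e := tangentialPairing_sub hm.1 hm.2.1 mg m0 hφ
    simp only [Pi.zero_apply, sub_zero] at e
    refine e.trans ?_
    have a := h1 φ hφ hs
    rw [tangentialPairing_Eplus hn hp, hg.2.2 φ hφ] at a
    linear_combination -a
  · intro φ hφ hs
    have e := tangentialPairing_sub hm.1 hm.2.1 mg m0 hφ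
    simp only [Pi.zero_apply, sub_zero] at e
    refine e.trans ?_
    have a := hg.2.2 φ hφ
    rw [tangentialPairing_eq_zero_of_disjoint (S := core) (hs.mono_right ball_subset_closedBall)] at a
    rw [h2 φ hφ hs]
    linear_combination -a

lemma ae_eq_zero_of_integral_inner_self {S : Set R3} {u : R3 → C3} (hu : MemLp u 2 (volume.restrict S))
    (h : ∫ x in S, inner ℂ (u x) (u x) = 0) : ∀ᵐ x ∂volume.restrict S, u x = 0 := by
  have h1 : ∫ x in S, ‖u x‖ ^ 2 = 0 := by
    have : ∀ x, inner ℂ (u x) (u x) = ((‖u x‖ ^ 2 : ℝ) : ℂ) := fun x => by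
      rw [inner_self_eq_norm_sq_to_K]; norm_cast
    simp_rw [this] at h
    have e := integral_complex_ofReal (f := fun x => ‖u x‖ ^ 2) (μ := volume.restrict S)
    exact Complex.ofReal_injective (e.symm.trans h)
  have h2 := (integral_eq_zero_iff_of_nonneg (fun x => by positivity)
    ((memLp_two_iff_integrable_sq_norm hu.1).1 hu)).1 h1
  filter_upwards [h2] with x hx
  simpa using hx

/-- Every solution in the shell is curl-free, and it differs from the gradient of a trace lift by a
curl-free field in `H₀(curl)`. -/
lemma IsShellField.curl_free (hΩ : IsOpen Ω) (hK : closedBall (0 : R3) 1 ⊆ Ω) (hn : 1 ≤ n) {g : R3 → ℂ}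
    (hg : IsTraceLift Ω n m k g) {Em : R3 → C3} (h : IsShellField Ω (Eplus n m k) Em) :
    HCurl (shell Ω) Em 0 ∧ HCurlZero (shell Ω) (fun x => Em x - grad g x) 0 := by
  obtain ⟨Cp, Cm, hp, hm, h3, -, h5, h6, -⟩ := h
  have h0 := hCurlZero_sub_grad hΩ hK hn hg hp hm h5 h6
  -- The field `Em - grad g` lies in H₀(curl) with weak curl `Cm`, so it may be used as the test
  -- field, and the equation reads ∫ |Cm|² = 0.
  have hC := ae_eq_zero_of_integral_inner_self hm.2.1 (h3 _ _ h0)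
  refine ⟨hm.congr_ae (Filter.Eventually.of_forall fun _ => rfl) hC, ?_⟩
  refine ⟨h0.1, MemLp.zero, fun φ hφ => ?_⟩
  rw [← h0.2.2 φ hφ]
  exact tangentialPairing_congr_ae (Filter.Eventually.of_forall fun _ => rfl)
    (hC.mono fun x hx => hx.symm) φ

lemma glue_ae_core (Ω : Set R3) (Ep Em : R3 → C3) :
    ∀ᵐ x ∂volume.restrict core, glue Ω Ep Em x = Ep x := by
  rw [ae_restrict_iff' measurableSet_core]
  refine Filter.Eventually.of_forall fun x hx => ?_
  have : x ∉ shell Ω := fun h => Set.disjoint_left.1 (disjoint_core_shell Ω) hx h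
  simp [glue, hx, this]

lemma glue_ae_shell (hΩ : IsOpen Ω) (Ep Em : R3 → C3) :
    ∀ᵐ x ∂volume.restrict (shell Ω), glue Ω Ep Em x = Em x := by
  rw [ae_restrict_iff' (isOpen_shell hΩ).measurableSet]
  refine Filter.Eventually.of_forall fun x hx => ?_
  have : x ∉ core := fun h => Set.disjoint_left.1 (disjoint_core_shell Ω) h hx
  simp [glue, hx, this]

/-- The boundary contributions from the two sides of the sphere are both expressed through ∇g and
cancel. On ∂Ω nothing is left because `Em - grad g` is in H₀(curl) and `g` is supported in Ω. -/
lemma hCurlZero_glue (hΩ : IsOpen Ω) (hK : closedBall (0 : R3) 1 ⊆ Ω) (hn : 1 ≤ n) {g : R3 → ℂ}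
    (hg : IsTraceLift Ω n m k g) {Em : R3 → C3} (h : IsShellField Ω (Eplus n m k) Em) :
    HCurlZero Ω (glue Ω (Eplus n m k) Em)
      (fun x => (Complex.I * k) • glue Ω (Hplus n m k) 0 x) := by
  obtain ⟨hm, h0⟩ := h.curl_free hΩ hK hn hg
  have hp := hCurl_Eplus (n := n) (m := m) (k := k) hn
  have ec := glue_ae_core Ω (Eplus n m k) Em
  have es := glue_ae_shell hΩ (Eplus n m k) Em
  have fc : ∀ᵐ x ∂volume.restrict core, (Complex.I * k) • glue Ω (Hplus n m k) 0 x
      = (Complex.I * k) • Hplus n m k x := by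
    filter_upwards [glue_ae_core Ω (Hplus n m k) 0] with x hx
    rw [hx]
  have fs : ∀ᵐ x ∂volume.restrict (shell Ω), (Complex.I * k) • glue Ω (Hplus n m k) 0 x
      = (0 : R3 → C3) x := by
    filter_upwards [glue_ae_shell hΩ (Hplus n m k) 0] with x hx
    rw [hx, Pi.zero_apply, smul_zero]
  have Lc := hp.1.ae_eq (ec.mono fun x hx => hx.symm)
  have Ls := hm.1.ae_eq (es.mono fun x hx => hx.symm)
  have Mc := hp.2.1.ae_eq (fc.mono fun x hx => hx.symm)
  have Ms := hm.2.1.ae_eq (fs.mono fun x hx => hx.symm)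
  refine ⟨memLp_of_core_shell hK Lc Ls, memLp_of_core_shell hK Mc Ms, fun φ hφ => ?_⟩
  have hsplit := setIntegral_eq_core_add_shell hΩ hK (integrable_pairing Lc Mc hφ)
    (integrable_pairing Ls Ms hφ)
  have e1 := tangentialPairing_congr_ae ec fc φ
  have e2 := tangentialPairing_congr_ae es fs φ
  have e3 := tangentialPairing_sub hm.1 (MemLp.zero (μ := volume.restrict (shell Ω)) (ε := C3))
    ((hg.1.grad.memLp 2).restrict (shell Ω)) (MemLp.zero (μ := volume.restrict (shell Ω)) (ε := C3)) hφ
  have e4 := h0.2.2 φ hφ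
  have e5 := hg.2.2 φ hφ
  rw [← tangentialPairing_Eplus hn hp] at e5
  simp only [Pi.zero_apply, sub_zero] at e3
  have e6 : tangentialPairing (shell Ω) (fun x => Em x - grad g x) 0 φ
      = tangentialPairing (shell Ω) Em 0 φ - tangentialPairing (shell Ω) (grad g) 0 φ := e3
  rw [tangentialPairing, hsplit]
  rw [tangentialPairing] at e1 e2
  rw [e1, e2, e5]
  linear_combination e4 - e6

lemma conj_toC3_real (a : R3) : conjVec (toC3 a) = toC3 a := by
  ext i; simp [toC3]

/-- E₊ and its curl are real vector fields, so the sesquilinear weak form is the conjugate of the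
bilinear Green pairing. -/
lemma inner_eq_conj_dot {a b : C3} (hb : conjVec b = b) : inner ℂ a b = (starRingEnd ℂ) (dot a b) := by
  rw [inner_eq_dot]
  simp only [dot, map_sum, map_mul]
  refine Finset.sum_congr rfl fun i _ => ?_
  conv_rhs => rw [← conjVec_apply b i, hb]
  rfl

lemma conjVec_smul_real (t : ℝ) (a : C3) : conjVec ((t : ℂ) • a) = (t : ℂ) • conjVec a := by
  ext i; simp

lemma conjVec_add (a b : C3) : conjVec (a + b) = conjVec a + conjVec b := by
  ext i; simp

lemma conjVec_grad_ofReal {p : R3 → ℝ} (hp : ContDiff ℝ (⊤ : ℕ∞) p) (x : R3) :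
    conjVec (grad (fun y => (p y : ℂ)) x) = grad (fun y => (p y : ℂ)) x := by
  ext i; rw [conjVec_apply, grad_ofReal hp, Complex.conj_ofReal]

lemma conjVec_crossC (a b : C3) : conjVec (crossC a b) = crossC (conjVec a) (conjVec b) := by
  ext i; simp [crossC]

lemma conjVec_smoothE (x : R3) : conjVec (smoothE n m k x) = smoothE n m k x := by
  rw [smoothE, elecField, conjVec_smul_real, conjVec_add, conjVec_smul_real, conjVec_smul_real,
    conj_toC3_real, conjVec_grad_ofReal (contDiff_solidHarmonic n m)]

lemma conjVec_curl_smoothE (x : R3) : conjVec (curl (smoothE n m k) x) = curl (smoothE n m k) x := by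
  rw [curl_smoothE, smoothH, magField, smul_smul,
    show Complex.I * k * (Complex.I * k * fieldConst n k) = ((-(k ^ 2 * fieldConst n k) : ℝ) : ℂ) by
      push_cast; linear_combination (k : ℂ) ^ 2 * fieldConst n k * Complex.I_sq,
    conjVec_smul_real, conjVec_smul_real, conjVec_crossC, conj_toC3_real,
    conjVec_grad_ofReal (contDiff_solidHarmonic n m)]

lemma isLimitEigenpair_glue (hΩ : IsOpen Ω) (hK : closedBall (0 : R3) 1 ⊆ Ω) (hn : 1 ≤ n)
    (hm : |m| ≤ (n : ℤ)) (hk : 0 < k) (hkn : sphBessel n k = 0) {g : R3 → ℂ}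
    (hg : IsTraceLift Ω n m k g) {Em : R3 → C3} (h : IsShellField Ω (Eplus n m k) Em) :
    IsLimitEigenpair Ω (glue Ω (Eplus n m k) Em) ((k : ℂ) ^ 2) := by
  have hcΩ := core_subset hK
  refine ⟨fun h0 => not_ae_Eplus_eq_zero hn hm hk hkn ?_, _, hCurlZero_glue hΩ hK hn hg h,
    fun F G hFG => ?_⟩
  · filter_upwards [h0, glue_ae_core Ω (Eplus n m k) Em] with x h1 h2
    rw [← h2, h1]
  have mF := hFG.1.mono_measure (Measure.restrict_mono hcΩ le_rfl)
  have mG := hFG.2.1.mono_measure (Measure.restrict_mono hcΩ le_rfl)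
  have hZ := contDiff_crossC contDiff_toC3 (contDiff_grad (contDiff_ofReal (contDiff_solidHarmonic n m)))
  -- This is where j_n(k) = 0 produces the eigenvalue equation: the magnetic field vanishes on the
  -- sphere, so Green's formula over the ball alone has no boundary term, although F has an
  -- arbitrary trace there.
  have key : tangentialPairing core F G (magField (radialProfile n k) (solidHarmonic n m)) = 0 :=
    tangentialPairing_core_radial hΩ.measurableSet hcΩ hFG.1 hFG.2.1 (fun φ hφ _ => hFG.2.2 φ hφ)
      (contDiff_radialProfile n k) (radialProfile_one hkn) hZ
  have hcm : ∀ x, curl (magField (radialProfile n k) (solidHarmonic n m)) x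
      = - elecField n (radialProfile n k) (solidHarmonic n m) x := fun x =>
    curl_magField (contDiff_radialProfile n k) (contDiff_solidHarmonic n m) (solidHarmonic_smul n m)
      (laplacian_solidHarmonic n m) x
  have hbd := isBounded_core
  have mm := memLp_restrict_of_continuous (contDiff_magField (contDiff_radialProfile n k)
    (contDiff_solidHarmonic n m)).continuous hbd 2
  have me := memLp_restrict_of_continuous (contDiff_elecField (n := n) (contDiff_radialProfile n k)
    (contDiff_solidHarmonic n m)).continuous hbd 2
  have key2 : ∫ x in core, dot (G x) (magField (radialProfile n k) (solidHarmonic n m) x)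
      = - ∫ x in core, dot (F x) (elecField n (radialProfile n k) (solidHarmonic n m) x) := by
    rw [tangentialPairing] at key
    simp only [hcm] at key
    have e : ∀ x, dot (G x) (magField (radialProfile n k) (solidHarmonic n m) x)
        - dot (F x) (-elecField n (radialProfile n k) (solidHarmonic n m) x)
        = dot (G x) (magField (radialProfile n k) (solidHarmonic n m) x)
        + dot (F x) (elecField n (radialProfile n k) (solidHarmonic n m) x) := fun x => by
      rw [dot_comm (F x), dot_neg_left, dot_comm _ (F x)]; ring
    simp only [e] at key
    rw [integral_add (integrable_dot mG mm) (integrable_dot mF me)] at key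
    linear_combination key
  -- The curl is zero in the shell, and in the ball its coefficient is (ik)(ikc) = -k²c with c =
  -- `fieldConst n k`.
  have c1 : ∫ x in Ω, inner ℂ (G x) ((Complex.I * k) • glue Ω (Hplus n m k) 0 x)
      = ∫ x in core, (starRingEnd ℂ) (-(k : ℂ) ^ 2 * fieldConst n k *
        dot (G x) (magField (radialProfile n k) (solidHarmonic n m) x)) := by
    rw [setIntegral_eq_of_subset_of_ae_sdiff_eq_zero hΩ.measurableSet.nullMeasurableSet hcΩ]
    · refine integral_congr_ae ?_
      filter_upwards [glue_ae_core Ω (Hplus n m k) 0, ae_restrict_of_ae (ae_Hplus (n := n) (m := m)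
        (k := k))] with x h1 h2
      rw [h1, h2, ← curl_smoothE, inner_eq_conj_dot (conjVec_curl_smoothE x), curl_smoothE, smoothH,
        smul_smul, dot_smul_right]
      congr 2
      linear_combination (k : ℂ) ^ 2 * fieldConst n k * Complex.I_sq
    · refine Filter.Eventually.of_forall fun x hx => ?_
      have : glue Ω (Hplus n m k) 0 x = 0 := by
        simp [glue, hx.2]
      rw [this, smul_zero, inner_zero_right]
  have c2 : ∫ x in core, inner ℂ (F x) (glue Ω (Eplus n m k) Em x)
      = ∫ x in core, (starRingEnd ℂ) (fieldConst n k *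
        dot (F x) (elecField n (radialProfile n k) (solidHarmonic n m) x)) := by
    refine integral_congr_ae ?_
    filter_upwards [glue_ae_core Ω (Eplus n m k) Em, ae_restrict_of_ae (ae_Eplus (n := n) (m := m)
      (k := k) hn)] with x h1 h2
    rw [h1, h2, inner_eq_conj_dot (conjVec_smoothE x), smoothE, dot_smul_right]
  rw [c1, c2, integral_conj, integral_conj, integral_const_mul, integral_const_mul, key2]
  simp only [map_mul, map_neg, map_pow, Complex.conj_ofReal]
  ring

end ShellField


/-! ### Existence of the shell field by orthogonal projection, and its potential. -/

section Existence

variable {Ω : Set R3} {n : ℕ} {m : ℤ} {k : ℝ}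

/-- Test functions supported in `Ω` which are constant near the closed unit ball. -/
def IsShellTest (Ω : Set R3) (ψ : R3 → ℂ) : Prop :=
  IsTest ψ ∧ tsupport ψ ⊆ Ω ∧ ∃ c, ∀ x ∈ closedBall (0 : R3) 1, ∀ᶠ y in 𝓝 x, ψ y = c

lemma IsShellTest.grad_eq_zero {ψ : R3 → ℂ} (h : IsShellTest Ω ψ) {x : R3} (hx : x ∉ shell Ω) :
    grad ψ x = 0 := by
  obtain ⟨-, hΩ, c, hc⟩ := h
  by_cases hb : x ∈ closedBall (0 : R3) 1
  · exact grad_zero_of_eventually_const (hc x hb)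
  · exact grad_zero_of_notMem fun h => hx ⟨hΩ h, hb⟩

lemma IsShellTest.add {ψ χ : R3 → ℂ} (h : IsShellTest Ω ψ) (h' : IsShellTest Ω χ) :
    IsShellTest Ω (fun x => ψ x + χ x) := by
  obtain ⟨ht, hΩ, c, hc⟩ := h
  obtain ⟨ht', hΩ', c', hc'⟩ := h'
  refine ⟨ht.add ht', (tsupport_add ψ χ).trans (Set.union_subset hΩ hΩ'), c + c', fun x hx => ?_⟩
  filter_upwards [hc x hx, hc' x hx] with y h1 h2
  rw [h1, h2]

lemma IsShellTest.const_mul {ψ : R3 → ℂ} (a : ℂ) (h : IsShellTest Ω ψ) :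
    IsShellTest Ω (fun x => a * ψ x) := by
  obtain ⟨ht, hΩ, c, hc⟩ := h
  refine ⟨IsTest.mul_left contDiff_const ht, (tsupport_mul_subset_right (f := fun _ => a)).trans hΩ,
    a * c, fun x hx => ?_⟩
  filter_upwards [hc x hx] with y h1
  rw [h1]

lemma IsShellTest.conj {ψ : R3 → ℂ} (h : IsShellTest Ω ψ) :
    IsShellTest Ω (fun x => (starRingEnd ℂ) (ψ x)) := by
  obtain ⟨ht, hΩ, c, hc⟩ := h
  refine ⟨ht.conj, (closure_mono fun x hx => ?_).trans hΩ, (starRingEnd ℂ) c, fun x hx => ?_⟩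
  · simpa using hx
  · filter_upwards [hc x hx] with y h1
    rw [h1]

lemma grad_conj {ψ : R3 → ℂ} (h : IsTest ψ) (x : R3) :
    grad (fun x => (starRingEnd ℂ) (ψ x)) x = conjVec (grad ψ x) := by
  ext i
  rw [conjVec_apply]
  exact pderiv_conj (h.differentiable x) i

lemma isShellTest_of_tsupport_subset {ψ : R3 → ℂ} (h : IsTest ψ) (hs : tsupport ψ ⊆ shell Ω) :
    IsShellTest Ω ψ :=
  ⟨h, hs.trans (shell_subset Ω), 0, eventually_eq_zero_of_disjoint
    (Set.disjoint_left.2 fun _ hx => (hs hx).2)⟩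

lemma setIntegral_shell_dot_grad {ψ : R3 → ℂ} (h : IsShellTest Ω ψ) (A : R3 → C3) :
    ∫ x in shell Ω, dot (grad ψ x) (A x) = ∫ x, dot (grad ψ x) (A x) :=
  setIntegral_eq_integral_of_forall_compl_eq_zero fun x hx => by
    rw [h.grad_eq_zero hx, dot_zero_left]

lemma norm_fderiv_le_norm_grad (ψ : R3 → ℂ) (x : R3) : ‖fderiv ℝ ψ x‖ ≤ 3 * ‖grad ψ x‖ := by
  refine ContinuousLinearMap.opNorm_le_bound _ (by positivity) fun y => ?_
  rw [fderiv_apply_eq_sum]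
  calc ‖∑ i, y i • pderiv i ψ x‖ ≤ ∑ i : Fin 3, ‖y i • pderiv i ψ x‖ := norm_sum_le _ _
    _ ≤ ∑ i : Fin 3, ‖y‖ * ‖grad ψ x‖ := by
      refine Finset.sum_le_sum fun i _ => ?_
      rw [norm_smul]
      exact mul_le_mul (PiLp.norm_apply_le y i) (PiLp.norm_apply_le (grad ψ x) i) (norm_nonneg _)
        (norm_nonneg _)
    _ = 3 * ‖grad ψ x‖ * ‖y‖ := by simp; ring

/-- The Poincaré inequality. -/
lemma exists_eLpNorm_le_eLpNorm_grad (hb : Bornology.IsBounded Ω) :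
    ∃ C : NNReal, ∀ ψ : R3 → ℂ, IsTest ψ → Function.support ψ ⊆ Ω →
      eLpNorm ψ 2 volume ≤ C * eLpNorm (grad ψ) 2 volume := by
  refine ⟨eLpNormLESNormFDerivOfLeConst ℂ (volume : Measure R3) Ω 2 2 * 3, fun ψ hψ hs => ?_⟩
  have h1 := eLpNorm_le_eLpNorm_fderiv (volume : Measure R3) (p := 2) (hψ.1.of_le (by exact_mod_cast le_top))
    hs (by norm_num) (by simp; norm_num) hb
  have h2 : eLpNorm (fderiv ℝ ψ) 2 volume ≤ 3 * eLpNorm (grad ψ) 2 volume := by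
    have := eLpNorm_le_nnreal_smul_eLpNorm_of_ae_le_mul (c := 3) (f := fderiv ℝ ψ) (g := grad ψ)
      (μ := (volume : Measure R3)) (Filter.Eventually.of_forall fun x => by
        exact_mod_cast norm_fderiv_le_norm_grad ψ x) 2
    simpa [ENNReal.smul_def] using this
  calc eLpNorm ψ 2 volume ≤ _ := h1
    _ ≤ _ * (3 * eLpNorm (grad ψ) 2 volume) := by gcongr; exact h2
    _ = _ := by rw [← mul_assoc]; push_cast; rfl

/-- The Poincaré inequality is applied on Ω; since the functions are constant near the ball, their
gradients live in the shell. -/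
lemma exists_eLpNorm_le_grad (hS : MeasurableSet (shell Ω)) (hb : Bornology.IsBounded Ω) :
    ∃ C : NNReal, ∀ ψ : R3 → ℂ, IsShellTest Ω ψ →
      eLpNorm ψ 2 (volume.restrict (shell Ω)) ≤ C * eLpNorm (grad ψ) 2 (volume.restrict (shell Ω)) := by
  obtain ⟨C, hC⟩ := exists_eLpNorm_le_eLpNorm_grad hb
  refine ⟨C, fun ψ hψ => ?_⟩
  have h3 : eLpNorm (grad ψ) 2 volume = eLpNorm (grad ψ) 2 (volume.restrict (shell Ω)) := by
    rw [← eLpNorm_indicator_eq_eLpNorm_restrict hS]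
    congr 1
    ext1 x
    by_cases hx : x ∈ shell Ω
    · simp [hx]
    · simp [hx, hψ.grad_eq_zero hx]
  calc eLpNorm ψ 2 (volume.restrict (shell Ω)) ≤ eLpNorm ψ 2 volume := eLpNorm_restrict_le _ _ _ _
    _ ≤ _ := hC ψ hψ.1 ((subset_tsupport ψ).trans hψ.2.1)
    _ = _ := by rw [h3]

/-- The space of test functions supported in `Ω` which are constant near the closed unit ball. -/
noncomputable def shellTests (Ω : Set R3) : Submodule ℂ (R3 → ℂ) where
  carrier := {ψ | IsShellTest Ω ψ}
  add_mem' := IsShellTest.add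
  zero_mem' := ⟨⟨contDiff_const, HasCompactSupport.zero⟩, by simp [tsupport], 0,
    fun x _ => Filter.Eventually.of_forall fun _ => rfl⟩
  smul_mem' := fun c _ h => h.const_mul c

/-- The classes in `L²(S)` of the gradients of the test functions in `T`. -/
noncomputable def gradSpace (T : Submodule ℂ (R3 → ℂ)) (S : Set R3) :
    Submodule ℂ (Lp C3 2 (volume.restrict S)) where
  carrier := {u | ∃ ψ ∈ T, IsTest ψ ∧ ∀ᵐ x ∂volume.restrict S, u x = grad ψ x}
  add_mem' := by
    rintro u v ⟨ψ, hψ, hψ', hu⟩ ⟨χ, hχ, hχ', hv⟩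
    refine ⟨_, T.add_mem hψ hχ, hψ'.add hχ', ?_⟩
    filter_upwards [hu, hv, Lp.coeFn_add u v] with x h1 h2 h3
    rw [h3, Pi.add_apply, h1, h2]
    exact (grad_add (hψ'.differentiable x) (hχ'.differentiable x)).symm
  zero_mem' := by
    refine ⟨0, T.zero_mem, ⟨contDiff_const, HasCompactSupport.zero⟩, ?_⟩
    filter_upwards [Lp.coeFn_zero C3 2 (volume.restrict S)] with x h1
    rw [h1, grad_zero_of_eventually_const (ψ := 0) (c := 0) (Filter.Eventually.of_forall fun _ => rfl)]
    rfl
  smul_mem' := by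
    rintro c u ⟨ψ, hψ, hψ', hu⟩
    refine ⟨_, T.smul_mem c hψ, IsTest.mul_left contDiff_const hψ', ?_⟩
    filter_upwards [hu, Lp.coeFn_smul c u] with x h1 h2
    rw [h2, Pi.smul_apply, h1]
    exact (grad_const_mul c (hψ'.differentiable x)).symm

/-- Bilinear integrals become inner products in L², so identities against a fixed test field survive
L² limits. -/
lemma integral_dot_eq_inner {μ : Measure R3} (u : Lp C3 2 μ) {A : R3 → C3} (hA : MemLp A 2 μ) :
    ∫ x, dot (u x) (A x) ∂μ = inner ℂ ((memLp_conjVec hA).toLp _) u := by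
  rw [L2.inner_def]
  refine integral_congr_ae ?_
  filter_upwards [(memLp_conjVec hA).coeFn_toLp] with x hx
  rw [hx, dot_comm, dot_eq_inner]

lemma integral_mul_eq_inner {μ : Measure R3} (u : Lp ℂ 2 μ) {f : R3 → ℂ} (hf : MemLp f 2 μ) :
    ∫ x, u x * f x ∂μ = inner ℂ (hf.star.toLp _) u := by
  rw [L2.inner_def]
  refine integral_congr_ae ?_
  filter_upwards [hf.star.coeFn_toLp] with x hx
  rw [hx, RCLike.inner_apply]
  simp

lemma IsShellTest.memLp_grad {ψ : R3 → ℂ} (h : IsShellTest Ω ψ) :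
    MemLp (grad ψ) 2 (volume.restrict (shell Ω)) := (h.1.grad.memLp 2).restrict _

lemma IsShellTest.toLp_grad_mem {ψ : R3 → ℂ} (h : IsShellTest Ω ψ) :
    h.memLp_grad.toLp _ ∈ gradSpace (shellTests Ω) (shell Ω) := ⟨ψ, h, h.1, h.memLp_grad.coeFn_toLp⟩

/-- For the gradient of a shell test function, extended by zero, the pairing is the integral of ∇ψ ·
curl φ over the whole space, which is 0; this is a closed condition. The free constant on the ball
does not affect tangential traces. -/
lemma hCurlZero_of_mem_closure {w : Lp C3 2 (volume.restrict (shell Ω))}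
    (hw : w ∈ (gradSpace (shellTests Ω) (shell Ω)).topologicalClosure) : HCurlZero (shell Ω) w 0 := by
  refine ⟨Lp.memLp w, MemLp.zero, fun φ hφ => ?_⟩
  have mA := (hφ.curl.memLp 2).restrict (shell Ω)
  have key : ∀ u ∈ (gradSpace (shellTests Ω) (shell Ω)).topologicalClosure, inner ℂ ((memLp_conjVec mA).toLp _) u = 0 := by
    intro u hu
    refine (isClosed_eq (f := fun u => inner ℂ ((memLp_conjVec mA).toLp _) u) (by fun_prop)
      continuous_const).closure_subset_iff.2 ?_ hu
    rintro v ⟨ψ, hψ, -, hv⟩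
    change inner ℂ _ _ = 0
    rw [← integral_dot_eq_inner v mA,
      integral_congr_ae (hv.mono fun x hx => by rw [hx] : _ =ᵐ[_] fun x => dot (grad ψ x) (curl φ x)),
      setIntegral_shell_dot_grad hψ, integral_dot_grad_curl hψ.1.1 hφ]
  have := key w hw
  rw [← integral_dot_eq_inner w mA] at this
  simp [tangentialPairing, integral_neg, this]

/-- Turns the flux condition into orthogonality. ψ - 1 vanishes near ∂Ω, so its cutoff by the
indicator of Ω is smooth, and it equals -1 near the ball. -/
lemma isShellTest_sub_one (hΩ : IsOpen Ω) (hb : Bornology.IsBounded Ω)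
    (hK : closedBall (0 : R3) 1 ⊆ Ω) {ψ : R3 → ℂ} (hψ : IsTest ψ)
    (h1 : ∀ᶠ x in 𝓝ˢ (frontier Ω), ψ x = 1) (h0 : Disjoint (tsupport ψ) (closedBall 0 1)) :
    ∃ χ, IsShellTest Ω χ ∧ ∀ x ∈ shell Ω, grad χ x = grad ψ x := by
  classical
  have hin : ∀ x ∈ Ω, (Ω.indicator fun x => ψ x - 1) =ᶠ[𝓝 x] fun x => ψ x - 1 := fun x hx => by
    filter_upwards [hΩ.mem_nhds hx] with y hy
    exact Set.indicator_of_mem hy _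
  have hout : ∀ x ∉ Ω, (Ω.indicator fun x => ψ x - 1) =ᶠ[𝓝 x] fun _ => 0 := fun x hx => by
    by_cases hc : x ∈ closure Ω
    · have hf : x ∈ frontier Ω := by rw [hΩ.frontier_eq]; exact ⟨hc, hx⟩
      filter_upwards [nhds_le_nhdsSet hf h1] with y hy
      by_cases hyΩ : y ∈ Ω
      · rw [Set.indicator_of_mem hyΩ, hy, sub_self]
      · exact Set.indicator_of_notMem hyΩ _
    · filter_upwards [isClosed_closure.isOpen_compl.mem_nhds hc] with y hy
      exact Set.indicator_of_notMem (fun h => hy (subset_closure h)) _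
  have hsm : ContDiff ℝ (⊤ : ℕ∞) (fun x => ψ x - 1) := hψ.1.sub contDiff_const
  refine ⟨Ω.indicator fun x => ψ x - 1, ⟨⟨?_, ?_⟩, fun x hx => ?_, -1, fun x hx => ?_⟩, fun x hx => ?_⟩
  · refine contDiff_iff_contDiffAt.2 fun x => ?_
    by_cases hx : x ∈ Ω
    · exact hsm.contDiffAt.congr_of_eventuallyEq (hin x hx)
    · exact contDiffAt_const.congr_of_eventuallyEq (hout x hx)
  · exact HasCompactSupport.of_support_subset_isCompact hb.isCompact_closure
      ((Set.support_indicator_subset).trans subset_closure)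
  · by_contra hxΩ
    exact notMem_tsupport_iff_eventuallyEq.2 (hout x hxΩ) hx
  · filter_upwards [hin x (hK hx), eventually_eq_zero_of_disjoint h0 x hx] with y h1 h2
    rw [h1, h2, zero_sub]
  · rw [grad_congr_of_eventuallyEq (hin x hx.1)]
    have := grad_sub (f := ψ) (g := fun _ => 1) (hψ.differentiable x) (differentiableAt_const _)
    rw [this, grad_zero_of_eventually_const (ψ := fun _ => (1 : ℂ)) (Filter.Eventually.of_forall fun _ => rfl),
      sub_zero]

/-- No boundary term arises: g vanishes near ∂Ω and φ vanishes near the ball. -/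
lemma setIntegral_mul_divergence {g : R3 → ℂ} (hg : IsTest g) (hgΩ : tsupport g ⊆ Ω) {φ : R3 → C3}
    (hφ : IsTest φ) (h0 : Disjoint (tsupport φ) (closedBall 0 1)) :
    ∫ x in shell Ω, g x * divergence φ x = -∫ x in shell Ω, dot (grad g x) (φ x) := by
  have hdiv : ∀ x ∉ tsupport φ, divergence φ x = 0 := fun x hx => by
    refine Finset.sum_eq_zero fun i _ => ?_
    rw [image_eq_zero_of_notMem_tsupport fun h => hx (tsupport_pderiv_subset φ i h)]
    rfl
  rw [setIntegral_eq_integral_of_forall_compl_eq_zero, setIntegral_eq_integral_of_forall_compl_eq_zero,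
    integral_mul_divergence hg.1 hφ]
  · intro x hx
    by_cases h : x ∈ tsupport φ
    · rw [grad_zero_of_notMem fun h' => hx ⟨hgΩ h', fun hb => h0.le_bot ⟨h, hb⟩⟩, dot_zero_left]
    · rw [image_eq_zero_of_notMem_tsupport h, dot_zero_right]
  · intro x hx
    by_cases h : x ∈ tsupport φ
    · rw [image_eq_zero_of_notMem_tsupport fun h' => hx ⟨hgΩ h', fun hb => h0.le_bot ⟨h, hb⟩⟩, zero_mul]
    · rw [hdiv x h, mul_zero]

lemma isTest_divergence {φ : R3 → C3} (hφ : IsTest φ) : IsTest (divergence φ) := by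
  refine IsTest.of_tsupport_subset hφ ?_ (closure_minimal (fun x hx => ?_) (isClosed_tsupport φ))
  · exact ContDiff.sum fun i _ => (contDiff_C3_iff.1 (contDiff_pderiv hφ.1 i)) i
  · by_contra h
    refine hx (Finset.sum_eq_zero fun i _ => ?_)
    rw [image_eq_zero_of_notMem_tsupport fun h' => h (tsupport_pderiv_subset φ i h')]
    rfl

/-- Limits of gradients of test functions have a potential, if a Poincaré inequality holds. -/
lemma exists_potential_of_mem_closure {T : Submodule ℂ (R3 → ℂ)} {S : Set R3}
    (hP : ∃ C : NNReal, ∀ ψ ∈ T,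
      eLpNorm ψ 2 (volume.restrict S) ≤ C * eLpNorm (grad ψ) 2 (volume.restrict S))
    {w : Lp C3 2 (volume.restrict S)} (hw : w ∈ (gradSpace T S).topologicalClosure) :
    ∃ h : Lp ℂ 2 (volume.restrict S), ∀ φ : R3 → C3, IsTest φ →
      (∀ ψ ∈ T, ∫ x in S, ψ x * divergence φ x = -∫ x in S, dot (grad ψ x) (φ x)) →
      ∫ x in S, h x * divergence φ x = -∫ x in S, dot (w x) (φ x) := by
  obtain ⟨u, hu, hlim⟩ := mem_closure_iff_seq_limit.1 hw
  choose ψ hψT hψ hψu using hu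
  obtain ⟨C, hC⟩ := hP
  have mψ : ∀ j, MemLp (ψ j) 2 (volume.restrict S) := fun j => ((hψ j).memLp 2).restrict _
  -- By the Poincaré inequality, convergence of the gradients makes the functions themselves a
  -- Cauchy sequence.
  have hd : ∀ i j, dist ((mψ i).toLp _) ((mψ j).toLp _) ≤ C * dist (u i) (u j) := by
    intro i j
    have h1 := hC _ (T.sub_mem (hψT i) (hψT j))
    have h2 : eLpNorm (grad (ψ i - ψ j)) 2 (volume.restrict S) = edist (u i) (u j) := by
      rw [Lp.edist_def]
      refine eLpNorm_congr_ae ?_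
      filter_upwards [hψu i, hψu j] with x h1 h2
      rw [Pi.sub_apply, h1, h2]
      exact grad_sub ((hψ i).differentiable x) ((hψ j).differentiable x)
    rw [h2] at h1
    have h3 : edist ((mψ i).toLp _) ((mψ j).toLp _) ≤ C * edist (u i) (u j) := by
      rw [Lp.edist_toLp_toLp]; exact h1
    rw [edist_dist, edist_dist, ← ENNReal.ofReal_coe_nnreal, ← ENNReal.ofReal_mul C.coe_nonneg] at h3
    exact (ENNReal.ofReal_le_ofReal_iff (by positivity)).1 h3
  have hcauchy : CauchySeq fun j => (mψ j).toLp _ := by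
    rw [Metric.cauchySeq_iff]
    intro ε hε
    obtain ⟨N, hN⟩ := Metric.cauchySeq_iff.1 hlim.cauchySeq (ε / (C + 1)) (by positivity)
    refine ⟨N, fun i hi j hj => (hd i j).trans_lt ?_⟩
    have h1 := hN i hi j hj
    rw [lt_div_iff₀ (by positivity)] at h1
    have h2 : (0 : ℝ) ≤ dist (u i) (u j) := dist_nonneg
    nlinarith
  obtain ⟨h, hh⟩ := cauchySeq_tendsto_of_complete hcauchy
  refine ⟨h, fun φ hφ h0 => ?_⟩
  have md := ((isTest_divergence hφ).memLp 2).restrict S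
  have mφ := (hφ.memLp 2).restrict S
  rw [integral_mul_eq_inner h md, integral_dot_eq_inner w mφ]
  have t1 : Filter.Tendsto (fun j => inner ℂ (md.star.toLp _) ((mψ j).toLp _)) Filter.atTop
      (𝓝 (inner ℂ (md.star.toLp _) h)) := tendsto_const_nhds.inner hh
  have t2 : Filter.Tendsto (fun j => -inner ℂ ((memLp_conjVec mφ).toLp _) (u j)) Filter.atTop
      (𝓝 (-inner ℂ ((memLp_conjVec mφ).toLp _) w)) := (tendsto_const_nhds.inner hlim).neg
  refine tendsto_nhds_unique t1 (t2.congr fun j => ?_)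
  have e1 : ∫ x in S, (mψ j).toLp _ x * divergence φ x = ∫ x in S, ψ j x * divergence φ x :=
    integral_congr_ae ((mψ j).coeFn_toLp.mono fun x hx => by simp only [hx])
  have e2 : ∫ x in S, dot (u j x) (φ x) = ∫ x in S, dot (grad (ψ j) x) (φ x) :=
    integral_congr_ae ((hψu j).mono fun x hx => by simp only [hx])
  rw [← integral_mul_eq_inner _ md, ← integral_dot_eq_inner _ mφ, e1, e2]
  exact (h0 _ (hψT j)).symm

/-- The field is ∇g - w, with w the projection of ∇g onto the closed span of gradients of shell test
functions. Subtracting w leaves the traces unchanged, and the orthogonality of the remainder gives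
the divergence and flux conditions together. -/
lemma exists_isShellField (hΩ : IsOpen Ω) (hb : Bornology.IsBounded Ω)
    (hK : closedBall (0 : R3) 1 ⊆ Ω) (hn : 1 ≤ n) {g : R3 → ℂ} (hg : IsTraceLift Ω n m k g) :
    ∃ Em : R3 → C3, IsShellField Ω (Eplus n m k) Em ∧
      ∃ (h : R3 → ℂ) (c : ℂ), IsShellPotential Ω h c Em := by
  have mg : MemLp (grad g) 2 (volume.restrict (shell Ω)) := (hg.1.grad.memLp 2).restrict _
  have m0 : MemLp (0 : R3 → C3) 2 (volume.restrict (shell Ω)) := MemLp.zero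
  have : CompleteSpace (gradSpace (shellTests Ω) (shell Ω)).topologicalClosure :=
    (Submodule.isClosed_topologicalClosure _).completeSpace_coe
  set w := (gradSpace (shellTests Ω) (shell Ω)).topologicalClosure.starProjection (mg.toLp _) with hwd
  have hw : w ∈ (gradSpace (shellTests Ω) (shell Ω)).topologicalClosure := Submodule.starProjection_apply_mem _ _
  have hw0 := hCurlZero_of_mem_closure hw
  have mE : MemLp (fun x => grad g x - w x) 2 (volume.restrict (shell Ω)) := mg.sub (Lp.memLp w)
  have horth : ∀ ψ, IsShellTest Ω ψ → ∫ x in shell Ω, dot (grad g x - w x) (grad ψ x) = 0 := by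
    intro ψ hψ
    have h1 := Submodule.starProjection_inner_eq_zero (K := (gradSpace (shellTests Ω) (shell Ω)).topologicalClosure)
      (mg.toLp _) _ (Submodule.le_topologicalClosure _ hψ.conj.toLp_grad_mem)
    rw [← hwd, ← inner_conj_symm, map_eq_zero, L2.inner_def] at h1
    rw [← h1]
    refine integral_congr_ae ?_
    filter_upwards [hψ.conj.memLp_grad.coeFn_toLp, Lp.coeFn_sub (mg.toLp _) w, mg.coeFn_toLp]
      with x h1 h2 h3
    rw [h1, h2, Pi.sub_apply, h3, grad_conj hψ.1, dot_comm, dot_eq_inner]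
  have hTP : ∀ φ : R3 → C3, IsTest φ → tangentialPairing (shell Ω) (fun x => grad g x - w x) 0 φ
      = tangentialPairing (shell Ω) (grad g) 0 φ := by
    intro φ hφ
    have e := tangentialPairing_sub mg m0 hw0.1 m0 hφ
    simp only [Pi.zero_apply, sub_zero] at e
    have e' : tangentialPairing (shell Ω) (fun x => grad g x - w x) 0 φ
      = tangentialPairing (shell Ω) (grad g) 0 φ - tangentialPairing (shell Ω) w 0 φ := e
    rw [e', hw0.2.2 φ hφ, sub_zero]
  have hzero : ∀ φ : R3 → C3, IsTest φ → Disjoint (tsupport φ) (closedBall 0 1) →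
      tangentialPairing (shell Ω) (fun x => grad g x - w x) 0 φ = 0 := by
    intro φ hφ hs
    have a := hg.2.2 φ hφ
    rw [tangentialPairing_eq_zero_of_disjoint (S := core) (hs.mono_right ball_subset_closedBall)] at a
    rw [hTP φ hφ]
    linear_combination a
  refine ⟨fun x => grad g x - w x, ⟨_, 0, hCurl_Eplus hn, ⟨mE, m0, fun φ hφ hs => ?_⟩, ?_, ?_, ?_, hzero,
    ?_⟩, ?_⟩
  · exact hzero φ hφ (Set.disjoint_left.2 fun _ hx => (hs hx).2)
  · intro F G _
    simp
  · exact fun ψ hψ hs => horth ψ (isShellTest_of_tsupport_subset hψ hs)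
  · intro φ hφ hs
    rw [tangentialPairing_Eplus hn (hCurl_Eplus hn), hg.2.2 φ hφ, hTP φ hφ]
  · intro ψ hψ h1 h0
    obtain ⟨χ, hχ, hgrad⟩ := isShellTest_sub_one hΩ hb hK hψ h1 h0
    rw [← horth χ hχ]
    refine setIntegral_congr_fun (isOpen_shell hΩ).measurableSet fun x hx => ?_
    simp only [hgrad x hx]
  · obtain ⟨h, hh⟩ := exists_potential_of_mem_closure
      (exists_eLpNorm_le_grad (isOpen_shell hΩ).measurableSet hb) hw
    have mg0 : MemLp g 2 (volume.restrict (shell Ω)) := (hg.1.memLp 2).restrict _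
    -- The potential is g minus the potential of w. Both vanish on ∂Ω, so the constant there is 0;
    -- it is the constant on the inner boundary that is left free.
    refine ⟨fun x => g x - h x, 0, mg0.sub (Lp.memLp h), mE, fun φ hφ h0 => ?_⟩
    have md := ((isTest_divergence hφ).memLp 2).restrict (shell Ω)
    have mφ := (hφ.memLp 2).restrict (shell Ω)
    have i1 : Integrable (fun x => g x * divergence φ x) (volume.restrict (shell Ω)) :=
      mg0.integrable_mul md
    have i2 : Integrable (fun x => h x * divergence φ x) (volume.restrict (shell Ω)) :=
      (Lp.memLp h).integrable_mul md
    simp only [sub_zero, sub_mul, dot_sub_left]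
    rw [integral_sub i1 i2,
      integral_sub (integrable_dot mg mφ) (integrable_dot (Lp.memLp w) mφ), hh φ hφ fun ψ hψ => setIntegral_mul_divergence hψ.1 hψ.2.1 hφ h0,
      setIntegral_mul_divergence hg.1 hg.2.1 hφ h0]
    ring

end Existence


/-! ### Mollifiers with shifted support, and weak convergence. -/

section Mollification

/-- Convolution with a weight. -/
noncomputable def moll (ρ : R3 → ℝ) (f : R3 → ℂ) : R3 → ℂ :=
  convolution ρ f (ContinuousLinearMap.lsmul ℝ ℝ) volume

lemma moll_apply (ρ : R3 → ℝ) (f : R3 → ℂ) (x : R3) : moll ρ f x = ∫ y, ρ y • f (x - y) := rfl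

lemma moll_apply' (ρ : R3 → ℝ) (f : R3 → ℂ) (x : R3) : moll ρ f x = ∫ y, ρ (x - y) • f y := by
  rw [moll_apply, ← integral_sub_left_eq_self _ volume x]
  simp

/-- Mollifiers `ρ j` supported in the balls of radius `t j * δ / 2` about `-t j • v`, where
`t j` tends to `0`. -/
structure IsMollifier (v : R3) (δ : ℝ) (ρ : ℕ → R3 → ℝ) (t : ℕ → ℝ) : Prop where
  isTest : ∀ j, IsTest (ρ j)
  nonneg : ∀ j x, 0 ≤ ρ j x
  integral_eq_one : ∀ j, ∫ x, ρ j x = 1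
  pos : ∀ j, 0 < t j
  tendsto : Filter.Tendsto t Filter.atTop (𝓝 0)
  norm_lt : ∀ j y, ρ j y ≠ 0 → ‖y + t j • v‖ < t j * δ / 2

lemma exists_isMollifier (v : R3) {δ : ℝ} (hδ : 0 < δ) : ∃ ρ t, IsMollifier v δ ρ t := by
  have ht : ∀ j : ℕ, (0 : ℝ) < 1 / ((j : ℝ) + 1) := fun j => by positivity
  let b : ∀ j : ℕ, ContDiffBump (-((1 / ((j : ℝ) + 1)) • v)) := fun j =>
    ⟨1 / ((j : ℝ) + 1) * δ / 4, 1 / ((j : ℝ) + 1) * δ / 2, by positivity, by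
      have : 0 < 1 / ((j : ℝ) + 1) * δ := mul_pos (ht j) hδ
      linarith⟩
  refine ⟨fun j => (b j).normed volume, fun j => 1 / ((j : ℝ) + 1), fun j => ⟨(b j).contDiff_normed,
    (b j).hasCompactSupport_normed⟩, fun j x => (b j).nonneg_normed x, fun j => (b j).integral_normed, ht,
    tendsto_one_div_add_atTop_nhds_zero_nat, fun j y hy => ?_⟩
  have h1 : y ∈ Function.support ((b j).normed volume) := hy
  rw [(b j).support_normed_eq, mem_ball, dist_eq_norm, sub_neg_eq_add] at h1
  exact h1

lemma contDiff_moll {ρ : R3 → ℝ} {f : R3 → ℂ} (hρ : IsTest ρ) (hf : MemLp f 2 volume) :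
    ContDiff ℝ (⊤ : ℕ∞) (moll ρ f) :=
  hρ.2.contDiff_convolution_left _ hρ.1 (hf.locallyIntegrable (by norm_num))

lemma pderiv_moll {ρ : R3 → ℝ} {f : R3 → ℂ} (hρ : IsTest ρ) (hf : MemLp f 2 volume) (j : Fin 3) (x : R3) :
    pderiv j (moll ρ f) x = moll (pderiv j ρ) f x := by
  have hl : LocallyIntegrable f volume := hf.locallyIntegrable (by norm_num)
  have h1 := hρ.2.hasFDerivAt_convolution_left (ContinuousLinearMap.lsmul ℝ ℝ) (hρ.1.of_le (by
    exact_mod_cast le_top)) hl x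
  have h2 : Integrable (fun y => (ContinuousLinearMap.lsmul ℝ ℝ : ℝ →L[ℝ] ℂ →L[ℝ] ℂ).precompL R3
      (fderiv ℝ ρ y) (f (x - y))) volume :=
    (hρ.2.fderiv ℝ).convolutionExists_left _ (hρ.1.continuous_fderiv (by simp)) hl x
  rw [moll, h1.pderiv_eq, convolution, ContinuousLinearMap.integral_apply h2]
  rfl

/-- `w` is the weak gradient of `h` in the whole space, both in `L²`. -/
def IsWeakGrad (h : R3 → ℂ) (w : R3 → C3) : Prop :=
  MemLp h 2 volume ∧ MemLp w 2 volume ∧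
    ∀ φ : R3 → ℂ, IsTest φ → ∀ j, ∫ x, h x * pderiv j φ x = -∫ x, w x j * φ x

lemma memLp_coord {μ : Measure R3} {w : R3 → C3} {p : ENNReal} (hw : MemLp w p μ) (j : Fin 3) :
    MemLp (fun x => w x j) p μ :=
  hw.mono ((EuclideanSpace.proj (𝕜 := ℂ) j).continuous.comp_aestronglyMeasurable hw.1)
    (Filter.Eventually.of_forall fun x => PiLp.norm_apply_le (w x) j)

lemma moll_pderiv_eq {ρ : R3 → ℝ} (hρ : IsTest ρ) (f : R3 → ℂ) (j : Fin 3) (x : R3) :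
    moll (pderiv j ρ) f x = -∫ y, f y * pderiv j (fun y => ((ρ (x - y) : ℝ) : ℂ)) y := by
  rw [moll_apply', ← integral_neg]
  congr 1 with y
  have h1 : HasFDerivAt (fun y => ((ρ (x - y) : ℝ) : ℂ))
      (Complex.ofRealCLM.comp ((fderiv ℝ ρ (x - y)).comp (-ContinuousLinearMap.id ℝ R3))) y :=
    Complex.ofRealCLM.hasFDerivAt.comp y ((hρ.differentiable (x - y)).hasFDerivAt.comp y
      ((hasFDerivAt_id y).const_sub x))
  rw [h1.pderiv_eq]
  simp [pderiv, mul_comm]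

lemma isTest_reflect {ρ : R3 → ℝ} (hρ : IsTest ρ) (x : R3) :
    IsTest (fun y => ((ρ (x - y) : ℝ) : ℂ)) :=
  IsTest.ofReal ⟨hρ.1.comp (contDiff_const.sub contDiff_id),
    hρ.2.comp_homeomorph (Homeomorph.subLeft x)⟩

/-- The reflected mollifier y ↦ ρ(x - y) is an admissible test function, and its sign change cancels
the sign in the weak gradient. -/
lemma IsWeakGrad.pderiv_moll {ρ : R3 → ℝ} {h : R3 → ℂ} {w : R3 → C3} (hw : IsWeakGrad h w)
    (hρ : IsTest ρ) (j : Fin 3) (x : R3) :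
    pderiv j (moll ρ h) x = moll ρ (fun x => w x j) x := by
  rw [CoreShell.pderiv_moll hρ hw.1, moll_pderiv_eq hρ, hw.2.2 _ (isTest_reflect hρ x), neg_neg, moll_apply']
  congr 1 with y
  simp [mul_comm]

lemma moll_eq_zero {ρ : R3 → ℝ} {f : R3 → ℂ} {x : R3} (h : ∀ᵐ y, ρ (x - y) ≠ 0 → f y = 0) :
    moll ρ f x = 0 := by
  rw [moll_apply']
  refine integral_eq_zero_of_ae ?_
  filter_upwards [h] with y hy
  by_cases h0 : ρ (x - y) = 0
  · simp [h0]
  · simp [hy h0]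

/-- Translations act continuously on L². -/
lemma continuous_integral_mul_translate {a f : R3 → ℂ} (ha : MemLp a 2 volume) (hf : MemLp f 2 volume) :
    Continuous fun y => ∫ x, a x * f (x - y) := by
  have : Fact ((2 : ENNReal) ≠ ⊤) := ⟨by norm_num⟩
  have h1 : ∀ y, ∫ x, a x * f (x - y)
      = inner ℂ (ha.star.toLp _) (DomAddAct.mk (-y) +ᵥ hf.toLp f) := by
    intro y
    rw [DomAddAct.mk_vadd_toLp, L2.inner_def]
    have h3 : MemLp (fun x => f (-y +ᵥ x)) 2 volume :=
      hf.comp_measurePreserving (measurePreserving_vadd (-y) volume)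
    refine integral_congr_ae ?_
    filter_upwards [ha.star.coeFn_toLp, h3.coeFn_toLp] with x h1 h2
    rw [h1, h2, RCLike.inner_apply]
    simp [sub_eq_neg_add, mul_comm]
  simp_rw [h1]
  have h2 : Continuous fun y : R3 => DomAddAct.mk (-y) +ᵥ hf.toLp f :=
    (DomAddAct.mkHomeomorph.continuous.comp continuous_neg).vadd continuous_const
  exact continuous_const.inner h2

lemma integral_mul_moll {ρ : R3 → ℝ} {a f : R3 → ℂ} (hρ : IsTest ρ) (ha : MemLp a 2 volume)
    (hf : MemLp f 2 volume) :
    ∫ x, a x * moll ρ f x = ∫ y, ρ y • ∫ x, a x * f (x - y) := by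
  -- Continuity for the absolute values makes the double integral absolutely convergent over the
  -- compact support of ρ, so Fubini applies.
  have hn : Continuous fun y => ∫ x, (fun x => (‖a x‖ : ℂ)) x * (fun x => (‖f x‖ : ℂ)) (x - y) :=
    continuous_integral_mul_translate (ha.norm.ofReal) (hf.norm.ofReal)
  have hm : AEStronglyMeasurable (fun p : R3 × R3 => a p.1 * (ρ p.2 • f (p.1 - p.2)))
      ((volume : Measure R3).prod volume) :=
    ha.1.comp_fst.mul (hρ.continuous.aestronglyMeasurable.convolution_integrand
      (ContinuousLinearMap.lsmul ℝ ℝ) hf.1)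
  have hint : Integrable (fun p : R3 × R3 => a p.1 * (ρ p.2 • f (p.1 - p.2)))
      ((volume : Measure R3).prod volume) := by
    rw [integrable_prod_iff' hm]
    refine ⟨Filter.Eventually.of_forall fun y => ?_, ?_⟩
    · have h2 := (ha.integrable_mul (hf.comp_measurePreserving
        (measurePreserving_sub_right volume y))).smul (ρ y)
      refine h2.congr (Filter.Eventually.of_forall fun x => ?_)
      simp [Complex.real_smul]; ring
    · have h3 : Integrable fun y => (ρ y : ℂ) *
          ∫ x, (fun x => (‖a x‖ : ℂ)) x * (fun x => (‖f x‖ : ℂ)) (x - y) :=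
        ((IsTest.ofReal hρ).continuous.mul hn).integrable_of_hasCompactSupport
          (IsTest.ofReal hρ).2.mul_right
      refine h3.norm.congr (Filter.Eventually.of_forall fun y => ?_)
      have h4 : ∫ x, (‖a x‖ : ℂ) * (‖f (x - y)‖ : ℂ) = ((∫ x, ‖a x‖ * ‖f (x - y)‖ : ℝ) : ℂ) := by
        rw [← integral_complex_ofReal]
        congr 1 with x
        push_cast; rfl
      simp only [h4, norm_mul, Complex.norm_real, norm_smul]
      rw [Real.norm_of_nonneg (integral_nonneg fun x => by positivity), ← integral_const_mul]
      congr 1 with x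
      ring
  calc ∫ x, a x * moll ρ f x = ∫ x, ∫ y, a x * (ρ y • f (x - y)) := by
        congr 1 with x
        rw [moll_apply, integral_const_mul]
    _ = ∫ y, ∫ x, a x * (ρ y • f (x - y)) := integral_integral_swap hint
    _ = _ := by
        congr 1 with y
        rw [← integral_smul]
        congr 1 with x
        simp only [Complex.real_smul]; ring

/-- After Fubini this is an average, with weight ρ_j concentrating at 0, of the continuous function
y ↦ ∫ a(x) f(x - y). Weak convergence is all that is needed later. -/
lemma IsMollifier.tendsto_integral_mul_moll {v : R3} {δ : ℝ} {ρ : ℕ → R3 → ℝ} {t : ℕ → ℝ}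
    (hρ : IsMollifier v δ ρ t) {a f : R3 → ℂ} (ha : MemLp a 2 volume) (hf : MemLp f 2 volume) :
    Filter.Tendsto (fun j => ∫ x, a x * moll (ρ j) f x) Filter.atTop (𝓝 (∫ x, a x * f x)) := by
  have hA := continuous_integral_mul_translate ha hf
  have hs : Filter.Tendsto (fun j => Function.support (ρ j)) Filter.atTop (𝓝 0).smallSets := by
    rw [Filter.tendsto_smallSets_iff]
    intro s hs
    obtain ⟨ε, hε, hεs⟩ := Metric.mem_nhds_iff.1 hs
    have h1 : Filter.Tendsto (fun j => t j * (‖v‖ + δ / 2)) Filter.atTop (𝓝 0) := by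
      simpa using hρ.tendsto.mul_const (‖v‖ + δ / 2)
    filter_upwards [h1.eventually (gt_mem_nhds hε)] with j hj
    intro y hy
    refine hεs (mem_ball_zero_iff.2 ?_)
    have h2 := hρ.norm_lt j y hy
    have h3 : ‖y‖ ≤ ‖y + t j • v‖ + ‖t j • v‖ := by
      simpa using norm_sub_le (y + t j • v) (t j • v)
    rw [norm_smul, Real.norm_of_nonneg (hρ.pos j).le] at h3
    linarith
  have h1 := convolution_tendsto_right (μ := (volume : Measure R3)) (φ := ρ) (l := Filter.atTop)
    (g := fun _ u => ∫ x, a x * f (x - -u)) (x₀ := 0) (k := fun _ => 0) (z₀ := ∫ x, a x * f x)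
    (Filter.Eventually.of_forall hρ.nonneg) (Filter.Eventually.of_forall hρ.integral_eq_one) hs
    (Filter.Eventually.of_forall fun _ => (hA.comp continuous_neg).aestronglyMeasurable)
    (by
      have h2 := ((hA.comp continuous_neg).tendsto 0).comp
        (Filter.tendsto_snd (f := (Filter.atTop : Filter ℕ)) (g := 𝓝 (0 : R3)))
      simp only [Function.comp_apply, neg_zero, sub_zero] at h2
      exact h2) tendsto_const_nhds
  refine h1.congr fun j => ?_
  rw [integral_mul_moll (hρ.isTest j) ha hf, convolution]
  simp

end Mollification


/-! ### Outer cones, and constancy of potentials off the shell. -/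

section Cone

/-- Near `p`, the complement of `S` contains with each point a truncated cone with axis `v`. -/
structure HasOuterCone (S : Set R3) (p v : R3) (δ r : ℝ) : Prop where
  delta_pos : 0 < δ
  r_pos : 0 < r
  notMem : ∀ x ∈ ball p r, x ∉ S → ∀ t, 0 < t → t < r → ∀ z : R3, ‖z‖ < δ → x + t • (v + z) ∉ S

/-- The condition is vacuous near an interior point; this lets interior and boundary points be
treated alike in the partition of unity. -/
lemma exists_hasOuterCone_of_mem {S : Set R3} (hS : IsOpen S) {p : R3} (hp : p ∈ S) :
    ∃ v δ r, HasOuterCone S p v δ r := by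
  obtain ⟨r, hr, h⟩ := Metric.isOpen_iff.1 hS p hp
  exact ⟨0, 1, r, one_pos, hr, fun x hx hxS => absurd (h hx) hxS⟩

/-- The axis points to the centre: x + t(-p + z) = (1 - t)x + t(x - p) + tz has norm at most (1 - t)
+ t/2 + t/2. Interior points of the ball are included so that the connected closed ball can be used
as a whole. -/
lemma exists_hasOuterCone_of_mem_closedBall {Ω : Set R3} (hΩ : IsOpen Ω)
    (hK : closedBall (0 : R3) 1 ⊆ Ω) {p : R3} (hp : p ∈ closedBall (0 : R3) 1) :
    ∃ v δ r, HasOuterCone (shell Ω) p v δ r := by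
  obtain ⟨r, hr, h⟩ := Metric.isOpen_iff.1 hΩ p (hK hp)
  refine ⟨-p, 1 / 2, min r (1 / 2), by norm_num, by positivity, fun x hx hxS t ht htr z hz => ?_⟩
  have hxr : ‖x - p‖ < min r (1 / 2) := by rwa [mem_ball, dist_eq_norm] at hx
  have hx1 : x ∈ closedBall (0 : R3) 1 := by
    by_contra hx1
    exact hxS ⟨h (ball_subset_ball (min_le_left _ _) hx), hx1⟩
  have hx1' : ‖x‖ ≤ 1 := by simpa using hx1
  have h2 : ‖x - p‖ < 1 / 2 := hxr.trans_le (min_le_right _ _)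
  have h3 : t < 1 / 2 := htr.trans_le (min_le_right _ _)
  refine fun hmem => hmem.2 ?_
  rw [mem_closedBall_zero_iff]
  have e : x + t • (-p + z) = (1 - t) • x + t • (x - p) + t • z := by module
  rw [e]
  calc ‖(1 - t) • x + t • (x - p) + t • z‖ ≤ ‖(1 - t) • x‖ + ‖t • (x - p)‖ + ‖t • z‖ := norm_add₃_le
    _ = (1 - t) * ‖x‖ + t * ‖x - p‖ + t * ‖z‖ := by
      rw [norm_smul, norm_smul, norm_smul, Real.norm_of_nonneg ht.le, Real.norm_of_nonneg (by linarith)]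
    _ ≤ 1 := by nlinarith

lemma IsLipschitzDomain.exists_hasOuterCone {Ω : Set R3} (h : IsLipschitzDomain Ω)
    (hK : closedBall (0 : R3) 1 ⊆ Ω) {p : R3} (hp : p ∈ frontier Ω) :
    ∃ v δ r, HasOuterCone (shell Ω) p v δ r := by
  obtain ⟨v, hv, K, g, hg, ρ, hρ, hgr⟩ := h.2.2.2 p hp
  have hK0 : (0 : ℝ) ≤ K := K.2
  have hpb : p ∉ closedBall (0 : R3) 1 := fun hb => by
    rw [h.1.frontier_eq] at hp
    exact hp.2 (hK hb)
  obtain ⟨s, hs, hsb⟩ := Metric.isOpen_iff.1 isClosed_closedBall.isOpen_compl p hpb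
  -- Moving by t(v + z) raises the height by at least t(1 - ‖z‖), while the graph rises by at most
  -- 2Kt‖z‖; hence the aperture 1/(1 + 2K). The radius `s` keeps away from the closed ball, and ρ/4
  -- keeps the moved point within the chart.
  refine ⟨v, 1 / (1 + 2 * K), min s (ρ / 4), by positivity, by positivity, fun x hx hxS t ht htr z hz => ?_⟩
  have hx4 : ‖x - p‖ < ρ / 4 := by
    rw [mem_ball, dist_eq_norm] at hx
    exact hx.trans_le (min_le_right _ _)
  have ht4 : t < ρ / 4 := htr.trans_le (min_le_right _ _)
  have hxΩ : x ∉ Ω := fun hxΩ => hxS ⟨hxΩ, hsb (ball_subset_ball (min_le_left _ _) hx)⟩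
  have hxρ : x ∈ ball p ρ := by
    rw [mem_ball, dist_eq_norm]; linarith
  have hδ : (1 + 2 * K) * ‖z‖ ≤ 1 := by
    rw [lt_div_iff₀ (by positivity)] at hz
    linarith
  have hz1 : ‖z‖ ≤ 1 := by nlinarith [norm_nonneg z, mul_nonneg hK0 (norm_nonneg z)]
  have hvz : |inner ℝ v z| ≤ ‖z‖ := by
    simpa [hv] using abs_real_inner_le_norm v z
  have hyρ : x + t • (v + z) ∈ ball p ρ := by
    rw [mem_ball, dist_eq_norm]
    calc ‖x + t • (v + z) - p‖ = ‖(x - p) + t • (v + z)‖ := by congr 1; module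
      _ ≤ ‖x - p‖ + t * (‖v‖ + ‖z‖) := by
        refine (norm_add_le _ _).trans ?_
        rw [norm_smul, Real.norm_of_nonneg ht.le]
        gcongr
        exact norm_add_le _ _
      _ < ρ := by rw [hv]; nlinarith
  refine fun hmem => ?_
  have h1 := (hgr _ hyρ).1 hmem.1
  have h2 : g (x - inner ℝ v x • v) ≤ inner ℝ v x := not_lt.1 fun h' => hxΩ ((hgr x hxρ).2 h')
  have hvv : inner ℝ v v = (1 : ℝ) := by rw [real_inner_self_eq_norm_sq, hv]; norm_num
  have e1 : inner ℝ v (x + t • (v + z)) = inner ℝ v x + t + t * inner ℝ v z := by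
    rw [inner_add_right, inner_smul_right, inner_add_right, hvv]; ring
  have e2 : x + t • (v + z) - inner ℝ v (x + t • (v + z)) • v - (x - inner ℝ v x • v)
      = t • (z - inner ℝ v z • v) := by rw [e1]; module
  have h3 : g (x + t • (v + z) - inner ℝ v (x + t • (v + z)) • v)
      ≤ g (x - inner ℝ v x • v) + K * (t * (2 * ‖z‖)) := by
    have h4 := hg.dist_le_mul (x + t • (v + z) - inner ℝ v (x + t • (v + z)) • v) (x - inner ℝ v x • v)
    rw [Real.dist_eq, dist_eq_norm, e2, norm_smul, Real.norm_of_nonneg ht.le] at h4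
    have h5 : ‖z - inner ℝ v z • v‖ ≤ 2 * ‖z‖ := by
      refine (norm_sub_le _ _).trans ?_
      rw [norm_smul, hv, mul_one, Real.norm_eq_abs]
      linarith
    have h6 : K * (t * ‖z - inner ℝ v z • v‖) ≤ K * (t * (2 * ‖z‖)) := by gcongr
    have h7 := (abs_le.1 (h4.trans h6)).2
    linarith
  rw [e1] at h1 h3
  have h8 := (abs_le.1 hvz).1
  have h9 : t * (K * (2 * ‖z‖)) + t * ‖z‖ ≤ t := by nlinarith
  have h10 : t * -‖z‖ ≤ t * inner ℝ v z := mul_le_mul_of_nonneg_left h8 ht.le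
  linarith

/-- The complement has positive measure near p, since it contains a ball inside the cone. So two
a.e. constants cannot differ. -/
lemma HasOuterCone.ae_unique {S : Set R3} {p v : R3} {δ r : ℝ} (h : HasOuterCone S p v δ r)
    (hp : p ∉ S) {f : R3 → ℂ} {c c' : ℂ} {s s' : ℝ} (hs : 0 < s) (hs' : 0 < s')
    (hc : ∀ᵐ x, x ∈ ball p s → x ∉ S → f x = c) (hc' : ∀ᵐ x, x ∈ ball p s' → x ∉ S → f x = c') :
    c = c' := by
  have hδ := h.delta_pos
  have hr := h.r_pos
  set q := min r (min s s') with hq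
  have hq0 : 0 < q := by positivity
  -- Small enough that the ball of radius tδ about p + tv, which lies in the cone at p, stays within
  -- distance q of p.
  set t := q / (2 * (‖v‖ + δ + 1)) with ht
  have ht0 : 0 < t := by positivity
  have htq : t * (2 * (‖v‖ + δ + 1)) = q := by rw [ht]; field_simp
  have htr : t < r := by
    have : q ≤ r := min_le_left _ _
    nlinarith [norm_nonneg v]
  by_contra hne
  have h0 : ∀ᵐ x, x ∉ ball (p + t • v) (t * δ) := by
    filter_upwards [hc, hc'] with x h1 h2 hx
    rw [mem_ball, dist_eq_norm] at hx
    have e : x = p + t • (v + (t⁻¹ • (x - p) - v)) := by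
      rw [add_sub_cancel, smul_smul, mul_inv_cancel₀ ht0.ne', one_smul, add_sub_cancel]
    have e2 : t⁻¹ • (x - p) - v = t⁻¹ • (x - (p + t • v)) := by
      rw [smul_sub, smul_sub, smul_add, smul_smul, inv_mul_cancel₀ ht0.ne', one_smul]; module
    have hz : ‖t⁻¹ • (x - p) - v‖ < δ := by
      rw [e2, norm_smul, norm_inv, Real.norm_of_nonneg ht0.le, inv_mul_lt_iff₀ ht0]
      exact hx
    have hxS : x ∉ S := by
      rw [e]; exact h.notMem p (mem_ball_self hr) hp t ht0 htr _ hz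
    have hxq : ‖x - p‖ < q := by
      calc ‖x - p‖ = ‖(x - (p + t • v)) + t • v‖ := by congr 1; module
        _ ≤ ‖x - (p + t • v)‖ + t * ‖v‖ := by
          refine (norm_add_le _ _).trans ?_
          rw [norm_smul, Real.norm_of_nonneg ht0.le]
        _ < q := by nlinarith [norm_nonneg v]
    refine hne ((h1 ?_ hxS).symm.trans (h2 ?_ hxS))
    · rw [mem_ball, dist_eq_norm]; exact hxq.trans_le ((min_le_right _ _).trans (min_le_left _ _))
    · rw [mem_ball, dist_eq_norm]; exact hxq.trans_le ((min_le_right _ _).trans (min_le_right _ _))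
  have h1 : volume (ball (p + t • v) (t * δ)) = 0 := measure_eq_zero_iff_ae_notMem.2 h0
  exact (measure_ball_pos volume (p + t • v) (mul_pos ht0 hδ)).ne' h1

/-- At x the mollification samples f only near x + t_j v, inside the outer cone at x. The sampling
radius t_j δ/2 is half of the aperture, which leaves room to move x a little, so that x is outside
the closed support and not merely a zero. -/
lemma HasOuterCone.eventually_moll_eq_zero {S : Set R3} {p v : R3} {δ r : ℝ}
    (h : HasOuterCone S p v δ r) {ρ : ℕ → R3 → ℝ} {t : ℕ → ℝ} (hρ : IsMollifier v δ ρ t)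
    {f : R3 → ℂ} {r' : ℝ} (hf : ∀ᵐ y, y ∈ ball p r' → y ∉ S → f y = 0) {j : ℕ} (hj : t j < r)
    (hj' : t j * (‖v‖ + δ) < r' / 2) {x : R3} (hx : x ∈ ball p r) (hx' : x ∈ ball p (r' / 2))
    (hxS : x ∉ S) : ∀ᶠ x' in 𝓝 x, moll (ρ j) f x' = 0 := by
  have hδ := h.delta_pos
  have ht0 := hρ.pos j
  filter_upwards [ball_mem_nhds x (by positivity : 0 < t j * δ / 2)] with x' hx''
  rw [mem_ball, dist_eq_norm] at hx'' hx'
  refine moll_eq_zero ?_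
  filter_upwards [hf] with y hy h0
  have h1 := hρ.norm_lt j _ h0
  have h2 : ‖y - (x + t j • v)‖ < t j * δ := by
    calc ‖y - (x + t j • v)‖ = ‖(x' - x) - (x' - y + t j • v)‖ := by congr 1; module
      _ ≤ ‖x' - x‖ + ‖x' - y + t j • v‖ := norm_sub_le _ _
      _ < t j * δ := by linarith
  have e : y = x + t j • (v + ((t j)⁻¹ • (y - x) - v)) := by
    rw [add_sub_cancel, smul_smul, mul_inv_cancel₀ ht0.ne', one_smul, add_sub_cancel]
  have e2 : (t j)⁻¹ • (y - x) - v = (t j)⁻¹ • (y - (x + t j • v)) := by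
    rw [smul_sub, smul_sub, smul_add, smul_smul, inv_mul_cancel₀ ht0.ne', one_smul]; module
  have hz : ‖(t j)⁻¹ • (y - x) - v‖ < δ := by
    rw [e2, norm_smul, norm_inv, Real.norm_of_nonneg ht0.le, inv_mul_lt_iff₀ ht0]
    exact h2
  refine hy ?_ (by rw [e]; exact h.notMem x hx hxS _ ht0 hj _ hz)
  rw [mem_ball, dist_eq_norm]
  calc ‖y - p‖ = ‖(y - (x + t j • v)) + (x - p) + t j • v‖ := by congr 1; module
    _ ≤ ‖y - (x + t j • v)‖ + ‖x - p‖ + t j * ‖v‖ := by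
      refine norm_add₃_le.trans ?_
      rw [norm_smul, Real.norm_of_nonneg ht0.le]
    _ < r' := by nlinarith

lemma norm_fderiv_eq_zero_of_pderiv {f : R3 → ℂ} {x : R3} (h : ∀ i, pderiv i f x = 0) :
    fderiv ℝ f x = 0 := by
  ext1 y
  rw [fderiv_apply_eq_sum]
  simp [h]

lemma eq_of_fderiv_eq_zero_on_segment {f : R3 → ℂ} (hf : Differentiable ℝ f) {x y : R3}
    (h : ∀ z ∈ segment ℝ x y, fderiv ℝ f z = 0) : f y = f x := by
  have := Convex.norm_image_sub_le_of_norm_fderiv_le (𝕜 := ℝ) (f := f) (C := 0) (fun z _ => hf z)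
    (fun z hz => by rw [h z hz, norm_zero]) (convex_segment x y) (left_mem_segment ℝ x y)
    (right_mem_segment ℝ x y)
  rw [zero_mul] at this
  exact sub_eq_zero.1 (norm_le_zero_iff.1 this)

/-- Near a point with the cone property, a function whose weak gradient vanishes off `S` is constant
off `S`. -/
lemma HasOuterCone.exists_ae_eq_const {S : Set R3} (hS : IsOpen S) {p v : R3} {δ r : ℝ}
    (h : HasOuterCone S p v δ r) (hp : p ∉ S) {f : R3 → ℂ} {w : R3 → C3} (hw : IsWeakGrad f w)
    (hw0 : ∀ᵐ x, x ∉ S → w x = 0) :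
    ∃ s > 0, ∃ c, ∀ᵐ x, x ∈ ball p s → x ∉ S → f x = c := by
  have hδ := h.delta_pos
  have hr := h.r_pos
  obtain ⟨ρ, t, hρ⟩ := exists_isMollifier v hδ
  set τ := r / (2 * (‖v‖ + δ + 1)) with hτ
  have hτ0 : 0 < τ := by positivity
  have hτr : τ * (2 * (‖v‖ + δ + 1)) = r := by rw [hτ]; field_simp
  have hτr' : τ < r := by nlinarith [norm_nonneg v]
  set s := τ * δ with hs
  have hs0 : 0 < s := by positivity
  set E := ball p s \ S with hE
  have hEm : MeasurableSet E := measurableSet_ball.diff hS.measurableSet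
  have hconst : ∀ᶠ j in Filter.atTop, ∀ x ∈ E, moll (ρ j) f x = moll (ρ j) f p := by
    have h1 : Filter.Tendsto (fun j => t j * (‖v‖ + δ)) Filter.atTop (𝓝 0) := by
      simpa using hρ.tendsto.mul_const (‖v‖ + δ)
    filter_upwards [hρ.tendsto.eventually (gt_mem_nhds hr), h1.eventually (gt_mem_nhds hr)] with j hj hj'
    have hd : ∀ x ∈ ball p r, x ∉ S → fderiv ℝ (moll (ρ j) f) x = 0 := by
      intro x hx hxS
      refine norm_fderiv_eq_zero_of_pderiv fun i => ?_
      rw [hw.pderiv_moll (hρ.isTest j)]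
      refine (h.eventually_moll_eq_zero hρ (r' := 2 * r) ?_ hj (by linarith) hx (by simpa using hx)
        hxS).self_of_nhds
      filter_upwards [hw0] with y hy _ hyS
      rw [hy hyS]; rfl
    have hdiff := (contDiff_moll (hρ.isTest j) hw.1).differentiable (by simp)
    -- The set `E` need not be connected, so each point is first moved along the axis v, staying off
    -- `S` where the mollified gradient vanishes. The endpoints all lie in one convex section of the
    -- cone at p, where they can be joined by segments.
    have hseg : ∀ x ∈ E, moll (ρ j) f (x + τ • v) = moll (ρ j) f x := by
      rintro x ⟨hx, hxS⟩
      rw [mem_ball, dist_eq_norm] at hx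
      refine eq_of_fderiv_eq_zero_on_segment hdiff fun z hz => ?_
      rw [segment_eq_image'] at hz
      obtain ⟨θ, ⟨h0, h1⟩, rfl⟩ := hz
      have e : x + θ • (x + τ • v - x) = x + (θ * τ) • (v + 0) := by
        rw [add_sub_cancel_left, smul_smul, add_zero]
      have hxr : x ∈ ball p r := by
        rw [mem_ball, dist_eq_norm]; nlinarith [norm_nonneg v]
      simp only [e]
      refine hd _ ?_ ?_
      · rw [mem_ball, dist_eq_norm, add_zero]
        have hθ : θ * τ ≤ τ := by nlinarith
        calc ‖x + (θ * τ) • v - p‖ = ‖(x - p) + (θ * τ) • v‖ := by congr 1; module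
          _ ≤ ‖x - p‖ + (θ * τ) * ‖v‖ := by
            refine (norm_add_le _ _).trans ?_
            rw [norm_smul, Real.norm_of_nonneg (by positivity)]
          _ ≤ ‖x - p‖ + τ * ‖v‖ := by gcongr
          _ < r := by nlinarith [norm_nonneg v]
      · rcases h0.eq_or_lt with rfl | h0
        · simpa using hxS
        · exact h.notMem x hxr hxS _ (by positivity) (by nlinarith) 0 (by simpa using hδ)
    have hpE : p ∈ E := ⟨mem_ball_self hs0, hp⟩
    intro x hx
    rw [← hseg x hx, ← hseg p hpE]
    refine eq_of_fderiv_eq_zero_on_segment hdiff fun z hz => ?_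
    rw [segment_eq_image'] at hz
    obtain ⟨θ, ⟨h0, h1⟩, rfl⟩ := hz
    have hxs := hx.1
    rw [mem_ball, dist_eq_norm] at hxs
    have e : p + τ • v + θ • (x + τ • v - (p + τ • v)) = p + τ • (v + (θ * τ⁻¹) • (x - p)) := by
      rw [smul_add, smul_smul, mul_comm θ, ← mul_assoc, mul_inv_cancel₀ hτ0.ne', one_mul]; module
    have hz : ‖(θ * τ⁻¹) • (x - p)‖ < δ := by
      rw [norm_smul, Real.norm_of_nonneg (by positivity), mul_assoc]
      have h2 : τ⁻¹ * ‖x - p‖ < δ := by rw [inv_mul_lt_iff₀ hτ0]; exact hxs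
      have h3 : 0 ≤ τ⁻¹ * ‖x - p‖ := by positivity
      nlinarith
    simp only [e]
    refine hd _ ?_ (h.notMem p (mem_ball_self hr) hp τ hτ0 hτr' _ hz)
    rw [mem_ball, dist_eq_norm, add_sub_cancel_left, norm_smul, Real.norm_of_nonneg hτ0.le]
    have h4 := norm_add_le v ((θ * τ⁻¹) • (x - p))
    nlinarith [norm_nonneg v]
  have hfin : volume E < ⊤ := (measure_mono Set.sdiff_subset).trans_lt measure_ball_lt_top
  -- On `E` the mollifications are constants; testing with indicators shows that these constants
  -- converge and that f has the limit as its average on every subset of `E`.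
  have hlim : ∀ A ⊆ E, MeasurableSet A → Filter.Tendsto (fun j => (volume.real A : ℂ) * moll (ρ j) f p)
      Filter.atTop (𝓝 (∫ x in A, f x)) := by
    intro A hA hAm
    have hAfin : volume A ≠ ⊤ := ((measure_mono hA).trans_lt hfin).ne
    have h1 := hρ.tendsto_integral_mul_moll (memLp_indicator_const 2 hAm (1 : ℂ) (Or.inr hAfin)) hw.1
    have h2 : ∀ F : R3 → ℂ, ∫ x, A.indicator (fun _ => (1 : ℂ)) x * F x = ∫ x in A, F x := fun F => by
      rw [← integral_indicator hAm]
      congr 1 with x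
      by_cases hx : x ∈ A <;> simp [hx]
    simp only [h2] at h1
    refine h1.congr' ?_
    filter_upwards [hconst] with j hj
    rw [setIntegral_congr_fun hAm fun x hx => hj x (hA hx), setIntegral_const, Complex.real_smul]
  refine ⟨s, hs0, (∫ x in E, f x) / volume.real E, ?_⟩
  by_cases hE0 : volume E = 0
  · filter_upwards [measure_eq_zero_iff_ae_notMem.1 hE0] with x hx h1 h2
    exact absurd ⟨h1, h2⟩ hx
  have hEr : (volume.real E : ℂ) ≠ 0 := by
    exact_mod_cast (ENNReal.toReal_pos hE0 hfin.ne).ne'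
  have hc : Filter.Tendsto (fun j => moll (ρ j) f p) Filter.atTop (𝓝 ((∫ x in E, f x) / volume.real E)) := by
    refine ((hlim E subset_rfl hEm).div_const (volume.real E : ℂ)).congr fun j => ?_
    field_simp
  have hloc : IntegrableOn f E volume :=
    ((hw.1.locallyIntegrable (by norm_num)).integrableOn_isCompact (isCompact_closedBall p s)).mono_set
      (Set.sdiff_subset.trans ball_subset_closedBall)
  have : IsFiniteMeasure (volume.restrict E) := ⟨by simpa using hfin⟩
  have h1 : f =ᵐ[volume.restrict E] fun _ => (∫ x in E, f x) / volume.real E := by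
    refine Integrable.ae_eq_of_forall_setIntegral_eq _ _ hloc (integrable_const _) fun A hA _ => ?_
    rw [Measure.restrict_restrict hA]
    have h2 := hlim (A ∩ E) Set.inter_subset_right (hA.inter hEm)
    rw [tendsto_nhds_unique h2 (hc.const_mul _), setIntegral_const, Complex.real_smul]
  filter_upwards [(ae_restrict_iff' hEm).1 h1] with x hx h1 h2
  exact hx ⟨h1, h2⟩

/-- The local constant is locally unchanged as p moves in Z, by `HasOuterCone.ae_unique`, hence it
is the same throughout a preconnected set. -/
lemma exists_const_of_isPreconnected {S Z : Set R3} (hS : IsOpen S) (hZ : IsPreconnected Z)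
    (hZS : ∀ p ∈ Z, p ∉ S ∧ ∃ v δ r, HasOuterCone S p v δ r) {f : R3 → ℂ} {w : R3 → C3}
    (hw : IsWeakGrad f w) (hw0 : ∀ᵐ x, x ∉ S → w x = 0) :
    ∃ c, ∀ p ∈ Z, ∃ s > 0, ∀ᵐ x, x ∈ ball p s → x ∉ S → f x = c := by
  have h1 : ∀ p, ∃ c, p ∈ Z → ∃ s > 0, ∀ᵐ x, x ∈ ball p s → x ∉ S → f x = c := fun p => by
    by_cases hp : p ∈ Z
    · obtain ⟨hpS, v, δ, r, hc⟩ := hZS p hp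
      obtain ⟨s, hs, c, h⟩ := hc.exists_ae_eq_const hS hpS hw hw0
      exact ⟨c, fun _ => ⟨s, hs, h⟩⟩
    · exact ⟨0, fun h => absurd h hp⟩
  choose c hc using h1
  rcases Z.eq_empty_or_nonempty with rfl | ⟨p₀, hp₀⟩
  · exact ⟨0, fun p hp => absurd hp (Set.notMem_empty p)⟩
  refine ⟨c p₀, fun p hp => ?_⟩
  have : c p = c p₀ := by
    refine hZ.induction₂ (fun x y => c x = c y) (fun x hx => ?_) (fun _ _ _ _ _ _ h h' => h.trans h')
      (fun _ _ _ _ h => h.symm) hp hp₀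
    obtain ⟨s, hs, hsx⟩ := hc x hx
    filter_upwards [mem_nhdsWithin_of_mem_nhds (ball_mem_nhds x hs), self_mem_nhdsWithin] with y hy hyZ
    obtain ⟨hyS, v, δ, r, hcone⟩ := hZS y hyZ
    obtain ⟨s', hs', hsy⟩ := hc y hyZ
    rw [mem_ball] at hy
    refine hcone.ae_unique hyS (s := s - dist y x) (by linarith) hs' ?_ hsy
    filter_upwards [hsx] with z hz hzy
    refine hz ?_
    rw [mem_ball] at hzy ⊢
    linarith [dist_triangle z y x]
  rw [← this]
  exact hc p hp

end Cone


/-! ### Potentials of compactly supported curl-free fields on the whole space. -/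

section Potential

/-- The Poincaré lemma for a closed 1-form on a convex set. -/
lemma exists_potential_of_closed {u : Fin 3 → R3 → ℂ} (hu : ∀ i, ContDiff ℝ (⊤ : ℕ∞) (u i))
    (hsymm : ∀ i j x, pderiv i (u j) x = pderiv j (u i) x) :
    ∃ f : R3 → ℂ, ContDiff ℝ (⊤ : ℕ∞) f ∧ ∀ i x, pderiv i f x = u i x := by
  let ω : R3 → R3 →L[ℝ] ℂ := fun x => ∑ i, (EuclideanSpace.proj (𝕜 := ℝ) i : R3 →L[ℝ] ℝ).smulRight (u i x)
  have hω : ContDiff ℝ (⊤ : ℕ∞) ω := ContDiff.sum fun i _ =>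
    (ContinuousLinearMap.smulRightL ℝ R3 ℂ (EuclideanSpace.proj (𝕜 := ℝ) i)).contDiff.comp (hu i)
  have hωa : ∀ x y, ω x y = ∑ i, y i • u i x := fun x y => by
    simp [ω]
  have hd : ∀ x y z, fderiv ℝ ω x y z = ∑ i, z i • fderiv ℝ (u i) x y := by
    intro x y z
    have h1 : HasFDerivAt (fun x => ω x z) ((ContinuousLinearMap.apply ℝ ℂ z).comp (fderiv ℝ ω x)) x :=
      (ContinuousLinearMap.apply ℝ ℂ z).hasFDerivAt.comp x (hω.differentiable (by simp) x).hasFDerivAt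
    have h2 : HasFDerivAt (fun x => ω x z) (∑ i, z i • fderiv ℝ (u i) x) x := by
      simp_rw [hωa]
      exact HasFDerivAt.fun_sum fun i _ => ((hu i).differentiable (by simp) x).hasFDerivAt.const_smul (z i)
    have h3 := congrArg (fun L : R3 →L[ℝ] ℂ => L y) (h1.unique h2)
    simpa using h3
  obtain ⟨f, hf⟩ := convex_univ.exists_forall_hasFDerivAt_of_fderiv_symmetric isOpen_univ
    (ω := ω) (hω.differentiable (by simp)).differentiableOn (fun a _ y z => by
      rw [hd, hd]
      simp_rw [fderiv_apply_eq_sum, Finset.smul_sum]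
      rw [Finset.sum_comm]
      refine Finset.sum_congr rfl fun i _ => Finset.sum_congr rfl fun j _ => ?_
      rw [hsymm, smul_comm])
  have hf' : fderiv ℝ f = ω := funext fun x => (hf x trivial).fderiv
  refine ⟨f, contDiff_infty_iff_fderiv.2 ⟨fun x => (hf x trivial).differentiableAt, hf' ▸ hω⟩,
    fun i x => ?_⟩
  rw [pderiv, hf', hωa]
  simp

/-- The image of punctured space under the radial map that adds R to the norm. -/
lemma isPreconnected_compl_closedBall {R : ℝ} (hR : 0 ≤ R) :
    IsPreconnected (closedBall (0 : R3) R)ᶜ := by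
  have h1 : IsConnected ({0}ᶜ : Set R3) := isConnected_compl_singleton_of_one_lt_rank
    (by rw [← Module.finrank_eq_rank]; simp) 0
  have h2 : ContinuousOn (fun x : R3 => (R / ‖x‖ + 1) • x) {0}ᶜ := by
    refine ContinuousOn.smul (ContinuousOn.add (continuousOn_const.div continuous_norm.continuousOn
      fun x hx => norm_ne_zero_iff.2 hx) continuousOn_const) continuousOn_id
  convert h1.isPreconnected.image _ h2 using 1
  ext x
  simp only [Set.mem_compl_iff, mem_closedBall_zero_iff, not_le, Set.mem_image, Set.mem_singleton_iff]
  constructor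
  · intro hx
    have hx0 : 0 < ‖x‖ := hR.trans_lt hx
    have h3 : 0 < 1 - R / ‖x‖ := by rw [sub_pos, div_lt_one hx0]; exact hx
    refine ⟨(1 - R / ‖x‖) • x, smul_ne_zero h3.ne' (norm_pos_iff.1 hx0), ?_⟩
    rw [norm_smul, Real.norm_of_nonneg h3.le, smul_smul]
    convert one_smul ℝ x using 2
    have : ‖x‖ - R ≠ 0 := by linarith
    field_simp
    ring
  · rintro ⟨y, hy, rfl⟩
    have hy0 : 0 < ‖y‖ := norm_pos_iff.2 hy
    rw [norm_smul, Real.norm_of_nonneg (by positivity), add_mul, div_mul_cancel₀ _ hy0.ne']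
    linarith

/-- The potential is constant on the connected exterior of the ball, so subtracting that constant
gives it compact support. -/
lemma exists_test_potential_of_closed {u : Fin 3 → R3 → ℂ} (hu : ∀ i, ContDiff ℝ (⊤ : ℕ∞) (u i))
    (hsymm : ∀ i j x, pderiv i (u j) x = pderiv j (u i) x) {R : ℝ} (hR : 0 ≤ R)
    (h0 : ∀ i x, R < ‖x‖ → u i x = 0) :
    ∃ f : R3 → ℂ, IsTest f ∧ Function.support f ⊆ closedBall 0 R ∧ ∀ i x, pderiv i f x = u i x := by
  obtain ⟨f, hf, hfu⟩ := exists_potential_of_closed hu hsymm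
  obtain ⟨a, ha⟩ : ∃ a : R3, R < ‖a‖ :=
    ⟨EuclideanSpace.single 0 (R + 1), by simp [abs_of_nonneg (by linarith : 0 ≤ R + 1)]⟩
  have hc : ∀ x, R < ‖x‖ → f x = f a := fun x hx => by
    refine isClosed_closedBall.isOpen_compl.is_const_of_fderiv_eq_zero (𝕜 := ℝ)
      (isPreconnected_compl_closedBall hR) (hf.differentiable (by simp)).differentiableOn
      (fun y hy => ?_) (by simpa using hx) (by simpa using ha)
    refine norm_fderiv_eq_zero_of_pderiv fun i => ?_
    rw [hfu]
    exact h0 i y (by simpa using hy)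
  have hs : Function.support (fun x => f x - f a) ⊆ closedBall 0 R := fun x hx => by
    by_contra h
    exact hx (sub_eq_zero.2 (hc x (by simpa using h)))
  refine ⟨fun x => f x - f a, ⟨hf.sub contDiff_const,
    HasCompactSupport.of_support_subset_isCompact (isCompact_closedBall 0 R) hs⟩, hs, fun i x => ?_⟩
  rw [pderiv_sub (hf.differentiable (by simp) x) (differentiableAt_const _), hfu, pderiv_const, sub_zero]

/-- A closed subspace is weakly closed: w minus its projection is orthogonal to every u_j in the
subspace, hence to the weak limit w. -/
lemma mem_topologicalClosure_of_tendsto_inner {H : Type*} [NormedAddCommGroup H]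
    [InnerProductSpace ℂ H] [CompleteSpace H] {U : Submodule ℂ H} {u : ℕ → H}
    (hu : ∀ᶠ j in Filter.atTop, u j ∈ U) {w : H}
    (h : ∀ a : H, Filter.Tendsto (fun j => inner ℂ a (u j)) Filter.atTop (𝓝 (inner ℂ a w))) :
    w ∈ U.topologicalClosure := by
  have : CompleteSpace U.topologicalClosure :=
    (Submodule.isClosed_topologicalClosure _).completeSpace_coe
  set P := U.topologicalClosure.starProjection w with hP
  have hPm : P ∈ U.topologicalClosure := Submodule.starProjection_apply_mem _ _
  have h1 : inner ℂ (w - P) w = 0 := by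
    refine tendsto_nhds_unique (h (w - P)) (tendsto_const_nhds.congr' ?_)
    filter_upwards [hu] with j hj
    exact (Submodule.starProjection_inner_eq_zero (K := U.topologicalClosure) w _
      (Submodule.le_topologicalClosure _ hj)).symm
  have h2 : inner ℂ (w - P) P = 0 := Submodule.starProjection_inner_eq_zero w _ hPm
  have h3 : inner ℂ (w - P) (w - P) = 0 := by rw [inner_sub_right, h1, h2, sub_zero]
  rw [inner_self_eq_zero, sub_eq_zero] at h3
  rw [h3]; exact hPm

lemma isTest_single {f : R3 → ℂ} (hf : IsTest f) (k : Fin 3) :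
    IsTest (fun x => (EuclideanSpace.single k (f x) : C3)) := by
  refine IsTest.of_tsupport_subset hf (contDiff_C3_iff.2 fun i => ?_) (closure_mono fun x hx => ?_)
  · by_cases h : i = k
    · subst h; simpa using hf.1
    · simpa [h] using contDiff_const
  · rw [Function.mem_support] at hx ⊢
    intro h
    exact hx (by rw [h]; simp)

lemma pderiv_single_apply {f : R3 → ℂ} (hf : IsTest f) (k i j : Fin 3) (x : R3) :
    pderiv j (fun x => (EuclideanSpace.single k (f x) : C3)) x i = if i = k then pderiv j f x else 0 := by
  rw [pderiv_apply_C3 ((isTest_single hf k).differentiable x)]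
  by_cases h : i = k
  · subst h; simp
  · simpa [h] using pderiv_const (0 : ℂ) j x

lemma divergence_single {f : R3 → ℂ} (hf : IsTest f) (k : Fin 3) (x : R3) :
    divergence (fun x => (EuclideanSpace.single k (f x) : C3)) x = pderiv k f x := by
  simp [divergence, pderiv_single_apply hf]

lemma dot_single (a : C3) (k : Fin 3) (c : ℂ) : dot a (EuclideanSpace.single k c) = a k * c := by
  simp [dot]

lemma dot_curl_single {f : R3 → ℂ} (hf : IsTest f) (a : C3) (k : Fin 3) (x : R3) :
    dot a (curl (fun x => (EuclideanSpace.single k (f x) : C3)) x)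
      = a (k + 1) * pderiv (k + 2) f x - a (k + 2) * pderiv (k + 1) f x := by
  simp only [dot, curl, pderiv_single_apply hf, Fin.sum_univ_three]
  fin_cases k <;> simp <;> ring

/-- Testing with fields along one coordinate axis turns weak curl-freeness into the symmetry of weak
derivatives, which mollification preserves. -/
lemma integral_coord_mul_pderiv_comm {w : R3 → C3} (hw : MemLp w 2 volume)
    (h : ∀ φ : R3 → C3, IsTest φ → ∫ x, dot (w x) (curl φ x) = 0) {f : R3 → ℂ} (hf : IsTest f)
    (i j : Fin 3) : ∫ x, w x i * pderiv j f x = ∫ x, w x j * pderiv i f x := by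
  have hint : ∀ i j, Integrable (fun x => w x i * pderiv j f x) volume := fun i j =>
    (memLp_coord hw i).integrable_mul ((hf.pderiv j).memLp 2)
  have key : ∀ k : Fin 3, ∫ x, w x (k + 1) * pderiv (k + 2) f x = ∫ x, w x (k + 2) * pderiv (k + 1) f x := by
    intro k
    have h1 := h _ (isTest_single hf k)
    simp only [dot_curl_single hf] at h1
    rw [integral_sub (hint _ _) (hint _ _)] at h1
    exact sub_eq_zero.1 h1
  have k0 := key 0
  have k1 := key 1
  have k2 := key 2
  fin_cases i <;> fin_cases j
  exacts [rfl, k2, k1.symm, k2.symm, rfl, k0, k1, k0.symm, rfl]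

/-- Test functions supported in a ball. -/
noncomputable def ballTests (R : ℝ) : Submodule ℂ (R3 → ℂ) where
  carrier := {ψ | IsTest ψ ∧ Function.support ψ ⊆ closedBall 0 R}
  add_mem' := fun h h' => ⟨h.1.add h'.1, (Function.support_add _ _).trans (Set.union_subset h.2 h'.2)⟩
  zero_mem' := ⟨⟨contDiff_const, HasCompactSupport.zero⟩, by simp⟩
  smul_mem' := fun c _ h => ⟨IsTest.mul_left contDiff_const h.1,
    (Function.support_const_smul_subset c _).trans h.2⟩

lemma inner_toLp_eq_sum {μ : Measure R3} (a : Lp C3 2 μ) {u : R3 → C3} (hu : MemLp u 2 μ) :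
    inner ℂ a (hu.toLp u) = ∑ i, ∫ x, (starRingEnd ℂ) (a x i) * u x i ∂μ := by
  rw [L2.inner_def, ← integral_finsetSum]
  · refine integral_congr_ae ?_
    filter_upwards [hu.coeFn_toLp] with x hx
    rw [hx, inner_eq_dot]
    rfl
  · exact fun i _ => (memLp_coord (Lp.memLp a) i).star.integrable_mul (memLp_coord hu i)

/-- A compactly supported curl-free field in `L²` has a potential in `L²`. -/
lemma exists_isWeakGrad {w : R3 → C3} (hw : MemLp w 2 volume)
    (hcurl : ∀ φ : R3 → C3, IsTest φ → ∫ x, dot (w x) (curl φ x) = 0) {R : ℝ} (hR : 0 ≤ R)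
    (h0 : ∀ x, R < ‖x‖ → w x = 0) : ∃ h, IsWeakGrad h w := by
  obtain ⟨ρ, t, hρ⟩ := exists_isMollifier (0 : R3) one_pos
  have hsm : ∀ j i, ContDiff ℝ (⊤ : ℕ∞) (moll (ρ j) fun x => w x i) := fun j i =>
    contDiff_moll (hρ.isTest j) (memLp_coord hw i)
  have hsymm : ∀ j i l x, pderiv i (moll (ρ j) fun x => w x l) x = pderiv l (moll (ρ j) fun x => w x i) x := by
    intro j i l x
    rw [pderiv_moll (hρ.isTest j) (memLp_coord hw l), pderiv_moll (hρ.isTest j) (memLp_coord hw i),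
      moll_pderiv_eq (hρ.isTest j), moll_pderiv_eq (hρ.isTest j),
      integral_coord_mul_pderiv_comm hw hcurl (isTest_reflect (hρ.isTest j) x) l i]
  -- The mollifier has radius t_j/2, so once t_j < 1 all supports lie in one ball, and a single
  -- Poincaré constant serves every j.
  have hzero : ∀ j, t j < 1 → ∀ i x, R + 1 < ‖x‖ → moll (ρ j) (fun x => w x i) x = 0 := by
    intro j hj i x hx
    refine moll_eq_zero (Filter.Eventually.of_forall fun y hy => ?_)
    have h1 := hρ.norm_lt j _ hy
    rw [smul_zero, add_zero] at h1
    have h2 := norm_sub_norm_le x (x - y)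
    rw [sub_sub_cancel] at h2
    rw [h0 y (by linarith)]; rfl
  have hpot : ∀ j, ∃ f : R3 → ℂ, t j < 1 → f ∈ ballTests (R + 1) ∧
      ∀ i x, pderiv i f x = moll (ρ j) (fun x => w x i) x := by
    intro j
    by_cases hj : t j < 1
    · obtain ⟨f, hf, hs, h⟩ := exists_test_potential_of_closed (hsm j) (hsymm j) (by linarith)
        (hzero j hj)
      exact ⟨f, fun _ => ⟨⟨hf, hs⟩, h⟩⟩
    · exact ⟨0, fun h => absurd h hj⟩
  choose f hf using hpot
  have hw' : MemLp w 2 (volume.restrict Set.univ) := by simpa using hw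
  have ht : ∀ᶠ j in Filter.atTop, t j < 1 := hρ.tendsto.eventually (gt_mem_nhds one_pos)
  have hmem : ∀ j, ∃ u : Lp C3 2 (volume.restrict (Set.univ : Set R3)), t j < 1 →
      u ∈ gradSpace (ballTests (R + 1)) Set.univ ∧
      ∀ a : Lp C3 2 (volume.restrict (Set.univ : Set R3)),
        inner ℂ a u = ∑ i, ∫ x, (starRingEnd ℂ) (a x i) * moll (ρ j) (fun x => w x i) x := by
    intro j
    by_cases hj : t j < 1
    · obtain ⟨hfT, hfg⟩ := hf j hj
      have mg : MemLp (grad (f j)) 2 (volume.restrict Set.univ) := by simpa using hfT.1.grad.memLp 2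
      refine ⟨mg.toLp _, fun _ => ⟨⟨f j, hfT, hfT.1, mg.coeFn_toLp⟩, fun a => ?_⟩⟩
      rw [inner_toLp_eq_sum]
      simp only [Measure.restrict_univ]
      refine Finset.sum_congr rfl fun i _ => ?_
      congr 1 with x
      rw [← hfg]; rfl
    · exact ⟨0, fun h => absurd h hj⟩
  choose u hu using hmem
  -- The mollified fields are gradients of test functions in the fixed ball and converge weakly to
  -- w, so w lies in the closure of these gradients.
  have hcl : hw'.toLp w ∈ (gradSpace (ballTests (R + 1)) Set.univ).topologicalClosure := by
    refine mem_topologicalClosure_of_tendsto_inner (ht.mono fun j hj => (hu j hj).1) fun a => ?_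
    have ha : MemLp a 2 volume := by simpa using Lp.memLp a
    rw [inner_toLp_eq_sum]
    simp only [Measure.restrict_univ]
    refine Filter.Tendsto.congr' (ht.mono fun j hj => ((hu j hj).2 a).symm) ?_
    exact tendsto_finsetSum _ fun i _ =>
      hρ.tendsto_integral_mul_moll (memLp_coord ha i).star (memLp_coord hw i)
  obtain ⟨C, hC⟩ := exists_eLpNorm_le_eLpNorm_grad (isBounded_closedBall (x := (0 : R3)) (r := R + 1))
  obtain ⟨h, hh⟩ := exists_potential_of_mem_closure (T := ballTests (R + 1)) (S := Set.univ)
    ⟨C, fun ψ hψ => by simpa using hC ψ hψ.1 hψ.2⟩ hcl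
  refine ⟨h, by simpa using Lp.memLp h, hw, fun φ hφ j => ?_⟩
  have h1 := hh _ (isTest_single hφ j) fun ψ hψ => by
    simpa using integral_mul_divergence hψ.1.1 (isTest_single hφ j)
  have h2 : ∫ x in Set.univ, dot (hw'.toLp w x) (EuclideanSpace.single j (φ x))
      = ∫ x in Set.univ, w x j * φ x := by
    refine integral_congr_ae ?_
    filter_upwards [hw'.coeFn_toLp] with x hx
    rw [hx, dot_single]
  rw [h2] at h1
  simpa [divergence_single hφ] using h1

end Potential


/-! ### Uniqueness of the shell field. -/

section Uniqueness

/-- A smooth partition of unity on a compact set, subordinate to balls. -/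
lemma exists_partition {T : Set R3} (hT : IsCompact T) {q : R3 → ℝ} (hq : ∀ p ∈ T, 0 < q p) :
    ∃ (s : Finset R3) (ζ : R3 → R3 → ℂ), (∀ p ∈ s, p ∈ T ∧ IsTest (ζ p) ∧ tsupport (ζ p) ⊆ ball p (q p)) ∧
      ∀ x ∈ T, ∑ p ∈ s, ζ p x = 1 := by
  classical
  obtain ⟨s, hs, hcov⟩ := hT.elim_nhds_subcover (fun p => ball p (q p)) fun p hp => ball_mem_nhds p (hq p hp)
  obtain ⟨f, hf⟩ := SmoothPartitionOfUnity.exists_isSubordinate (modelWithCornersSelf ℝ R3) hT.isClosed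
    (fun p : s => ball (p : R3) (q p)) (fun _ => isOpen_ball) (by simpa [Set.iUnion_subtype] using hcov)
  have hts : ∀ p : s, IsTest (fun x => ((f p x : ℝ) : ℂ)) := fun p => IsTest.ofReal
    ⟨(f p).contMDiff.contDiff, HasCompactSupport.of_support_subset_isCompact (isCompact_closedBall (p : R3) (q p))
      ((subset_tsupport _).trans ((hf p).trans ball_subset_closedBall))⟩
  refine ⟨s, fun p x => if h : p ∈ s then ((f ⟨p, h⟩ x : ℝ) : ℂ) else 0, fun p hp => ?_, fun x hx => ?_⟩
  · simp only [dif_pos hp]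
    refine ⟨hs p hp, hts ⟨p, hp⟩, (closure_mono fun x hx => ?_).trans (hf ⟨p, hp⟩)⟩
    simpa using hx
  · have h1 := f.sum_eq_one hx
    rw [finsum_eq_sum_of_fintype] at h1
    rw [← Finset.sum_coe_sort]
    simp only [Finset.coe_mem, dif_pos, Subtype.coe_eta]
    exact_mod_cast h1

lemma IsTest.isWeakGrad {f : R3 → ℂ} (hf : IsTest f) : IsWeakGrad f (CoreShell.grad f) := by
  refine ⟨hf.memLp 2, hf.grad.memLp 2, fun φ hφ j => ?_⟩
  rw [integral_mul_pderiv hf.1 hφ]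
  rfl

lemma IsWeakGrad.sub_const_mul {h g : R3 → ℂ} {w : R3 → C3} (hw : IsWeakGrad h w) (hg : IsTest g) (c : ℂ) :
    IsWeakGrad (fun x => h x - c * g x) (fun x => w x - c • grad g x) := by
  have hcg := (IsTest.mul_left (φ := fun _ => c) contDiff_const hg)
  have h1 := hcg.isWeakGrad
  have e : grad (fun x => c * g x) = fun x => c • grad g x :=
    funext fun x => grad_const_mul c (hg.differentiable x)
  rw [e] at h1
  refine ⟨hw.1.sub h1.1, hw.2.1.sub h1.2.1, fun φ hφ j => ?_⟩
  have mφ := hφ.memLp 2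
  have md := (hφ.pderiv j).memLp 2
  have i1 : Integrable (fun x => h x * pderiv j φ x) volume := hw.1.integrable_mul md
  have i2 : Integrable (fun x => c * g x * pderiv j φ x) volume := h1.1.integrable_mul md
  have i3 : Integrable (fun x => w x j * φ x) volume := (memLp_coord hw.2.1 j).integrable_mul mφ
  have i4 : Integrable (fun x => (c • grad g x) j * φ x) volume :=
    (memLp_coord h1.2.1 j).integrable_mul mφ
  simp only [PiLp.sub_apply, sub_mul]
  rw [integral_sub i1 i2, integral_sub i3 i4, hw.2.2 φ hφ, h1.2.2 φ hφ]
  ring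

lemma memLp_mul_isTest {a f : R3 → ℂ} (ha : MemLp a 2 volume) (hf : IsTest f) :
    MemLp (fun x => a x * f x) 2 volume :=
  MemLp.mul (p := 2) (q := ⊤) (hf.memLp ⊤) ha

/-- A field on `S` which is orthogonal to the gradients of the test functions supported in `S` is
orthogonal to the weak gradients of functions vanishing off `S`, if `S` has the cone property. -/
lemma integral_dot_eq_zero_of_vanishing {S T : Set R3} (hST : S ⊆ T) (hS : IsOpen S) (hT : IsCompact T)
    {a : R3 → C3} (ha : MemLp a 2 volume) (haS : ∀ x ∉ S, a x = 0)
    (hdiv : ∀ ψ : R3 → ℂ, IsTest ψ → tsupport ψ ⊆ S → ∫ x, dot (a x) (grad ψ x) = 0)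
    (hcone : ∀ p ∈ T, ∃ v δ r, HasOuterCone S p v δ r) {h : R3 → ℂ} {w : R3 → C3}
    (hw : IsWeakGrad h w) (hv : ∀ p ∈ T, ∃ s > 0, ∀ᵐ x, x ∈ ball p s → x ∉ S → h x = 0) :
    ∫ x, dot (a x) (w x) = 0 := by
  have hex : ∀ p, ∃ (v : R3) (δ r s : ℝ) (ρ : ℕ → R3 → ℝ) (t : ℕ → ℝ), p ∈ T →
      HasOuterCone S p v δ r ∧ 0 < s ∧ (∀ᵐ x, x ∈ ball p s → x ∉ S → h x = 0) ∧ IsMollifier v δ ρ t := by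
    intro p
    by_cases hp : p ∈ T
    · obtain ⟨v, δ, r, hc⟩ := hcone p hp
      obtain ⟨s, hs, h0⟩ := hv p hp
      obtain ⟨ρ, t, hρ⟩ := exists_isMollifier v hc.delta_pos
      exact ⟨v, δ, r, s, ρ, t, fun _ => ⟨hc, hs, h0, hρ⟩⟩
    · exact ⟨0, 0, 0, 0, 0, 0, fun h => absurd h hp⟩
  choose v δ r s ρ t hex using hex
  obtain ⟨F, ζ, hζ, hζ1⟩ := exists_partition hT (q := fun p => min (r p) (s p / 2)) fun p hp =>
    lt_min (hex p hp).1.r_pos (half_pos (hex p hp).2.1)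
  -- Near each point h is mollified in the direction of the local outer cone, and the pieces are
  -- glued by the partition of unity.
  set ψ : ℕ → R3 → ℂ := fun j x => ∑ p ∈ F, ζ p x * moll (ρ p j) h x with hψ
  have hm : ∀ p ∈ F, ∀ j, IsTest (ρ p j) := fun p hp j => (hex p (hζ p hp).1).2.2.2.isTest j
  have hterm : ∀ p ∈ F, ∀ j, IsTest (fun x => ζ p x * moll (ρ p j) h x) := fun p hp j =>
    (hζ p hp).2.1.mul_right (contDiff_moll (hm p hp j) hw.1)
  have hψt : ∀ j, IsTest (ψ j) := fun j => by
    refine ⟨ContDiff.sum fun p hp => (hterm p hp j).1, ?_⟩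
    refine HasCompactSupport.of_support_subset_isCompact
      (F.isCompact_biUnion fun p hp => (hterm p hp j).2) fun x hx => ?_
    by_contra hx'
    refine hx (Finset.sum_eq_zero fun p hp => ?_)
    by_contra h0
    exact hx' (Set.mem_iUnion₂.2 ⟨p, hp, subset_tsupport _ h0⟩)
  -- At a point off `S`, each term vanishes nearby: either ζ_p does, or the mollification does by
  -- the cone property.
  have hsupp : ∀ᶠ j in Filter.atTop, tsupport (ψ j) ⊆ S := by
    have h1 : ∀ᶠ j in Filter.atTop, ∀ p ∈ F, t p j < r p ∧ t p j * (‖v p‖ + δ p) < s p / 2 := by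
      rw [Filter.eventually_all_finset]
      intro p hp
      obtain ⟨hc, hs, -, hρ⟩ := hex p (hζ p hp).1
      have h2 : Filter.Tendsto (fun j => t p j * (‖v p‖ + δ p)) Filter.atTop (𝓝 0) := by
        simpa using hρ.tendsto.mul_const (‖v p‖ + δ p)
      exact (hρ.tendsto.eventually (gt_mem_nhds hc.r_pos)).and (h2.eventually (gt_mem_nhds (half_pos hs)))
    filter_upwards [h1] with j hj x hx
    by_contra hxS
    refine notMem_tsupport_iff_eventuallyEq.2 ?_ hx
    have h2 : ∀ p ∈ F, ∀ᶠ y in 𝓝 x, ζ p y * moll (ρ p j) h y = 0 := by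
      intro p hp
      by_cases hxp : x ∈ tsupport (ζ p)
      · obtain ⟨hc, hs, h0, hρ⟩ := hex p (hζ p hp).1
        have hb := (hζ p hp).2.2 hxp
        filter_upwards [hc.eventually_moll_eq_zero hρ h0 (hj p hp).1 (hj p hp).2
          (ball_subset_ball (min_le_left _ _) hb) (ball_subset_ball (min_le_right _ _) hb) hxS] with y hy
        rw [hy, mul_zero]
      · filter_upwards [notMem_tsupport_iff_eventuallyEq.1 hxp] with y hy
        rw [hy, Pi.zero_apply, zero_mul]
    filter_upwards [(Filter.eventually_all_finset F).2 h2] with y hy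
    exact Finset.sum_eq_zero hy
  have hζd : ∀ p ∈ F, ∀ i, MemLp (fun x => a x i * pderiv i (ζ p) x) 2 volume := fun p hp i =>
    memLp_mul_isTest (memLp_coord ha i) ((hζ p hp).2.1.pderiv i)
  have hζm : ∀ p ∈ F, ∀ i, MemLp (fun x => a x i * ζ p x) 2 volume := fun p hp i =>
    memLp_mul_isTest (memLp_coord ha i) (hζ p hp).2.1
  have hpd : ∀ j i x, pderiv i (ψ j) x = ∑ p ∈ F, (pderiv i (ζ p) x * moll (ρ p j) h x
      + ζ p x * moll (ρ p j) (fun x => w x i) x) := by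
    intro j i x
    rw [hψ, pderiv_sum F fun p hp => (hterm p hp j).differentiable x]
    refine Finset.sum_congr rfl fun p hp => ?_
    rw [pderiv_mul ((hζ p hp).2.1.differentiable x)
      ((contDiff_moll (hm p hp j) hw.1).differentiable (by simp) x), hw.pderiv_moll (hm p hp j)]
  have hsplit : ∀ j, ∫ x, dot (a x) (grad (ψ j) x) = ∑ i, ∑ p ∈ F,
      ((∫ x, a x i * pderiv i (ζ p) x * moll (ρ p j) h x)
        + ∫ x, a x i * ζ p x * moll (ρ p j) (fun x => w x i) x) := by
    intro j
    have i1 : ∀ i, ∀ p ∈ F, Integrable (fun x => a x i * pderiv i (ζ p) x * moll (ρ p j) h x) volume := by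
      intro i p hp
      have h1 := (memLp_coord ha i).integrable_mul ((((hζ p hp).2.1.pderiv i).mul_right
        (contDiff_moll (hm p hp j) hw.1)).memLp 2)
      refine h1.congr (Filter.Eventually.of_forall fun x => ?_)
      simp [mul_assoc]
    have i2 : ∀ i, ∀ p ∈ F, Integrable (fun x => a x i * ζ p x * moll (ρ p j) (fun x => w x i) x) volume := by
      intro i p hp
      have h1 := (memLp_coord ha i).integrable_mul ((((hζ p hp).2.1).mul_right
        (contDiff_moll (hm p hp j) (memLp_coord hw.2.1 i))).memLp 2)
      refine h1.congr (Filter.Eventually.of_forall fun x => ?_)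
      simp [mul_assoc]
    simp only [dot, grad]
    rw [integral_finsetSum]
    · refine Finset.sum_congr rfl fun i _ => ?_
      have e : ∀ x, a x i * pderiv i (ψ j) x = ∑ p ∈ F, (a x i * pderiv i (ζ p) x * moll (ρ p j) h x
          + a x i * ζ p x * moll (ρ p j) (fun x => w x i) x) := fun x => by
        rw [hpd, Finset.mul_sum]
        exact Finset.sum_congr rfl fun p _ => by ring
      simp only [e]
      have i6 : ∀ p ∈ F, Integrable (fun x => a x i * pderiv i (ζ p) x * moll (ρ p j) h x
          + a x i * ζ p x * moll (ρ p j) (fun x => w x i) x) volume := fun p hp =>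
        (i1 i p hp).add (i2 i p hp)
      rw [integral_finsetSum _ i6]
      exact Finset.sum_congr rfl fun p hp => integral_add (i1 i p hp) (i2 i p hp)
    · exact fun i _ => (memLp_coord ha i).integrable_mul (((hψt j).pderiv i).memLp 2)
  have hlim : Filter.Tendsto (fun j => ∫ x, dot (a x) (grad (ψ j) x)) Filter.atTop
      (𝓝 (∑ i, ∑ p ∈ F, ((∫ x, a x i * pderiv i (ζ p) x * h x) + ∫ x, a x i * ζ p x * w x i))) := by
    simp only [hsplit]
    refine tendsto_finsetSum _ fun i _ => tendsto_finsetSum _ fun p hp => ?_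
    have hρ := (hex p (hζ p hp).1).2.2.2
    exact (hρ.tendsto_integral_mul_moll (hζd p hp i) hw.1).add
      (hρ.tendsto_integral_mul_moll (hζm p hp i) (memLp_coord hw.2.1 i))
  have h0 := tendsto_nhds_unique (tendsto_const_nhds.congr' (hsupp.mono fun j hj =>
    (hdiv _ (hψt j) hj).symm)) hlim
  rw [h0]
  have i3 : ∀ i, Integrable (fun x => a x i * w x i) volume := fun i =>
    (memLp_coord ha i).integrable_mul (memLp_coord hw.2.1 i)
  simp only [dot]
  rw [integral_finsetSum _ fun i _ => i3 i]
  refine Finset.sum_congr rfl fun i _ => ?_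
  have i4 : ∀ p ∈ F, Integrable (fun x => a x i * pderiv i (ζ p) x * h x) volume := fun p hp =>
    (hζd p hp i).integrable_mul hw.1
  have i5 : ∀ p ∈ F, Integrable (fun x => a x i * ζ p x * w x i) volume := fun p hp =>
    (hζm p hp i).integrable_mul (memLp_coord hw.2.1 i)
  have i6 : ∀ p ∈ F, Integrable (fun x => a x i * pderiv i (ζ p) x * h x + a x i * ζ p x * w x i)
    volume := fun p hp => (i4 p hp).add (i5 p hp)
  rw [← Finset.sum_congr rfl fun p hp => integral_add (i4 p hp) (i5 p hp), ← integral_finsetSum _ i6]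
  congr 1 with x
  by_cases hx : x ∈ S
  · have h1 : ∑ p ∈ F, pderiv i (ζ p) x = 0 := by
      rw [← pderiv_sum F fun p hp => (hζ p hp).2.1.differentiable x,
        pderiv_congr_of_eventuallyEq (g := fun _ => (1 : ℂ)), pderiv_const]
      filter_upwards [hS.mem_nhds hx] with y hy
      exact hζ1 y (hST hy)
    have h2 := hζ1 x (hST hx)
    calc a x i * w x i = a x i * h x * ∑ p ∈ F, pderiv i (ζ p) x + a x i * w x i * ∑ p ∈ F, ζ p x := by
          rw [h1, h2]; ring
      _ = _ := by
          rw [Finset.mul_sum, Finset.mul_sum, ← Finset.sum_add_distrib]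
          exact Finset.sum_congr rfl fun p _ => by ring
  · simp [haS x hx]

variable {Ω : Set R3}

lemma conj_dot (a b : C3) : (starRingEnd ℂ) (dot a b) = dot (conjVec a) (conjVec b) := by
  simp [dot]

/-- A field in `H₀(curl)` of the shell without curl, divergence and flux vanishes if the outer boundary
is connected. -/
lemma ae_eq_zero_of_isConnected_frontier (hL : IsLipschitzDomain Ω) (hK : closedBall (0 : R3) 1 ⊆ Ω)
    (hconn : IsConnected (frontier Ω)) {w : R3 → C3} (hw : HCurlZero (shell Ω) w 0)
    (hdiv : ∀ ψ : R3 → ℂ, IsTest ψ → tsupport ψ ⊆ shell Ω → ∫ x in shell Ω, dot (w x) (grad ψ x) = 0)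
    (hflux : ∀ ψ : R3 → ℂ, IsTest ψ → (∀ᶠ x in 𝓝ˢ (frontier Ω), ψ x = 1) →
      Disjoint (tsupport ψ) (closedBall 0 1) → ∫ x in shell Ω, dot (w x) (grad ψ x) = 0) :
    ∀ᵐ x ∂volume.restrict (shell Ω), w x = 0 := by
  have hΩ := hL.1
  have hS := isOpen_shell hΩ
  -- Extension by zero: vanishing tangential trace means that `W` is curl-free across both
  -- boundaries.
  set W : R3 → C3 := (shell Ω).indicator w with hW
  have hWS : ∀ x ∉ shell Ω, W x = 0 := fun x hx => Set.indicator_of_notMem hx _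
  have hWin : ∀ x ∈ shell Ω, W x = w x := fun x hx => Set.indicator_of_mem hx _
  have mW : MemLp W 2 volume := (memLp_indicator_iff_restrict hS.measurableSet).2 hw.1
  have hWint : ∀ A : R3 → C3, ∫ x, dot (W x) (A x) = ∫ x in shell Ω, dot (w x) (A x) := fun A => by
    rw [← setIntegral_eq_integral_of_forall_compl_eq_zero (s := shell Ω) fun x hx => by
      rw [hWS x hx, dot_zero_left]]
    exact setIntegral_congr_fun hS.measurableSet fun x hx => by simp only [hWin x hx]
  have hWc : ∀ A : R3 → C3, ∫ x, dot (conjVec (W x)) (A x)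
      = (starRingEnd ℂ) (∫ x in shell Ω, dot (w x) (conjVec (A x))) := fun A => by
    rw [← hWint fun x => conjVec (A x), ← integral_conj]
    simp only [conj_dot, conjVec_conjVec]
  obtain ⟨R, hR0, hR⟩ : ∃ R : ℝ, 0 ≤ R ∧ ∀ x ∈ closure Ω, ‖x‖ ≤ R := by
    obtain ⟨R, hR⟩ := hL.2.2.1.closure.exists_norm_le
    exact ⟨max R 0, le_max_right _ _, fun x hx => (hR x hx).trans (le_max_left _ _)⟩
  obtain ⟨h, hh⟩ := exists_isWeakGrad mW (fun φ hφ => by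
    rw [hWint]
    have := hw.2.2 φ hφ
    simpa [tangentialPairing, integral_neg] using this) hR0 fun x hx =>
      hWS x fun hxS => hx.not_ge (hR x (subset_closure hxS.1))
  have hW0 : ∀ᵐ x, x ∉ shell Ω → W x = 0 := Filter.Eventually.of_forall hWS
  have hfr : ∀ p ∈ frontier Ω, p ∉ Ω := fun p hp => by rw [hΩ.frontier_eq] at hp; exact hp.2
  obtain ⟨c₁, hc₁⟩ := exists_const_of_isPreconnected hS (isPreconnected_closedBall (x := (0 : R3)) (r := 1))
    (fun p hp => ⟨fun hpS => hpS.2 hp, exists_hasOuterCone_of_mem_closedBall hΩ hK hp⟩) hh hW0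
  obtain ⟨c₀, hc₀⟩ := exists_const_of_isPreconnected hS hconn.isPreconnected
    (fun p hp => ⟨fun hpS => hfr p hp hpS.1, hL.exists_hasOuterCone hK hp⟩) hh hW0
  obtain ⟨χ, hχ, hχΩ, hχ1⟩ := exists_cutoff hΩ hK
  obtain ⟨η, hη, -, hη1⟩ : ∃ η : R3 → ℂ, IsTest η ∧ True ∧ ∀ x ∈ closure Ω, ∀ᶠ y in 𝓝 x, η y = 1 := by
    let b : ContDiffBump (0 : R3) := ⟨R + 1, R + 2, by linarith, by linarith⟩
    refine ⟨fun x => (b x : ℂ), IsTest.ofReal ⟨b.contDiff, b.hasCompactSupport⟩, trivial, fun x hx => ?_⟩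
    have hx' : x ∈ ball (0 : R3) b.rIn := by
      rw [mem_ball_zero_iff]
      have := hR x hx
      change ‖x‖ < R + 1
      linarith
    filter_upwards [isOpen_ball.mem_nhds hx'] with y hy
    rw [b.one_of_mem_closedBall (ball_subset_closedBall hy)]
    simp
  -- Near Ω̄ the subtracted function equals c₁ around the ball and c₀ around ∂Ω, so the corrected
  -- potential vanishes off the shell there.
  have hh' := (hh.sub_const_mul hη c₀).sub_const_mul hχ (c₁ - c₀)
  have hcl : closure Ω = Ω ∪ frontier Ω := by
    rw [hΩ.frontier_eq, Set.union_sdiff_cancel subset_closure]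
  have hcases : ∀ p ∈ closure Ω, p ∈ shell Ω ∨ p ∈ closedBall (0 : R3) 1 ∨ p ∈ frontier Ω := by
    intro p hp
    rw [hcl] at hp
    by_cases hb : p ∈ closedBall (0 : R3) 1
    · exact Or.inr (Or.inl hb)
    · exact hp.elim (fun h => Or.inl ⟨h, hb⟩) fun h => Or.inr (Or.inr h)
  have hzero : ∫ x, dot (conjVec (W x)) (W x - c₀ • grad η x - (c₁ - c₀) • grad χ x) = 0 := by
    refine integral_dot_eq_zero_of_vanishing (T := closure Ω) ((shell_subset Ω).trans subset_closure) hS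
      hL.2.2.1.isCompact_closure (memLp_conjVec mW) (fun x hx => ?_) (fun ψ hψ hs => ?_)
      (fun p hp => ?_) hh' (fun p hp => ?_)
    · ext i; simp [hWS x hx]
    · rw [hWc]
      simp only [← grad_conj hψ]
      rw [hdiv _ hψ.conj ((closure_mono fun x hx => by simpa using hx).trans hs), map_zero]
    · rcases hcases p hp with h1 | h1 | h1
      · exact exists_hasOuterCone_of_mem hS h1
      · exact exists_hasOuterCone_of_mem_closedBall hΩ hK h1
      · exact hL.exists_hasOuterCone hK h1
    · rcases hcases p hp with h1 | h1 | h1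
      · obtain ⟨s, hs, hsS⟩ := Metric.isOpen_iff.1 hS p h1
        exact ⟨s, hs, Filter.Eventually.of_forall fun x hx hxS => absurd (hsS hx) hxS⟩
      · obtain ⟨s, hs, hsc⟩ := hc₁ p h1
        obtain ⟨s', hs', hs1⟩ := Metric.eventually_nhds_iff_ball.1 ((hη1 p hp).and (hχ1 p h1))
        refine ⟨min s s', lt_min hs hs', ?_⟩
        filter_upwards [hsc] with x hx hxs hxS
        obtain ⟨e1, e2⟩ := hs1 x (ball_subset_ball (min_le_right _ _) hxs)
        rw [hx (ball_subset_ball (min_le_left _ _) hxs) hxS, e1, e2]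
        ring
      · obtain ⟨s, hs, hsc⟩ := hc₀ p h1
        have hχ0 : ∀ᶠ y in 𝓝 p, χ y = 0 :=
          notMem_tsupport_iff_eventuallyEq.1 fun h => hfr p h1 (hχΩ h)
        obtain ⟨s', hs', hs1⟩ := Metric.eventually_nhds_iff_ball.1 ((hη1 p hp).and hχ0)
        refine ⟨min s s', lt_min hs hs', ?_⟩
        filter_upwards [hsc] with x hx hxs hxS
        obtain ⟨e1, e2⟩ := hs1 x (ball_subset_ball (min_le_right _ _) hxs)
        rw [hx (ball_subset_ball (min_le_left _ _) hxs) hxS, e1, e2]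
        ring
  -- η - χ̄ equals 1 near ∂Ω and 0 near the ball, and ∇η = 0 in the shell, so this integral is, up
  -- to sign and conjugation, the vanishing flux.
  have hχflux : ∫ x, dot (conjVec (W x)) (grad χ x) = 0 := by
    have h1 := hflux (fun x => η x - (starRingEnd ℂ) (χ x)) (hη.sub hχ.conj) ?_ ?_
    · rw [hWc]
      simp only [← grad_conj hχ]
      have h2 : ∫ x in shell Ω, dot (w x) (grad (fun x => (starRingEnd ℂ) (χ x)) x)
          = -∫ x in shell Ω, dot (w x) (grad (fun x => η x - (starRingEnd ℂ) (χ x)) x) := by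
        rw [← integral_neg]
        refine setIntegral_congr_fun hS.measurableSet fun x hx => ?_
        have h3 := grad_sub (hη.differentiable x) (hχ.conj.differentiable x)
        simp only [h3, grad_zero_of_eventually_const (hη1 x (subset_closure hx.1)), zero_sub]
        rw [dot_comm (w x) (-_), dot_neg_left, neg_neg, dot_comm]
      rw [h2, h1, neg_zero, map_zero]
    · rw [eventually_nhdsSet_iff_forall]
      intro x hx
      filter_upwards [hη1 x (frontier_subset_closure hx),
        notMem_tsupport_iff_eventuallyEq.1 fun h => hfr x hx (hχΩ h)] with y h1 h2
      rw [h1, h2]; simp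
    · refine disjoint_tsupport_of_eventually fun x hx => ?_
      filter_upwards [hη1 x (subset_closure (hK hx)), hχ1 x hx] with y h1 h2
      rw [h1, h2]; simp
  refine ae_eq_zero_of_integral_inner_self hw.1 ?_
  -- Only the χ term survives in the shell. It vanishes by the flux condition, leaving ∫ |W|² = 0.
  have e : ∀ x, dot (conjVec (W x)) (W x - c₀ • grad η x - (c₁ - c₀) • grad χ x)
      = dot (conjVec (W x)) (W x) - (c₁ - c₀) * dot (conjVec (W x)) (grad χ x) := by
    intro x
    by_cases hx : x ∈ shell Ω
    · rw [grad_zero_of_eventually_const (hη1 x (subset_closure hx.1)), smul_zero, sub_zero, dot_sub_right,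
        dot_smul_right]
    · have : conjVec (W x) = 0 := by ext i; simp [hWS x hx]
      simp [this]
  simp only [e] at hzero
  rw [integral_sub (integrable_dot (memLp_conjVec mW) mW) ((integrable_dot (memLp_conjVec mW)
    (hχ.grad.memLp 2)).const_mul _), integral_const_mul, hχflux, mul_zero, sub_zero] at hzero
  rw [← setIntegral_eq_integral_of_forall_compl_eq_zero (s := shell Ω) fun x hx => by
    rw [hWS x hx, dot_zero_right]] at hzero
  rw [← hzero]
  exact setIntegral_congr_fun hS.measurableSet fun x hx => by simp only [hWin x hx, inner_eq_dot]

variable {n : ℕ} {m : ℤ} {k : ℝ}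

/-- Both solutions differ from the same ∇g by curl-free fields of H₀(curl), so their difference is
such a field, with zero divergence and flux. -/
lemma IsShellField.ae_unique (hL : IsLipschitzDomain Ω) (hK : closedBall (0 : R3) 1 ⊆ Ω) (hn : 1 ≤ n)
    {g : R3 → ℂ} (hg : IsTraceLift Ω n m k g) (hconn : IsConnected (frontier Ω)) {Em Em' : R3 → C3}
    (h : IsShellField Ω (Eplus n m k) Em) (h' : IsShellField Ω (Eplus n m k) Em') :
    ∀ᵐ x ∂volume.restrict (shell Ω), Em x = Em' x := by
  obtain ⟨hc, h0⟩ := h.curl_free hL.1 hK hn hg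
  obtain ⟨hc', h0'⟩ := h'.curl_free hL.1 hK hn hg
  have m0 : MemLp (0 : R3 → C3) 2 (volume.restrict (shell Ω)) := MemLp.zero
  have hd : HCurlZero (shell Ω) (fun x => Em x - Em' x) 0 := by
    refine ⟨hc.1.sub hc'.1, m0, fun φ hφ => ?_⟩
    have e := tangentialPairing_sub h0.1 m0 h0'.1 m0 hφ
    simp only [Pi.zero_apply, sub_zero, sub_sub_sub_cancel_right] at e
    refine Eq.trans e ?_
    rw [h0.2.2 φ hφ, h0'.2.2 φ hφ, sub_zero]
  have hint : ∀ ψ : R3 → ℂ, IsTest ψ → ∫ x in shell Ω, dot (Em x - Em' x) (grad ψ x)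
      = (∫ x in shell Ω, dot (Em x) (grad ψ x)) - ∫ x in shell Ω, dot (Em' x) (grad ψ x) := by
    intro ψ hψ
    have mg := (hψ.grad.memLp 2).restrict (shell Ω)
    simp only [dot_sub_left]
    exact integral_sub (integrable_dot hc.1 mg) (integrable_dot hc'.1 mg)
  obtain ⟨-, -, -, -, -, a1, -, -, a2⟩ := h
  obtain ⟨-, -, -, -, -, b1, -, -, b2⟩ := h'
  have := ae_eq_zero_of_isConnected_frontier hL hK hconn hd
    (fun ψ hψ hs => by rw [hint ψ hψ, a1 ψ hψ hs, b1 ψ hψ hs, sub_zero])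
    (fun ψ hψ h1 h2 => by rw [hint ψ hψ, a2 ψ hψ h1 h2, b2 ψ hψ h1 h2, sub_zero])
  filter_upwards [this] with x hx
  exact sub_eq_zero.1 hx

end Uniqueness

end CoreShell

/-! ### Assembly of the theorem. -/

theorem theorem4p4 (n : ℕ) (hn : 1 ≤ n) (m : ℤ) (hm : |m| ≤ (n : ℤ))
    (k : ℝ) (hk : 0 < k) (hkn : sphBessel n k = 0) :
    -- Maxwell's equations in the unit ball, and the overdetermined boundary conditions
    (HCurl core (Eplus n m k) (fun x => (Complex.I * k) • Hplus n m k x) ∧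
      HCurl core (Hplus n m k) (fun x => (-(Complex.I * k)) • Eplus n m k x) ∧
      ∀ ω : R3, ‖ω‖ = 1 → dot (Eplus n m k ω) (toC3 ω) = 0 ∧ Hplus n m k ω = 0) ∧
    ∀ Ω : Set R3, IsLipschitzDomain Ω → closedBall (0 : R3) 1 ⊆ Ω →
      -- existence of the field in the shell, as the gradient of a potential constant on `∂Ω`
      (∃ Em : R3 → C3, IsShellField Ω (Eplus n m k) Em ∧
        ∃ (h : R3 → ℂ) (c : ℂ), IsShellPotential Ω h c Em) ∧
      -- uniqueness
      (IsConnected (frontier Ω) → ∀ Em Em' : R3 → C3,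
        IsShellField Ω (Eplus n m k) Em → IsShellField Ω (Eplus n m k) Em' →
          ∀ᵐ x ∂(volume.restrict (shell Ω)), Em x = Em' x) ∧
      -- the field in the shell is curl-free, and the glued fields are a resonance
      (∀ Em : R3 → C3, IsShellField Ω (Eplus n m k) Em →
        HCurl (shell Ω) Em 0 ∧
        HCurlZero Ω (glue Ω (Eplus n m k) Em)
          (fun x => (Complex.I * k) • glue Ω (Hplus n m k) 0 x) ∧
        IsLimitEigenpair Ω (glue Ω (Eplus n m k) Em) ((k : ℂ) ^ 2)) := by
  refine ⟨⟨hCurl_Eplus hn, hCurl_Hplus hn, fun ω hω => Eplus_Hplus_on_sphere hn hkn hω⟩,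
    fun Ω hL hK => ?_⟩
  obtain ⟨g, hg⟩ := exists_isTraceLift (m := m) hL.1 hK hkn
  exact ⟨exists_isShellField hL.1 hL.2.2.1 hK hn hg,
    fun hconn Em Em' h h' => h.ae_unique hL hK hn hg hconn h',
    fun Em h => ⟨(h.curl_free hL.1 hK hn hg).1, hCurlZero_glue hL.1 hK hn hg h,
      isLimitEigenpair_glue hL.1 hK hn hm hk hkn hg h⟩⟩
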